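/- **Setting.** $\lambda$ is the security parameter; all objects below may depend on it. Let $n=n(\lambda)$, let $D$ be a probability distribution on Pauli strings $w\in\{\mathds 1,X,Z\}^n$, and let $S_0\subseteq\{0,1\}^n$ be a non-empty $\mu$-biased set, i.e. $|\mathbb E_{a\in S_0}(-1)^{a\cdot b}|\le\mu$ for all $b\ne 0$, where $\mu<1$ is a constant. Put $\sigma_w(a)=\bigotimes_i\sigma_{w_i}^{a_i}$ and $\pi^w_u=\bigotimes_i\frac{\mathds 1+(-1)^{u_i}\sigma_{w_i}}2=\mathbb E_{a\in\{0,1\}^n}(-1)^{u\cdot a}\sigma_w(a)$, with $\sigma_{\mathds 1}=\mathds 1$. *Questions.* The Alice questions $\mathcal Q_A$ are $(\mathsf{com},a,b)$ and $(\mathsf{MS},a,b,\ell)$ with $a,b\in S_0$ and $\ell$ a row or column of a $3\times3$ grid, the bases $W\in\{X,Z\}$, the strings $w\in\{\mathds 1,X,Z\}^n$, and $\mathsf{tele}$, encoded as bit strings of one common length polynomial in $\lambda$. The Bob questions are $W\in\{X,Z\}$, $(\mathsf{MS},a,b,j)$ with $j$ a cell of the grid, and $w\in\{\mathds 1,X,Z\}^n$.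 *Compiled game.* Fix a quantum homomorphic encryption scheme $(\mathsf{Gen},\mathsf{Enc},\mathsf{Eval},\mathsf{Dec})$ such that encryptions of any two messages of equal polynomial length are indistinguishable, up to a negligible function, by polynomial-size quantum circuits with quantum advice (this follows from IND-CPA security against such adversaries; no other property of the scheme is used). In the compiled version of a test, the verifier samples a pair $(q,y)$ of questions, $sk\leftarrow\mathsf{Gen}(1^\lambda)$ and $c\leftarrow\mathsf{Enc}_{sk}(q)$, sends $c$, receives $\alpha$, sends $y$, receives Bob's answer, and evaluates the test with $\mathsf{Dec}_{sk}(\alpha)$ as Alice's answer (answers of the wrong format are rejected). *Pauli braiding test.* Choose $a,b\in S_0$ independently and uniformly. If $a\cdot b=0$ (commutation test): ask Alice $(\mathsf{com},a,b)$, getting bits $u_a,u_b$; ask Bob a uniform $W\in\{X,Z\}$, getting $v\in\{0,1\}^n$; accept iff $a\cdot v=u_a$ (for $W=Z$), resp. $b\cdot v=u_b$ (for $W=X$), modulo 2. If $a\cdot b=1$ (anticommutation test, a magic square game): choose a uniform cell $j$ and, with probability $\frac12$ each, its row or its column $\ell$; ask Alice $(\mathsf{MS},a,b,\ell)$, getting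 one bit for each cell of $\ell$; the three bits must have even parity if $\ell$ is a row and odd parity if it is a column. If $j$ is the top centre cell ask Bob $Z$ and compare $a\cdot v$ with Alice's bit for $j$; if $j$ is the centre left cell ask Bob $X$ and compare $b\cdot v$ with it; otherwise ask Bob $(\mathsf{MS},a,b,j)$ and compare his bit with it. *Mixed-versus-pure basis test.* Ask Alice a uniform $W\in\{X,Z\}$, getting $u\in\{0,1\}^n$. With probability $\frac12$ ask Bob $W$, getting $v$, and accept iff $u=v$; with probability $\frac12$ ask Bob $w\sim D$, getting $v$, and accept iff $u_i=v_i$ for all $i$ with $w_i=W$. *Prover.* A prover has a register $\mathcal H$ of qubits, a unit vector $|\psi\rangle\in\mathcal H$, operators $A^c_\alpha$ on $\mathcal H$ such that $\{(A^c_\alpha)^\dagger A^c_\alpha\}_\alpha$ is a projective measurement for each $c$, and a projective measurement on $\mathcal H$ for each Bob question; the measurement for $w$ is written $\{M^w_u\}_{u\in\{0,1\}^n}$, where $M^w_u=0$ whenever $w_i=\mathds 1$ and $u_i=1$ for some $i$. It is efficient if all these operations are done by quantum circuits with polynomially bounded numbers of qubits and gates (the initial state is arbitrary). Put $\psi^{\mathsf{Enc}(q)}=\mathbb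 E_{sk}\mathbb E_{c\leftarrow\mathsf{Enc}_{sk}(q)}\sum_\alpha A^c_\alpha|\psi\rangle\langle\psi|(A^c_\alpha)^\dagger$, $\|A\|_\rho^2=\mathrm{Tr}[A^\dagger A\rho]$, and $O^w(a)=\sum_u(-1)^{a\cdot u}M^w_u$. **Statement.** For every $\mu<1$ there is a constant $K$, depending only on $\mu$, with the following property. If an efficient prover wins the compiled Pauli braiding test and the compiled mixed-versus-pure basis test each with probability at least $1-\epsilon$ (with $\epsilon=\epsilon(\lambda)$), then there are a finite-dimensional Hilbert space $\mathcal H_{\rm aux}$ and an isometry $V:\mathcal H\to\mathbb C^{2^n}\otimes\mathcal H_{\rm aux}$ (for each $\lambda$), and a negligible function $\eta$, such that for all $\lambda$ and every Alice question $q\in\mathcal Q_A$ $$\mathbb E_{w\sim D}\,\mathbb E_{a\in\{0,1\}^n}\big\|O^w(a)-V^\dagger(\sigma_w(a)\otimes\mathds 1_{\rm aux})V\big\|^2_{\psi^{\mathsf{Enc}(q)}}\le K\sqrt\epsilon+\eta(\lambda),$$ and, with the same $V$, for every subset $S\subseteq\{0,1\}^n$ $$\mathbb E_{w\sim D}\sum_{u\in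 S}\big\|M^w_u-V^\dagger(\pi^w_u\otimes\mathds 1_{\rm aux})V\big\|^2_{\psi^{\mathsf{Enc}(q)}}\le K\sqrt\epsilon+\eta(\lambda).$$ -/

import Mathlib

open scoped Matrix Kronecker

namespace CompiledPauli

noncomputable section

/-! ### Bit strings, registers of qubits, expectations -/

/-- Bit strings indexed by `ι`; also the computational basis of a register of qubits with
wires `ι`. -/
abbrev Bits (ι : Type) : Type := ι → Bool

/-- The all-zero string. -/
def zeros (ι : Type) : Bits ι := fun _ => false

/-- Linear operators on the register `(ℂ²)^{⊗ ι}`. -/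
abbrev Op (ι : Type) : Type := Matrix (Bits ι) (Bits ι) ℂ

/-- The number of positions at which both strings are `1`, so that `(-1)^(overlap a b)` is
the sign `(-1)^{a·b}`. -/
def overlap {n : ℕ} (a b : Bits (Fin n)) : ℕ :=
  (Finset.univ.filter fun i => a i = true ∧ b i = true).card

/-- The inner product `a·b` modulo `2`. -/
def dot {n : ℕ} (a b : Bits (Fin n)) : Bool := decide (overlap a b % 2 = 1)

/-- Expectation of a function (with values in a real vector space) of a sample from a
distribution on a finite set. -/
def expect {α E : Type} [Fintype α] [AddCommGroup E] [Module ℝ E] (p : PMF α) (f : α → E) : E :=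
  ∑ a, (p a).toReal • f a

/-- Probability of an event. -/
def prob {α : Type} (p : PMF α) (s : Set α) : ℝ := (p.toOuterMeasure s).toReal

/-- Negligible functions of the security parameter. -/
def Negligible (η : ℕ → ℝ) : Prop :=
  Asymptotics.SuperpolynomialDecay Filter.atTop (fun κ : ℕ => (κ : ℝ)) η

/-- A set `S` of bit strings is `μ`-biased. -/
def IsBiased {n : ℕ} (μ : ℝ) (S : Finset (Bits (Fin n))) : Prop :=
  ∀ b : Bits (Fin n), b ≠ zeros (Fin n) →
    |(∑ a ∈ S, (-1 : ℝ) ^ overlap a b) / (S.card : ℝ)| ≤ μ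

/-! ### Pauli operators -/

/-- A pure basis choice. -/
inductive Basis : Type
  | X
  | Z
  deriving DecidableEq

instance : Fintype Basis := ⟨{Basis.X, Basis.Z}, fun W => by cases W <;> decide⟩

/-- The labels `𝟙, X, Z`. -/
inductive Pauli : Type
  | I
  | X
  | Z
  deriving DecidableEq

instance : Fintype Pauli := ⟨{Pauli.I, Pauli.X, Pauli.Z}, fun W => by cases W <;> decide⟩

/-- The label of a basis. -/
def Basis.toPauli : Basis → Pauli
  | Basis.X => Pauli.X
  | Basis.Z => Pauli.Z

/-- The single-qubit matrices `σ_𝟙 = 𝟙`, `σ_X`, `σ_Z`. -/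
def Pauli.mat : Pauli → Matrix Bool Bool ℂ
  | Pauli.I => 1
  | Pauli.X => Matrix.of fun x y => if x = y then 0 else 1
  | Pauli.Z => Matrix.diagonal fun x => if x then -1 else 1

/-- The tensor product `⊗_i m_i` of single-qubit operators. -/
def tensor {n : ℕ} (m : Fin n → Matrix Bool Bool ℂ) : Op (Fin n) :=
  Matrix.of fun x y => ∏ i, m i (x i) (y i)

/-- `σ_w(a) = ⊗_i σ_{w_i}^{a_i}`. -/
def pauliString {n : ℕ} (w : Fin n → Pauli) (a : Bits (Fin n)) : Op (Fin n) :=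
  tensor fun i => (w i).mat ^ (a i).toNat

/-- `π^w_u = ⊗_i (𝟙 + (-1)^{u_i} σ_{w_i}) / 2`. -/
def pauliProj {n : ℕ} (w : Fin n → Pauli) (u : Bits (Fin n)) : Op (Fin n) :=
  tensor fun i => (1 / 2 : ℂ) • (1 + (-1 : ℂ) ^ (u i).toNat • (w i).mat)

/-- The uniform average over bit strings of length `n`. -/
def avgBits {n : ℕ} {E : Type} [AddCommGroup E] [Module ℝ E] (f : Bits (Fin n) → E) : E :=
  ((2 : ℝ) ^ n)⁻¹ • ∑ a, f a

/-- The projections are also given by `π^w_u = E_a (-1)^{u·a} σ_w(a)`. -/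
theorem pauliProj_eq {n : ℕ} (w : Fin n → Pauli) (u : Bits (Fin n)) :
    pauliProj w u = avgBits fun a => (-1 : ℂ) ^ overlap u a • pauliString w a := by
  ext x y
  have h1 : ∀ i : Fin n, ((1 / 2 : ℂ) • (1 + (-1 : ℂ) ^ (u i).toNat • (w i).mat)) (x i) (y i) =
      ∑ b : Bool, (1 / 2 : ℂ) * ((if u i = true ∧ b = true then -1 else 1) *
        ((w i).mat ^ b.toNat) (x i) (y i)) := by
    intro i
    cases u i <;> simp <;> ring
  have h2 : ∀ a : Bits (Fin n), (-1 : ℂ) ^ overlap u a =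
      ∏ i, (if u i = true ∧ a i = true then -1 else 1) := by
    intro a
    rw [overlap, Finset.prod_ite]
    simp
  simp only [pauliProj, tensor, Matrix.of_apply, h1]
  simp only [avgBits, pauliString, tensor, Matrix.of_apply, Matrix.smul_apply,
    Matrix.sum_apply, h2]
  rw [Fintype.prod_sum, Finset.smul_sum]
  refine Finset.sum_congr rfl fun a _ => ?_
  rw [Finset.prod_mul_distrib, Finset.prod_mul_distrib]
  simp

/-! ### Measurements and the state-dependent norm -/

/-- Projective measurements: mutually orthogonal projections that sum to the identity. -/
structure IsProjMeas {β X : Type} [Fintype β] [Fintype X] [DecidableEq X]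
    (N : β → Matrix X X ℂ) : Prop where
  herm : ∀ b, (N b)ᴴ = N b
  idem : ∀ b, N b * N b = N b
  orth : ∀ b b', b ≠ b' → N b * N b' = 0
  total : ∑ b, N b = 1

/-- The squared state-dependent norm `‖A‖²_ψ = Tr[A† A ψ]`. -/
def stateNormSq {X : Type} [Fintype X] (A ρ : Matrix X X ℂ) : ℝ := (Aᴴ * A * ρ).trace.re

/-! ### Quantum circuits -/

/-- A gate: an arbitrary single-qubit unitary on a target wire, controlled on a (possibly
empty) set of other wires.  These gates include CNOT and all single-qubit gates, and each of
them can be compiled into polynomially many (in the number of controls) of those. -/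
structure Gate (ι : Type) where
  target : ι
  controls : Finset ι
  target_notMem : target ∉ controls
  u : Matrix.unitaryGroup Bool ℂ

/-- The operator of a gate. -/
def Gate.mat {ι : Type} [Fintype ι] [DecidableEq ι] (g : Gate ι) : Op ι :=
  Matrix.of fun x y =>
    if ∀ i ∈ g.controls, y i = true then
      if ∀ i, i ≠ g.target → x i = y i then
        (g.u : Matrix Bool Bool ℂ) (x g.target) (y g.target)
      else 0
    else if x = y then 1 else 0

/-- A circuit is a list of gates; the head of the list is applied first. -/
abbrev Circuit (ι : Type) : Type := List (Gate ι)

/-- The unitary that a circuit computes. -/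
def Circuit.mat {ι : Type} [Fintype ι] [DecidableEq ι] : Circuit ι → Op ι
  | [] => 1
  | g :: C => Circuit.mat C * g.mat

/-- The cost of a circuit: the number of its wires, plus one for each gate and for each
control of a gate. -/
def Circuit.cost {ι : Type} [Fintype ι] (C : Circuit ι) : ℕ :=
  Fintype.card ι + (C.map fun g => 1 + g.controls.card).sum

/-- The measurement `N` on the register `ι`, with outcomes the bit strings on `o`, can be
implemented at cost at most `t`: adjoin ancillas in the zero state, run a circuit, and measure
some wires in the computational basis. -/
def MeasurableAtCost {ι o : Type} [Fintype ι] [DecidableEq ι] [Fintype o]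
    (t : ℕ) (N : Bits o → Op ι) : Prop :=
  ∃ (r : ℕ) (C : Circuit (ι ⊕ Fin r)) (out : o ↪ ι ⊕ Fin r), C.cost ≤ t ∧
    ∀ (v : Bits o) (x y : Bits ι),
      N v x y = ∑ z : Bits (ι ⊕ Fin r),
        if (fun j => z (out j)) = v then
          star (C.mat z (Sum.elim x (zeros (Fin r)))) * C.mat z (Sum.elim y (zeros (Fin r)))
        else 0

/-! ### Encryption -/

/-- The algorithms of a (secret-key, homomorphic) encryption scheme that the verifier of a
compiled game runs.  Evaluation is only ever run by an honest prover and is not part of the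
data.  `dec` takes an arbitrary classical ciphertext to a random classical string. -/
structure EncScheme where
  keyLen : ℕ → ℕ
  ctLen : ℕ → ℕ → ℕ
  gen : ∀ κ, PMF (Bits (Fin (keyLen κ)))
  enc : ∀ (κ : ℕ) {ℓ : ℕ}, Bits (Fin (keyLen κ)) → Bits (Fin ℓ) → PMF (Bits (Fin (ctLen κ ℓ)))
  dec : ∀ κ, Bits (Fin (keyLen κ)) → List Bool → PMF (List Bool)

/-- The probability that the wire `out` is `1` after the circuit `C` was run on the basis
state `c` together with the advice state `φ`. -/
def outputProb {ι W : Type} [Fintype ι] [DecidableEq ι] [Fintype W] [DecidableEq W]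
    (C : Circuit (ι ⊕ W)) (out : ι ⊕ W) (φ : Bits W → ℂ) (c : Bits ι) : ℝ :=
  ∑ z : Bits (ι ⊕ W),
    if z out = true then ‖∑ y : Bits W, C.mat z (Sum.elim c y) * φ y‖ ^ 2 else 0

/-- Indistinguishability of the encryptions of any two messages of equal, polynomially bounded
length, against polynomial-size quantum circuits with quantum advice.  This is implied by
IND-CPA security, where the adversary may in addition query an encryption oracle. -/
def EncScheme.Secure (E : EncScheme) : Prop :=
  ∀ (p : Polynomial ℕ) (ℓ : ℕ → ℕ) (m₀ m₁ : ∀ κ, Bits (Fin (ℓ κ)))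
    (W : ℕ → Type) [∀ κ, Fintype (W κ)] [∀ κ, DecidableEq (W κ)]
    (φ : ∀ κ, Bits (W κ) → ℂ)
    (C : ∀ κ, Circuit (Fin (E.ctLen κ (ℓ κ)) ⊕ W κ))
    (out : ∀ κ, Fin (E.ctLen κ (ℓ κ)) ⊕ W κ),
    (∀ κ, ℓ κ ≤ p.eval κ) → (∀ κ, (C κ).cost ≤ p.eval κ) → (∀ κ, ∑ y, ‖φ κ y‖ ^ 2 = 1) →
    Negligible fun κ =>
      |expect (E.gen κ) (fun sk =>
          expect (E.enc κ sk (m₀ κ)) (outputProb (C κ) (out κ) (φ κ))) -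
        expect (E.gen κ) (fun sk =>
          expect (E.enc κ sk (m₁ κ)) (outputProb (C κ) (out κ) (φ κ)))|

/-! ### Questions -/

/-- A row or a column of the `3 × 3` grid. -/
inductive Line : Type
  | row (i : Fin 3)
  | col (j : Fin 3)

/-- Alice questions, for the set `S` from which the braiding test draws its strings. -/
inductive AliceQ {n : ℕ} (S : Finset (Bits (Fin n))) : Type
  | com (a b : S)
  | ms (a b : S) (l : Line)
  | pure (W : Basis)
  | mixed (w : Fin n → Pauli)
  | tele

/-- The data of the two tests, for each value of the security parameter: the number `n` of
qubits, the set `S`, the distribution `D` on Pauli strings, and an encoding of the Alice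
questions by messages of the encryption scheme. -/
structure TestFamily where
  n : ℕ → ℕ
  S : ∀ κ, Finset (Bits (Fin (n κ)))
  S_nonempty : ∀ κ, (S κ).Nonempty
  D : ∀ κ, PMF (Fin (n κ) → Pauli)
  len : ℕ → ℕ
  len_poly : ∃ p : Polynomial ℕ, ∀ κ, len κ ≤ p.eval κ
  code : ∀ κ, AliceQ (S κ) ↪ Bits (Fin (len κ))

/-! ### Provers -/

/-- A prover for the compiled tests.  Its first measurement depends on the ciphertext only;
its second one depends on the Bob question: `P W` for a pure basis question `W`, `B a b j` for
the question about cell `j` of the magic square, `M w` for the mixed basis question `w`. -/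
structure Prover (E : EncScheme) (T : TestFamily) where
  /-- The number of qubits of the prover's Hilbert space. -/
  m : ℕ → ℕ
  ψ : ∀ κ, Bits (Fin (m κ)) → ℂ
  ψ_norm : ∀ κ, ∑ x, ‖ψ κ x‖ ^ 2 = 1
  /-- The length of the first answer. -/
  ansLen : ℕ → ℕ
  A : ∀ κ, Bits (Fin (E.ctLen κ (T.len κ))) → Bits (Fin (ansLen κ)) → Op (Fin (m κ))
  A_meas : ∀ κ c, IsProjMeas fun α => (A κ c α)ᴴ * A κ c α
  P : ∀ κ, Basis → Bits (Fin (T.n κ)) → Op (Fin (m κ))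
  P_meas : ∀ κ W, IsProjMeas (P κ W)
  B : ∀ κ, T.S κ → T.S κ → Fin 3 × Fin 3 → Bool → Op (Fin (m κ))
  B_meas : ∀ κ a b j, IsProjMeas (B κ a b j)
  M : ∀ κ, (Fin (T.n κ) → Pauli) → Bits (Fin (T.n κ)) → Op (Fin (m κ))
  M_meas : ∀ κ w, IsProjMeas (M κ w)
  /-- The prover answers `0` where it was asked to measure the identity. -/
  M_zero : ∀ κ w u i, w i = Pauli.I → u i = true → M κ w u = 0

namespace Prover

variable {E : EncScheme} {T : TestFamily}

/-- Computational efficiency.  The first measurement is done by one polynomial-size circuit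
that maps `|c⟩|0⟩|0⟩|x⟩` to `∑_α |c⟩|α⟩|0⟩ A^c_α|x⟩`; each second measurement is done by a
circuit of polynomial size, uniformly in the question.  The initial state is arbitrary. -/
def Efficient (P : Prover E T) : Prop :=
  ∃ p : Polynomial ℕ, ∀ κ,
    (∃ (r : ℕ)
        (C : Circuit ((Fin (E.ctLen κ (T.len κ)) ⊕ Fin (P.ansLen κ)) ⊕ (Fin r ⊕ Fin (P.m κ)))),
      C.cost ≤ p.eval κ ∧
      ∀ c c' α s x y,
        C.mat (Sum.elim (Sum.elim c' α) (Sum.elim s x))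
            (Sum.elim (Sum.elim c (zeros _)) (Sum.elim (zeros _) y)) =
          if c' = c ∧ s = zeros _ then P.A κ c α x y else 0) ∧
    (∀ W, MeasurableAtCost (p.eval κ) (P.P κ W)) ∧
    (∀ a b j, MeasurableAtCost (p.eval κ) fun v : Bits Unit => P.B κ a b j (v ())) ∧
    ∀ w, MeasurableAtCost (p.eval κ) (P.M κ w)

/-- The unnormalised post-measurement state `ψ^c_α = A^c_α |ψ⟩⟨ψ| (A^c_α)†`. -/
def postState (P : Prover E T) (κ : ℕ) (c : Bits (Fin (E.ctLen κ (T.len κ))))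
    (α : Bits (Fin (P.ansLen κ))) : Op (Fin (P.m κ)) :=
  P.A κ c α * Matrix.vecMulVec (P.ψ κ) (star (P.ψ κ)) * (P.A κ c α)ᴴ

/-- The state `ψ^{Enc(q)} = E_{sk} E_{c ← Enc_sk(q)} ∑_α ψ^c_α`. -/
def encState (P : Prover E T) (κ : ℕ) (q : AliceQ (T.S κ)) : Op (Fin (P.m κ)) :=
  expect (E.gen κ) fun sk => expect (E.enc κ sk (T.code κ q)) fun c => ∑ α, P.postState κ c α

/-- The probability that the verifier of the compiled game accepts, if the Alice question is
`q` (sent encrypted), the prover applies `N` to answer the Bob question, and `acc` is the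
acceptance predicate on the decrypted first answer and the second answer. -/
def acceptProb (P : Prover E T) (κ : ℕ) (q : AliceQ (T.S κ)) {β : Type} [Fintype β]
    (N : β → Op (Fin (P.m κ))) (acc : List Bool → β → Prop) : ℝ :=
  expect (E.gen κ) fun sk => expect (E.enc κ sk (T.code κ q)) fun c =>
    ∑ α, ∑ v, (N v * P.postState κ c α).trace.re *
      prob (E.dec κ sk (List.ofFn α)) {s | acc s v}

/-- Commutation test. -/
def comWin (P : Prover E T) (κ : ℕ) (a b : T.S κ) : ℝ :=
  (1 / 2) *
    (P.acceptProb κ (AliceQ.com a b) (P.P κ Basis.Z)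
        (fun s v => ∃ ua ub : Bool, s = [ua, ub] ∧ dot a.1 v = ua) +
      P.acceptProb κ (AliceQ.com a b) (P.P κ Basis.X)
        (fun s v => ∃ ua ub : Bool, s = [ua, ub] ∧ dot b.1 v = ub))

/-- The parity which the three answers of Alice must have: the observables of each row
multiply to `1`, those of each column to `-1`. -/
def lineParity : Line → Bool
  | Line.row _ => false
  | Line.col _ => true

/-- One round of the magic square game: Alice is asked the line `l`, in which the cell `j` of
Bob is at position `k`.  For the top centre and the centre left cell, Bob is asked to measure
everything in the `Z` or the `X` basis. -/
def squareRound (P : Prover E T) (κ : ℕ) (a b : T.S κ) (l : Line) (j : Fin 3 × Fin 3)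
    (k : Fin 3) : ℝ :=
  if j = (0, 1) then
    P.acceptProb κ (AliceQ.ms a b l) (P.P κ Basis.Z) fun s v =>
      ∃ u : Bits (Fin 3), s = List.ofFn u ∧ ((u 0 ^^ u 1) ^^ u 2) = lineParity l ∧ dot a.1 v = u k
  else if j = (1, 0) then
    P.acceptProb κ (AliceQ.ms a b l) (P.P κ Basis.X) fun s v =>
      ∃ u : Bits (Fin 3), s = List.ofFn u ∧ ((u 0 ^^ u 1) ^^ u 2) = lineParity l ∧ dot b.1 v = u k
  else
    P.acceptProb κ (AliceQ.ms a b l) (P.B κ a b j) fun s v =>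
      ∃ u : Bits (Fin 3), s = List.ofFn u ∧ ((u 0 ^^ u 1) ^^ u 2) = lineParity l ∧ v = u k

/-- Anticommutation test. -/
def anticomWin (P : Prover E T) (κ : ℕ) (a b : T.S κ) : ℝ :=
  (1 / 9) * ∑ j : Fin 3 × Fin 3,
    (1 / 2) * (P.squareRound κ a b (Line.row j.1) j j.2 +
      P.squareRound κ a b (Line.col j.2) j j.1)

/-- The probability of winning the compiled Pauli braiding test. -/
def braidingWin (P : Prover E T) (κ : ℕ) : ℝ :=
  (1 / ((T.S κ).card : ℝ) ^ 2) * ∑ a : T.S κ, ∑ b : T.S κ,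
    if dot a.1 b.1 = false then P.comWin κ a b else P.anticomWin κ a b

/-- The probability of winning the compiled mixed-versus-pure basis test. -/
def mixedPureWin (P : Prover E T) (κ : ℕ) : ℝ :=
  (1 / 2) * ∑ W : Basis,
    ((1 / 2) * P.acceptProb κ (AliceQ.pure W) (P.P κ W) (fun s v => s = List.ofFn v) +
      (1 / 2) * expect (T.D κ) fun w =>
        P.acceptProb κ (AliceQ.pure W) (P.M κ w) fun s v =>
          ∃ u : Bits (Fin (T.n κ)), s = List.ofFn u ∧ ∀ i, w i = W.toPauli → u i = v i)

/-- The mixed basis observable `O^w(a) = ∑_u (-1)^{a·u} M^w_u`. -/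
def mixedObs (P : Prover E T) (κ : ℕ) (w : Fin (T.n κ) → Pauli) (a : Bits (Fin (T.n κ))) :
    Op (Fin (P.m κ)) :=
  ∑ u, (-1 : ℂ) ^ overlap a u • P.M κ w u

end Prover

end

end CompiledPauli

open CompiledPauli

/-! The argument rests on approximate eigenvectors. The state ψ^{Enc(q)} is split according to the
key, the ciphertext, Alice's answer and its decryption (`Prover.exists_labels`). If the verifier
compares the sign of a Bob observable with the decrypted answer, then on the pieces this observable
acts as that sign, with mean squared error at most four times the losing probability
(`Prover.signErr_le_of_accept`). Signs multiply and commute, so relations between the answers to one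
Alice question become approximate relations between Bob's observables, in the state of that
question.

Encryption carries a relation to the state of every other question. The defect of a relation between
two words is ‖1 ∓ U‖² for a single word U, and ‖1 - U‖² is four times the acceptance probability of
a Hadamard test that takes the ciphertext as input and ψ as advice (`exists_hadamardTest`). Hence it
depends on q only up to a negligible η (`Prover.exists_wordIndist`). Relations in the
state-dependent norm can be multiplied by unitaries on the left for free. Multiplication on the
right by an observable O costs little in a state made of approximate eigenvectors of O, and by
indistinguishability one may pass to such a state and return (`WordModel.gap_append_right`). This
takes the role that moving operators to Alice's tensor factor has for nonlocal games.

With this calculus, the commutation test gives Z(a)X(b) ≈ X(b)Z(a) and the magic square gives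
Z(a)X(b) ≈ -X(b)Z(a), on average over a, b in the small-bias set. The bias condition extends the
relations, first in a and then in b, to all pairs of strings (`IsEnsemble.extend_of_isBiased`,
`Prover.braidGap_le`). The isometry V = ∑_v |v⟩ ⊗ X(v) P^Z_v pulls σ_w(a) back to an average over c
of ± Z(c) X(a_X) Z(c + a_Z), where a_X and a_Z are the parts of a on the X and Z positions of w. The
relations turn this into X(a_X) Z(a_Z) (`stateNormSq_sub_swapIsometry_le`). The mixed-versus-pure
test shows that the prover's O^w(a) = O^w(a_X) O^w(a_Z) is close to the same product.

The bound on observables is linear in ε + η. The bound on projections follows from it by Parseval's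
identity, and min(ε, 1) ≤ √ε gives the stated form. -/

namespace CompiledPauli

noncomputable section

/-! ### Characters of the group of bit strings -/

/-- The sign `(-1)^{a·b}`. -/
def chi {ι : Type} [Fintype ι] (a b : Bits ι) : ℂ :=
  ∏ i, if a i = true ∧ b i = true then -1 else 1

/-- Addition of bit strings. -/
def bxor {ι : Type} (a b : Bits ι) : Bits ι := fun i => a i ^^ b i

theorem neg_one_pow_overlap {n : ℕ} (a b : Bits (Fin n)) :
    (-1 : ℂ) ^ overlap a b = chi a b := by
  rw [overlap, chi, Finset.prod_ite]
  simp

@[simp] theorem bxor_self {ι : Type} (a : Bits ι) : bxor a a = zeros ι := by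
  funext i; simp [bxor, zeros]

@[simp] theorem bxor_zeros {ι : Type} (a : Bits ι) : bxor a (zeros ι) = a := by
  funext i; simp [bxor, zeros]

theorem bxor_comm {ι : Type} (a b : Bits ι) : bxor a b = bxor b a := by
  funext i; simp [bxor, Bool.xor_comm]

theorem bxor_assoc {ι : Type} (a b c : Bits ι) : bxor (bxor a b) c = bxor a (bxor b c) := by
  funext i; simp [bxor]

@[simp] theorem bxor_bxor_self {ι : Type} (a b : Bits ι) : bxor (bxor a b) b = a := by
  rw [bxor_assoc, bxor_self, bxor_zeros]

theorem bxor_eq_zeros_iff {ι : Type} (a b : Bits ι) : bxor a b = zeros ι ↔ a = b := by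
  constructor
  · intro h
    funext i
    have := congrFun h i
    simpa [bxor, zeros] using this
  · rintro rfl
    simp

section chi

variable {ι : Type} [Fintype ι]

theorem chi_comm (a b : Bits ι) : chi a b = chi b a := by
  simp only [chi, and_comm]

theorem chi_bxor_right (a b c : Bits ι) : chi a (bxor b c) = chi a b * chi a c := by
  simp only [chi, bxor, ← Finset.prod_mul_distrib]
  refine Finset.prod_congr rfl fun i _ => ?_
  by_cases ha : a i = true <;> by_cases hb : b i = true <;> by_cases hc : c i = true <;>
    simp [ha, hb, hc]

theorem chi_bxor_left (a b c : Bits ι) : chi (bxor a b) c = chi a c * chi b c := by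
  rw [chi_comm, chi_bxor_right, chi_comm c, chi_comm c]

theorem chi_eq_or (a b : Bits ι) : chi a b = 1 ∨ chi a b = -1 := by
  unfold chi
  refine Finset.prod_induction _ (fun x : ℂ => x = 1 ∨ x = -1) ?_ (Or.inl rfl) ?_
  · rintro x y (rfl | rfl) (rfl | rfl) <;> simp
  · intro i _
    split_ifs <;> simp

theorem chi_mul_self (a b : Bits ι) : chi a b * chi a b = 1 := by
  rcases chi_eq_or a b with h | h <;> simp [h]

theorem star_chi (a b : Bits ι) : star (chi a b) = chi a b := by
  rcases chi_eq_or a b with h | h <;> simp [h]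

theorem chi_zeros_left (b : Bits ι) : chi (zeros ι) b = 1 := by simp [chi, zeros]

variable [DecidableEq ι]

theorem sum_chi (b : Bits ι) :
    ∑ a, chi a b = if b = zeros ι then (2 : ℂ) ^ Fintype.card ι else 0 := by
  have h : ∑ a, chi a b = ∏ i, ∑ x : Bool, (if x = true ∧ b i = true then (-1 : ℂ) else 1) := by
    rw [Fintype.prod_sum]; rfl
  rw [h]
  split_ifs with hb
  · subst hb
    simp [zeros]
  · have : ∃ i, b i = true := by
      by_contra hcon
      push Not at hcon
      exact hb (funext fun i => by simpa [zeros] using hcon i)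
    obtain ⟨i, hi⟩ := this
    exact Finset.prod_eq_zero (Finset.mem_univ i) (by simp [hi])

theorem sum_chi_mul_chi (b c : Bits ι) :
    ∑ a, chi a b * chi a c = if b = c then (2 : ℂ) ^ Fintype.card ι else 0 := by
  simp only [← chi_bxor_right, sum_chi, bxor_eq_zeros_iff]

end chi

/-! ### Vectors, measurements and ensembles -/

section vectors

variable {X : Type} [Fintype X]

/-- The squared Euclidean norm. -/
def nsq (x : X → ℂ) : ℝ := ∑ j, ‖x j‖ ^ 2

theorem nsq_nonneg (x : X → ℂ) : 0 ≤ nsq x := by unfold nsq; positivity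

theorem nsq_eq_dotProduct (x : X → ℂ) : (nsq x : ℂ) = star x ⬝ᵥ x := by
  simp only [nsq, dotProduct, Pi.star_apply, Complex.ofReal_sum]
  refine Finset.sum_congr rfl fun j _ => ?_
  have := Complex.conj_mul' (x j)
  simpa using this.symm

theorem nsq_add_le (x y : X → ℂ) : nsq (x + y) ≤ 2 * nsq x + 2 * nsq y := by
  simp only [nsq, Finset.mul_sum, ← Finset.sum_add_distrib]
  refine Finset.sum_le_sum fun j _ => ?_
  have h := norm_add_le (x j) (y j)
  have h0 := norm_nonneg (x j + y j)
  simp only [Pi.add_apply]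
  nlinarith [sq_nonneg (‖x j‖ - ‖y j‖), norm_nonneg (x j), norm_nonneg (y j)]

theorem nsq_smul (c : ℂ) (x : X → ℂ) : nsq (c • x) = ‖c‖ ^ 2 * nsq x := by
  simp [nsq, Finset.mul_sum, mul_pow]

theorem nsq_neg (x : X → ℂ) : nsq (-x) = nsq x := by simp [nsq]

theorem nsq_sub_le (x y : X → ℂ) : nsq (x - y) ≤ 2 * nsq x + 2 * nsq y := by
  rw [sub_eq_add_neg]
  simpa [nsq_neg] using nsq_add_le x (-y)

theorem nsq_mulVec (A : Matrix X X ℂ) (x : X → ℂ) :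
    (nsq (A *ᵥ x) : ℂ) = star x ⬝ᵥ ((Aᴴ * A) *ᵥ x) := by
  rw [nsq_eq_dotProduct, Matrix.star_mulVec, Matrix.dotProduct_mulVec, Matrix.vecMul_vecMul,
    ← Matrix.dotProduct_mulVec]

theorem nsq_mulVec_of_isometry [DecidableEq X] {A : Matrix X X ℂ} (h : Aᴴ * A = 1) (x : X → ℂ) :
    nsq (A *ᵥ x) = nsq x := by
  have h1 := nsq_mulVec A x
  rw [h, Matrix.one_mulVec, ← nsq_eq_dotProduct] at h1
  exact_mod_cast h1

theorem stateNormSq_vecMulVec (A : Matrix X X ℂ) (x : X → ℂ) :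
    stateNormSq A (Matrix.vecMulVec x (star x)) = nsq (A *ᵥ x) := by
  rw [stateNormSq, Matrix.mul_vecMulVec, Matrix.trace_vecMulVec, dotProduct_comm, ← nsq_mulVec,
    Complex.ofReal_re]

/-- Convexity of the squared norm. -/
theorem nsq_sum_smul_le {J : Type} [Fintype J] (c : J → ℝ) (hc : ∀ j, 0 ≤ c j)
    (hc1 : ∑ j, c j = 1) (x : J → X → ℂ) :
    nsq (∑ j, (c j : ℂ) • x j) ≤ ∑ j, c j * nsq (x j) := by
  simp only [nsq, Finset.mul_sum]
  rw [Finset.sum_comm]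
  refine Finset.sum_le_sum fun k _ => ?_
  have h1 : ‖(∑ j, (c j : ℂ) • x j) k‖ ≤ ∑ j, c j * ‖x j k‖ := by
    rw [Finset.sum_apply]
    refine (norm_sum_le _ _).trans (Finset.sum_le_sum fun j _ => ?_)
    simp [abs_of_nonneg (hc j)]
  calc ‖(∑ j, (c j : ℂ) • x j) k‖ ^ 2 ≤ (∑ j, c j * ‖x j k‖) ^ 2 := by gcongr
    _ ≤ ∑ j, c j * ‖x j k‖ ^ 2 := by
      have := (convexOn_pow (𝕜 := ℝ) 2).map_sum_le (t := Finset.univ) (w := c) (p := fun j => ‖x j k‖)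
        (fun j _ => hc j) hc1 (fun j _ => by simp)
      simpa using this

/-- Parseval's identity. -/
theorem sum_nsq_chi {n : ℕ} (x : Bits (Fin n) → X → ℂ) :
    ∑ u, nsq (((2 : ℂ) ^ n)⁻¹ • ∑ a, chi u a • x a) = ((2 : ℝ) ^ n)⁻¹ * ∑ a, nsq (x a) := by
  have key : ∀ j : X, ∑ u : Bits (Fin n), ‖∑ a, chi u a * x a j‖ ^ 2 =
      (2 : ℝ) ^ n * ∑ a, ‖x a j‖ ^ 2 := by
    intro j
    have h1 : ∀ u : Bits (Fin n), ((‖∑ a, chi u a * x a j‖ ^ 2 : ℝ) : ℂ) =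
        ∑ a, ∑ b, (chi u a * chi u b) * (star (x a j) * x b j) := by
      intro u
      have := Complex.conj_mul' (∑ a, chi u a * x a j)
      push_cast
      rw [← this, map_sum, Finset.sum_mul_sum]
      refine Finset.sum_congr rfl fun a _ => Finset.sum_congr rfl fun b _ => ?_
      rw [map_mul]
      have := star_chi u a
      simp only [Complex.star_def] at this ⊢
      rw [this]; ring
    have h2 : ((∑ u : Bits (Fin n), ‖∑ a, chi u a * x a j‖ ^ 2 : ℝ) : ℂ) =
        ((2 : ℝ) ^ n * ∑ a, ‖x a j‖ ^ 2 : ℝ) := by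
      rw [Complex.ofReal_sum]
      simp only [h1]
      rw [Finset.sum_comm]
      simp only [Complex.ofReal_mul, Complex.ofReal_sum, Finset.mul_sum]
      refine Finset.sum_congr rfl fun a _ => ?_
      rw [Finset.sum_comm]
      simp only [← Finset.sum_mul, sum_chi_mul_chi]
      have := Complex.conj_mul' (x a j)
      simp [this]
    exact_mod_cast h2
  simp only [nsq_smul]
  simp only [nsq, Finset.sum_apply, Pi.smul_apply, smul_eq_mul]
  rw [← Finset.mul_sum, Finset.sum_comm]
  simp only [key, ← Finset.mul_sum]
  rw [Finset.sum_comm]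
  simp
  field_simp

end vectors

section ensembles

variable {X : Type} [Fintype X]

/-- A decomposition of a state into pure states `v i` with weights `p i`. -/
structure IsEnsemble {I : Type} [Fintype I] (ρ : Matrix X X ℂ) (p : I → ℝ) (v : I → X → ℂ) :
    Prop where
  nonneg : ∀ i, 0 ≤ p i
  eq_sum : ρ = ∑ i, (p i : ℂ) • Matrix.vecMulVec (v i) (star (v i))

theorem IsEnsemble.stateNormSq_eq {I : Type} [Fintype I] {ρ : Matrix X X ℂ} {p : I → ℝ}
    {v : I → X → ℂ} (h : IsEnsemble ρ p v) (A : Matrix X X ℂ) :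
    stateNormSq A ρ = ∑ i, p i * nsq (A *ᵥ v i) := by
  simp only [← stateNormSq_vecMulVec]
  rw [h.eq_sum, stateNormSq, Finset.mul_sum, Matrix.trace_sum, Complex.re_sum]
  refine Finset.sum_congr rfl fun i _ => ?_
  rw [Matrix.mul_smul, Matrix.trace_smul, smul_eq_mul, Complex.re_ofReal_mul, stateNormSq]

end ensembles

section measurements

variable {β X : Type} [Fintype β]

/-- The observable that assigns the value `f v` to the outcome `v`. -/
def obs (N : β → Matrix X X ℂ) (f : β → ℂ) : Matrix X X ℂ := ∑ v, f v • N v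

theorem obs_sub (N : β → Matrix X X ℂ) (f g : β → ℂ) :
    obs N f - obs N g = obs N (fun v => f v - g v) := by
  simp [obs, sub_smul]

variable [Fintype X] [DecidableEq X] {N : β → Matrix X X ℂ}

theorem IsProjMeas.obs_one (h : IsProjMeas N) : obs N (fun _ => 1) = 1 := by
  simp [obs, h.total]

theorem IsProjMeas.obs_const (h : IsProjMeas N) (c : ℂ) : obs N (fun _ => c) = c • 1 := by
  simp [obs, ← Finset.smul_sum, h.total]

theorem IsProjMeas.obs_mul [DecidableEq β] (h : IsProjMeas N) (f g : β → ℂ) :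
    obs N f * obs N g = obs N (fun v => f v * g v) := by
  simp only [obs, Finset.sum_mul, Finset.mul_sum, Matrix.smul_mul, Matrix.mul_smul, smul_smul]
  refine Finset.sum_congr rfl fun v _ => ?_
  rw [Finset.sum_eq_single v]
  · rw [h.idem, mul_comm]
  · intro w _ hw
    rw [h.orth _ _ hw, smul_zero]
  · simp

theorem IsProjMeas.obs_conjTranspose (h : IsProjMeas N) (f : β → ℂ) :
    (obs N f)ᴴ = obs N (fun v => star (f v)) := by
  simp [obs, Matrix.conjTranspose_sum, Matrix.conjTranspose_smul, h.herm]

theorem IsProjMeas.nsq_obs [DecidableEq β] (h : IsProjMeas N) (f : β → ℂ) (x : X → ℂ) :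
    nsq (obs N f *ᵥ x) = ∑ v, ‖f v‖ ^ 2 * nsq (N v *ᵥ x) := by
  have key : (nsq (obs N f *ᵥ x) : ℂ) = ((∑ v, ‖f v‖ ^ 2 * nsq (N v *ᵥ x) : ℝ) : ℂ) := by
    rw [nsq_mulVec, h.obs_conjTranspose, h.obs_mul, obs, Matrix.sum_mulVec, dotProduct_sum]
    push_cast
    refine Finset.sum_congr rfl fun v _ => ?_
    rw [nsq_mulVec, h.herm, h.idem, Matrix.smul_mulVec, dotProduct_smul, smul_eq_mul]
    have := Complex.conj_mul' (f v)
    simp only [Complex.star_def, this]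
  exact_mod_cast key

theorem IsProjMeas.sum_nsq [DecidableEq β] (h : IsProjMeas N) (x : X → ℂ) :
    ∑ v, nsq (N v *ᵥ x) = nsq x := by
  have := h.nsq_obs (fun _ => 1) x
  rw [h.obs_one] at this
  simpa using this.symm

theorem IsProjMeas.trace_mul_vecMulVec (h : IsProjMeas N) (v : β) (x : X → ℂ) :
    (N v * Matrix.vecMulVec x (star x)).trace.re = nsq (N v *ᵥ x) := by
  rw [← stateNormSq_vecMulVec, stateNormSq, h.herm, h.idem]

end measurements

/-! ### Calculus of circuits -/

theorem sum_bits_sum {ι ρ E : Type} [Fintype ι] [Fintype ρ] [DecidableEq ι] [DecidableEq ρ]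
    [AddCommMonoid E] (f : Bits (ι ⊕ ρ) → E) : ∑ z, f z = ∑ x, ∑ y, f (Sum.elim x y) := by
  rw [← Fintype.sum_prod_type']
  exact Fintype.sum_equiv (Equiv.sumArrowEquivProdArrow ι ρ Bool) _ _ fun z => by
    simp [Equiv.sumArrowEquivProdArrow]

theorem sum_bits_unit {E : Type} [AddCommMonoid E] (f : Bits Unit → E) :
    ∑ z, f z = f (fun _ => true) + f (fun _ => false) := by
  rw [← Fintype.sum_equiv (Equiv.funUnique Unit Bool).symm (fun b => f fun _ => b) f
    fun b => by rfl]
  simp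

section circuits

variable {ι κ : Type} [DecidableEq ι] [DecidableEq κ]

/-- The number of gates and controls of a circuit. -/
def Circuit.gateCost (C : Circuit ι) : ℕ := (C.map fun g => 1 + g.controls.card).sum

/-- Relabelling of the wires of a gate. -/
def Gate.relabel (e : ι ↪ κ) (g : Gate ι) : Gate κ where
  target := e g.target
  controls := g.controls.map e
  target_notMem := by simpa using g.target_notMem
  u := g.u

/-- Relabelling of the wires of a circuit. -/
def Circuit.relabel (e : ι ↪ κ) (C : Circuit ι) : Circuit κ := List.map (Gate.relabel e) C

/-- The inverse gate. -/
def Gate.inv (g : Gate ι) : Gate ι where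
  target := g.target
  controls := g.controls
  target_notMem := g.target_notMem
  u := g.u⁻¹

/-- The inverse circuit. -/
def Circuit.inv (C : Circuit ι) : Circuit ι := (List.map Gate.inv C).reverse

omit [DecidableEq ι] in
theorem Circuit.gateCost_append (C D : Circuit ι) :
    Circuit.gateCost (C ++ D) = Circuit.gateCost C + Circuit.gateCost D := by
  simp [Circuit.gateCost]

omit [DecidableEq ι] [DecidableEq κ] in
theorem Circuit.gateCost_relabel (e : ι ↪ κ) (C : Circuit ι) :
    Circuit.gateCost (Circuit.relabel e C) = Circuit.gateCost C := by
  simp only [Circuit.gateCost, Circuit.relabel, List.map_map]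
  congr 1
  refine List.map_congr_left fun g _ => ?_
  simp [Gate.relabel]

omit [DecidableEq ι] in
theorem Circuit.gateCost_inv (C : Circuit ι) :
    Circuit.gateCost (Circuit.inv C) = Circuit.gateCost C := by
  simp only [Circuit.gateCost, Circuit.inv, List.map_reverse, List.sum_reverse, List.map_map]
  rfl

variable [Fintype ι] [Fintype κ]

omit [DecidableEq ι] in
theorem Circuit.cost_eq (C : Circuit ι) :
    Circuit.cost C = Fintype.card ι + Circuit.gateCost C := rfl

theorem Circuit.mat_append (C D : Circuit ι) :
    Circuit.mat (C ++ D) = Circuit.mat D * Circuit.mat C := by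
  induction C with
  | nil => simp [Circuit.mat]
  | cons g C ih => simp [Circuit.mat, ih, Matrix.mul_assoc]

theorem Gate.mat_relabel (e : ι ↪ κ) (g : Gate ι) (x y : Bits κ) :
    (g.relabel e).mat x y =
      if ∀ k ∉ Set.range e, x k = y k then g.mat (x ∘ e) (y ∘ e) else 0 := by
  have h1 : (∀ i ∈ (g.relabel e).controls, y i = true) ↔
      ∀ i ∈ g.controls, (y ∘ e) i = true := by simp [Gate.relabel]
  have h2 : (∀ i, i ≠ (g.relabel e).target → x i = y i) ↔
      (∀ k ∉ Set.range e, x k = y k) ∧ ∀ i, i ≠ g.target → (x ∘ e) i = (y ∘ e) i := by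
    simp only [Gate.relabel]
    constructor
    · intro h
      refine ⟨fun k hk => h k fun hk' => hk ⟨_, hk'.symm⟩, fun i hi => h _ fun hi' => hi ?_⟩
      exact e.injective hi'
    · rintro ⟨h, h'⟩ k hk
      by_cases hr : k ∈ Set.range e
      · obtain ⟨i, rfl⟩ := hr
        exact h' i fun hi => hk (by rw [hi])
      · exact h k hr
  have h3 : x = y ↔ (∀ k ∉ Set.range e, x k = y k) ∧ x ∘ e = y ∘ e := by
    constructor
    · rintro rfl
      simp
    · rintro ⟨h, h'⟩
      funext k
      by_cases hr : k ∈ Set.range e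
      · obtain ⟨i, rfl⟩ := hr
        exact congrFun h' i
      · exact h k hr
  simp only [Gate.mat, Matrix.of_apply, h1, h2, h3, ite_and]
  simp only [Gate.relabel, Function.comp_apply]
  split_ifs <;> rfl

omit [DecidableEq ι] [DecidableEq κ] [Fintype ι] [Fintype κ] in
theorem extend_comp_self (e : ι ↪ κ) (x : Bits κ) :
    Function.extend e (x ∘ e) x = x := by
  funext k
  by_cases hr : k ∈ Set.range e
  · obtain ⟨i, rfl⟩ := hr
    simp [e.injective.extend_apply]
  · rw [Function.extend_apply' _ _ _ (by simpa using hr)]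

/-- Sums over the strings that agree with `y` outside the range of `e`. -/
theorem sum_ite_agree {E : Type} [AddCommMonoid E] (e : ι ↪ κ) (y : Bits κ) (f : Bits κ → E)
    [∀ z : Bits κ, Decidable (∀ k ∉ Set.range e, z k = y k)] :
    (∑ z, if ∀ k ∉ Set.range e, z k = y k then f z else 0) =
      ∑ w : Bits ι, f (Function.extend e w y) := by
  symm
  refine Fintype.sum_of_injective (fun w : Bits ι => Function.extend e w y) ?_ _
    (fun z => if ∀ k ∉ Set.range e, z k = y k then f z else 0) ?_ ?_
  · intro w w' h
    funext i
    have := congrFun h (e i)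
    simpa [e.injective.extend_apply] using this
  · intro z hz
    rw [if_neg]
    intro h
    refine hz ⟨z ∘ e, ?_⟩
    funext k
    by_cases hr : k ∈ Set.range e
    · obtain ⟨i, rfl⟩ := hr
      simp [e.injective.extend_apply]
    · simp only
      rw [Function.extend_apply' _ _ _ (by simpa using hr), h k hr]
  · intro w
    rw [if_pos]
    intro k hr
    rw [Function.extend_apply' _ _ _ (by simpa using hr)]

/-- A relabelled circuit is the old one tensored with the identity on the wires outside the range of
`e`. In the induction, the intermediate strings that contribute agree with `y` off that range, so
they are parametrised by their restriction to `ι`. -/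
theorem Circuit.mat_relabel (e : ι ↪ κ) (C : Circuit ι) (x y : Bits κ) :
    Circuit.mat (Circuit.relabel e C) x y =
      if ∀ k ∉ Set.range e, x k = y k then Circuit.mat C (x ∘ e) (y ∘ e) else 0 := by
  classical
  induction C generalizing x y with
  | nil =>
    simp only [Circuit.relabel, List.map_nil, Circuit.mat, Matrix.one_apply, ← ite_and]
    congr 1
    rw [eq_iff_iff]
    constructor
    · rintro rfl
      simp
    · rintro ⟨h, h'⟩
      rw [← extend_comp_self e x, ← extend_comp_self e y, h']
      funext k
      by_cases hr : k ∈ Set.range e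
      · obtain ⟨i, rfl⟩ := hr
        simp [e.injective.extend_apply]
      · rw [Function.extend_apply' _ _ _ (by simpa using hr),
          Function.extend_apply' _ _ _ (by simpa using hr), h k hr]
  | cons g C ih =>
    have h1 : Circuit.relabel e (g :: C) = g.relabel e :: Circuit.relabel e C := rfl
    rw [h1]
    simp only [Circuit.mat, Matrix.mul_apply, ih, Gate.mat_relabel, mul_ite, mul_zero]
    rw [sum_ite_agree e y fun z => (if ∀ k ∉ Set.range e, x k = z k then
      Circuit.mat C (x ∘ e) (z ∘ e) else 0) * g.mat (z ∘ e) (y ∘ e)]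
    have h2 : ∀ w : Bits ι, (∀ k ∉ Set.range e, x k = Function.extend e w y k) ↔
        ∀ k ∉ Set.range e, x k = y k := by
      intro w
      refine forall₂_congr fun k hr => ?_
      rw [Function.extend_apply' _ _ _ (by simpa using hr)]
    simp only [h2, Function.extend_comp e.injective]
    split_ifs <;> simp

theorem Circuit.relabel_mulVec (e : ι ↪ κ) (C : Circuit ι) (φ : Bits κ → ℂ) (x : Bits κ) :
    (Circuit.mat (Circuit.relabel e C) *ᵥ φ) x =
      ∑ w : Bits ι, Circuit.mat C (x ∘ e) w * φ (Function.extend e w x) := by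
  classical
  simp only [Matrix.mulVec, dotProduct, Circuit.mat_relabel, ite_mul, zero_mul]
  simp only [show ∀ z : Bits κ, (∀ k ∉ Set.range e, x k = z k) ↔ ∀ k ∉ Set.range e, z k = x k from
    fun z => forall₂_congr fun k _ => eq_comm]
  rw [sum_ite_agree e x fun z => Circuit.mat C (x ∘ e) (z ∘ e) * φ z]
  simp only [Function.extend_comp e.injective]

theorem Gate.mat_of_agree {g : Gate ι} {x y : Bits ι} (h : ∀ i ∈ g.controls, y i = true)
    (h' : ∀ i, i ≠ g.target → x i = y i) :
    g.mat x y = (g.u : Matrix Bool Bool ℂ) (x g.target) (y g.target) := by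
  rw [Gate.mat, Matrix.of_apply, if_pos h, if_pos h']

theorem Gate.mat_of_not_agree {g : Gate ι} {x y : Bits ι}
    (h' : ¬ ∀ i, i ≠ g.target → x i = y i) : g.mat x y = 0 := by
  have hne : x ≠ y := by rintro rfl; exact h' fun _ _ => rfl
  rw [Gate.mat, Matrix.of_apply, if_neg h', if_neg hne, ite_self]

theorem Gate.mat_of_not_controls {g : Gate ι} {x y : Bits ι}
    (h : ¬ ∀ i ∈ g.controls, y i = true) : g.mat x y = (1 : Op ι) x y := by
  rw [Gate.mat, Matrix.of_apply, if_neg h, Matrix.one_apply]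

theorem Gate.mat_inv (g : Gate ι) : g.inv.mat = g.matᴴ := by
  ext x y
  rw [Matrix.conjTranspose_apply]
  by_cases hxy : ∀ i, i ≠ g.target → x i = y i
  · have hyx : ∀ i, i ≠ g.target → y i = x i := fun i hi => (hxy i hi).symm
    have hc : (∀ i ∈ g.controls, y i = true) ↔ ∀ i ∈ g.controls, x i = true := by
      refine forall₂_congr fun i hi => ?_
      rw [hxy i fun h => g.target_notMem (h ▸ hi)]
    by_cases h : ∀ i ∈ g.controls, y i = true
    · rw [Gate.mat_of_agree (g := g.inv) h hxy, Gate.mat_of_agree (hc.1 h) hyx]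
      rfl
    · rw [Gate.mat_of_not_controls (g := g.inv) h, Gate.mat_of_not_controls (hc.not.1 h),
        ← Matrix.conjTranspose_apply, Matrix.conjTranspose_one]
  · have hyx : ¬ ∀ i, i ≠ g.target → y i = x i := fun h => hxy fun i hi => (h i hi).symm
    rw [Gate.mat_of_not_agree (g := g.inv) hxy, Gate.mat_of_not_agree hyx, star_zero]

theorem Gate.mul_mat_apply (g : Gate ι) (A : Op ι) (x y : Bits ι) :
    (A * g.mat) x y = if ∀ i ∈ g.controls, y i = true then
      ∑ b, A x (Function.update y g.target b) * (g.u : Matrix Bool Bool ℂ) b (y g.target)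
      else A x y := by
  rw [Matrix.mul_apply]
  split_ifs with h
  · simp only [Gate.mat, Matrix.of_apply, if_pos h]
    symm
    refine Fintype.sum_of_injective (fun b => Function.update y g.target b) ?_ _ _ ?_ ?_
    · intro b b' hb
      have := congrFun hb g.target
      simpa using this
    · intro z hz
      rw [if_neg, mul_zero]
      intro hz'
      refine hz ⟨z g.target, ?_⟩
      funext i
      by_cases hi : i = g.target
      · subst hi; simp
      · simp [hi, hz' i hi]
    · intro b
      rw [if_pos]
      · simp
      · intro i hi
        simp [hi]
  · simp [Gate.mat, h]

theorem Gate.mat_unitary (g : Gate ι) : g.matᴴ * g.mat = 1 := by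
  rw [← Gate.mat_inv]
  ext x y
  rw [Gate.mul_mat_apply]
  have hu : ((g.u⁻¹ : Matrix.unitaryGroup Bool ℂ) : Matrix Bool Bool ℂ) * g.u = 1 := by
    rw [← Matrix.UnitaryGroup.mul_val, inv_mul_cancel]
    rfl
  have hup : ∀ b, (∀ i ∈ g.controls, Function.update y g.target b i = true) ↔
      ∀ i ∈ g.controls, y i = true := by
    intro b
    refine forall₂_congr fun i hi => ?_
    rw [Function.update_of_ne (by rintro rfl; exact g.target_notMem hi)]
  split_ifs with h
  · by_cases hxy : ∀ i, i ≠ g.target → x i = y i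
    · have h2 : ∀ b, g.inv.mat x (Function.update y g.target b) =
          ((g.u⁻¹ : Matrix.unitaryGroup Bool ℂ) : Matrix Bool Bool ℂ) (x g.target) b := by
        intro b
        rw [Gate.mat_of_agree (g := g.inv) ((hup b).2 h)]
        · simp only [Gate.inv, Function.update_self]
        · intro i hi
          have hi' : i ≠ g.target := hi
          rw [Function.update_of_ne hi', hxy i hi']
      have h3 := congrFun₂ hu (x g.target) (y g.target)
      rw [Matrix.mul_apply] at h3
      simp only [h2]
      rw [h3, Matrix.one_apply, Matrix.one_apply]
      congr 1
      rw [eq_iff_iff]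
      constructor
      · intro ht
        funext i
        by_cases hi : i = g.target
        · rw [hi, ht]
        · exact hxy i hi
      · rintro rfl
        rfl
    · have h2 : ∀ b, g.inv.mat x (Function.update y g.target b) = 0 := by
        intro b
        refine Gate.mat_of_not_agree fun hb => hxy fun i hi => ?_
        rw [hb i hi, Function.update_of_ne hi]
      have hne : x ≠ y := by rintro rfl; exact hxy fun _ _ => rfl
      simp [h2, hne]
  · exact Gate.mat_of_not_controls (g := g.inv) h

theorem Circuit.mat_unitary (C : Circuit ι) : (Circuit.mat C)ᴴ * Circuit.mat C = 1 := by
  induction C with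
  | nil => simp [Circuit.mat]
  | cons g C ih =>
    rw [Circuit.mat, Matrix.conjTranspose_mul, Matrix.mul_assoc,
      ← Matrix.mul_assoc (Circuit.mat C)ᴴ, ih, Matrix.one_mul, Gate.mat_unitary]

theorem Circuit.mat_inv (C : Circuit ι) : Circuit.mat (Circuit.inv C) = (Circuit.mat C)ᴴ := by
  induction C with
  | nil => simp [Circuit.mat, Circuit.inv]
  | cons g C ih =>
    have : Circuit.inv (g :: C) = Circuit.inv C ++ [g.inv] := by simp [Circuit.inv]
    rw [this, Circuit.mat_append, ih]
    simp [Circuit.mat, Gate.mat_inv]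

end circuits

/-! ### Controlled observables and the Hadamard test -/

/-- The operator `U` on the register `ι` can be applied, controlled on a qubit, by a circuit with
`r` ancillas, which start and end in the zero state, and with gate cost at most `g`. -/
def ControlledAtCost {ι : Type} [Fintype ι] [DecidableEq ι] (r g : ℕ) (U : Op ι) : Prop :=
  ∃ C : Circuit (Unit ⊕ (ι ⊕ Fin r)), C.gateCost ≤ g ∧
    ∀ (u' u : Bits Unit) (x y : Bits ι) (s : Bits (Fin r)),
      C.mat (Sum.elim u' (Sum.elim x s)) (Sum.elim u (Sum.elim y (zeros _))) =
        if u' = u ∧ s = zeros _ then (if u () = true then U else 1) x y else 0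

section controlled

variable {ι : Type} [Fintype ι] [DecidableEq ι]

theorem sum_ite_eq_zeros {ρ E : Type} [Fintype ρ] [DecidableEq ρ] [AddCommMonoid E]
    (f : Bits ρ → E) : (∑ s, if s = zeros ρ then f s else 0) = f (zeros ρ) := by
  simp

theorem ControlledAtCost.one (r : ℕ) : ControlledAtCost r 0 (1 : Op ι) := by
  refine ⟨[], by simp [Circuit.gateCost], fun u' u x y s => ?_⟩
  simp only [Circuit.mat, ite_self, Matrix.one_apply, ← ite_and, Sum.elim_eq_iff]
  congr 1
  rw [eq_iff_iff]
  tauto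

/-- Since the ancillas return to zero, the second circuit can reuse those of the first: the gate
costs add and the number of wires does not grow. -/
theorem ControlledAtCost.mul {r g₁ g₂ : ℕ} {U₁ U₂ : Op ι} (h₁ : ControlledAtCost r g₁ U₁)
    (h₂ : ControlledAtCost r g₂ U₂) : ControlledAtCost r (g₂ + g₁) (U₁ * U₂) := by
  obtain ⟨C₁, hc₁, hC₁⟩ := h₁
  obtain ⟨C₂, hc₂, hC₂⟩ := h₂
  refine ⟨C₂ ++ C₁, ?_, fun u' u x y s => ?_⟩
  · rw [Circuit.gateCost_append]
    omega
  · rw [Circuit.mat_append, Matrix.mul_apply, sum_bits_sum]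
    simp only [sum_bits_sum, hC₂, ite_and]
    simp only [mul_ite, mul_zero]
    have h : ∀ w : Bits Unit, (∑ a : Bits ι, ∑ b : Bits (Fin r), if w = u then
        if b = zeros (Fin r) then C₁.mat (Sum.elim u' (Sum.elim x s)) (Sum.elim w (Sum.elim a b)) *
          (if u () = true then U₂ else 1) a y else 0 else 0) =
        if w = u then ∑ a : Bits ι, C₁.mat (Sum.elim u' (Sum.elim x s))
          (Sum.elim w (Sum.elim a (zeros _))) * (if u () = true then U₂ else 1) a y else 0 := by
      intro w
      by_cases hw : w = u
      · simp only [hw, if_true, sum_ite_eq_zeros]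
      · simp only [hw, if_false, Finset.sum_const_zero]
    simp only [h, Finset.sum_ite_eq', Finset.mem_univ, if_true, hC₁]
    by_cases hu : u' = u ∧ s = zeros _
    · obtain ⟨rfl, rfl⟩ := hu
      simp only [and_self, if_true]
      split_ifs
      · rw [Matrix.mul_apply]
      · rw [← Matrix.mul_apply, Matrix.one_mul]
    · simp only [hu, ← ite_and, if_false, zero_mul, Finset.sum_const_zero]

theorem ControlledAtCost.list_prod {r g : ℕ} (l : List (Op ι))
    (h : ∀ U ∈ l, ControlledAtCost r g U) : ControlledAtCost r (l.length * g) l.prod := by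
  induction l with
  | nil => simpa using ControlledAtCost.one r
  | cons U l ih =>
    have := (h U (by simp)).mul (ih fun U' hU' => h U' (by simp [hU']))
    rw [List.prod_cons, List.length_cons, Nat.add_mul, Nat.one_mul]
    exact this

/-- Circuits for different observables need a common ancilla register before they can be composed;
the extra wires stay idle. -/
theorem ControlledAtCost.mono_ancillas {r t g : ℕ} {U : Op ι} (hrt : r ≤ t)
    (h : ControlledAtCost r g U) : ControlledAtCost t g U := by
  classical
  obtain ⟨C, hc, hC⟩ := h
  let e : Unit ⊕ (ι ⊕ Fin r) ↪ Unit ⊕ (ι ⊕ Fin t) :=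
    (Function.Embedding.refl _).sumMap ((Function.Embedding.refl _).sumMap (Fin.castLEEmb hrt))
  refine ⟨Circuit.relabel e C, by rwa [Circuit.gateCost_relabel], fun u' u x y s => ?_⟩
  have he : ∀ (u : Bits Unit) (x : Bits ι) (s : Bits (Fin t)),
      Sum.elim u (Sum.elim x s) ∘ e = Sum.elim u (Sum.elim x (s ∘ Fin.castLE hrt)) := by
    intro u x s
    funext k
    rcases k with k | k | k <;> rfl
  have hz : zeros (Fin t) ∘ Fin.castLE hrt = zeros (Fin r) := rfl
  rw [Circuit.mat_relabel, he, he, hz, hC, ← ite_and]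
  congr 1
  rw [eq_iff_iff]
  constructor
  · rintro ⟨h, rfl, h'⟩
    refine ⟨rfl, ?_⟩
    funext k
    by_cases hk : (k : ℕ) < r
    · exact congrFun h' ⟨k, hk⟩
    · refine h (Sum.inr (Sum.inr k)) ?_
      rintro ⟨j, hj⟩
      rcases j with j | j | j
      · simp [e] at hj
      · simp [e] at hj
      · simp only [e, Function.Embedding.coe_sumMap, Sum.map_inr, Sum.inr.injEq] at hj
        rw [← hj] at hk
        exact hk (by simp)
  · rintro ⟨rfl, rfl⟩
    refine ⟨fun k hk => ?_, rfl, hz⟩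
    rcases k with k | k | k
    · rfl
    · exact absurd ⟨Sum.inr (Sum.inl k), rfl⟩ hk
    · rfl

/-- The unitary matrix `σ_Z`. -/
def unitaryZ : Matrix.unitaryGroup Bool ℂ :=
  ⟨Matrix.diagonal fun x => if x then -1 else 1, by
    rw [Matrix.mem_unitaryGroup_iff, Matrix.star_eq_conjTranspose, Matrix.diagonal_conjTranspose,
      Matrix.diagonal_mul_diagonal, ← Matrix.diagonal_one]
    congr 1
    funext x
    cases x <;> simp⟩

/-- The controlled `σ_Z`. -/
def controlledZ (j : ι) : Gate (Unit ⊕ ι) where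
  target := Sum.inr j
  controls := {Sum.inl ()}
  target_notMem := by simp
  u := unitaryZ

theorem mat_controlledZ (j : ι) : (controlledZ j).mat =
    Matrix.diagonal fun z => if z (Sum.inl ()) = true ∧ z (Sum.inr j) = true then -1 else 1 := by
  ext x y
  rw [Matrix.diagonal_apply]
  by_cases h : y (Sum.inl ()) = true
  · have hc : ∀ i ∈ (controlledZ j).controls, y i = true := by simpa [controlledZ] using h
    by_cases hxy : ∀ i, i ≠ (controlledZ j).target → x i = y i
    · rw [Gate.mat_of_agree hc hxy]
      have : x = y ↔ x (Sum.inr j) = y (Sum.inr j) := by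
        constructor
        · rintro rfl
          rfl
        · intro ht
          funext i
          by_cases hi : i = Sum.inr j
          · rw [hi, ht]
          · exact hxy i hi
      simp only [this]
      have hx : x (Sum.inl ()) = true := by
        rw [← h]
        exact hxy _ (by simp [controlledZ])
      simp [controlledZ, unitaryZ, hx, Matrix.diagonal_apply]
    · rw [Gate.mat_of_not_agree hxy, if_neg]
      rintro rfl
      exact hxy fun _ _ => rfl
  · rw [Gate.mat_of_not_controls (by simpa [controlledZ] using h), Matrix.one_apply]
    by_cases hxy : x = y
    · subst hxy
      simp [h]
    · simp [hxy]

theorem mat_map_controlledZ (l : List ι) : Circuit.mat (l.map controlledZ) =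
    Matrix.diagonal fun z => if z (Sum.inl ()) = true then
      (l.map fun j => if z (Sum.inr j) = true then (-1 : ℂ) else 1).prod else 1 := by
  induction l with
  | nil => simp [Circuit.mat]
  | cons j l ih =>
    rw [List.map_cons, Circuit.mat, ih, mat_controlledZ, Matrix.diagonal_mul_diagonal]
    congr 1
    funext z
    by_cases h : z (Sum.inl ()) = true <;> simp [h, mul_comm]

theorem mat_relabel_inr (C : Circuit ι) (u' u : Bits Unit) (x y : Bits ι) :
    Circuit.mat (Circuit.relabel (Function.Embedding.inr : ι ↪ Unit ⊕ ι) C)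
      (Sum.elim u' x) (Sum.elim u y) = if u' = u then Circuit.mat C x y else 0 := by
  classical
  rw [Circuit.mat_relabel]
  have h1 : ∀ (u : Bits Unit) (x : Bits ι),
      Sum.elim u x ∘ (Function.Embedding.inr : ι ↪ Unit ⊕ ι) = x := fun u x => rfl
  rw [h1, h1]
  congr 1
  rw [eq_iff_iff]
  constructor
  · intro h
    funext k
    exact h (Sum.inl k) (by simp)
  · rintro rfl k hk
    rcases k with k | k
    · rfl
    · exact absurd ⟨k, rfl⟩ hk

/-- Run the measurement circuit, apply σ_Z to the output wires selected by `a`, and run the inverse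
circuit. Only the σ_Z gates have to be controlled: without them the circuit cancels its inverse. -/
theorem MeasurableAtCost.controlled {o : Type} [Fintype o] [DecidableEq o] {t : ℕ}
    {N : Bits o → Op ι} (h : MeasurableAtCost t N) (hN : IsProjMeas N) (a : Bits o) :
    ControlledAtCost t (4 * t) (obs N (chi a)) := by
  obtain ⟨r, C, out, hcost, hC⟩ := h
  rw [Circuit.cost_eq] at hcost
  have hr : r ≤ t := by
    have : r ≤ Fintype.card (ι ⊕ Fin r) := by simp
    omega
  have ho : Fintype.card o ≤ t := by
    have := Fintype.card_le_of_embedding out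
    omega
  refine ControlledAtCost.mono_ancillas hr ?_
  set l : List (ι ⊕ Fin r) := ((Finset.univ.filter fun j => a j = true).toList).map out with hl
  set sgn : Bits (ι ⊕ Fin r) → ℂ := fun z =>
    (l.map fun j => if z j = true then (-1 : ℂ) else 1).prod with hsgn
  have hsgn' : ∀ z, sgn z = chi a fun j => z (out j) := by
    intro z
    simp only [hsgn, hl, List.map_map]
    rw [Function.comp_def, Finset.prod_map_toList, Finset.prod_filter, chi]
    refine Finset.prod_congr rfl fun j _ => ?_
    rw [ite_and]
  set R := Circuit.relabel (Function.Embedding.inr : ι ⊕ Fin r ↪ Unit ⊕ (ι ⊕ Fin r)) C with hR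
  set U : Op (ι ⊕ Fin r) := C.matᴴ * Matrix.diagonal sgn * C.mat with hU
  have hU0 : ∀ x y, U (Sum.elim x (zeros _)) (Sum.elim y (zeros _)) = obs N (chi a) x y := by
    intro x y
    simp only [hU, obs, Matrix.sum_apply, Matrix.smul_apply, hC, smul_eq_mul, Finset.mul_sum]
    rw [Finset.sum_comm, Matrix.mul_apply]
    refine Finset.sum_congr rfl fun z _ => ?_
    simp only [mul_ite, mul_zero, Finset.sum_ite_eq, Finset.mem_univ, if_true]
    rw [Matrix.mul_diagonal, Matrix.conjTranspose_apply, hsgn']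
    ring
  have hCu : C.mat * C.matᴴ = 1 := mul_eq_one_comm.1 C.mat_unitary
  have hUu : Uᴴ * U = 1 := by
    have h1 : star sgn * sgn = 1 := by
      funext z
      rw [Pi.mul_apply, Pi.star_apply, hsgn', star_chi, chi_mul_self]
      rfl
    have h2 : (Matrix.diagonal sgn)ᴴ * Matrix.diagonal sgn = 1 := by
      rw [Matrix.diagonal_conjTranspose, Matrix.diagonal_mul_diagonal]
      exact (congrArg Matrix.diagonal h1).trans Matrix.diagonal_one
    calc Uᴴ * U = C.matᴴ * (Matrix.diagonal sgn)ᴴ * (C.mat * C.matᴴ) *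
          Matrix.diagonal sgn * C.mat := by
          simp only [hU, Matrix.conjTranspose_mul, Matrix.conjTranspose_conjTranspose,
            Matrix.mul_assoc]
      _ = 1 := by
          rw [hCu, Matrix.mul_one, Matrix.mul_assoc C.matᴴ, h2, Matrix.mul_one, C.mat_unitary]
  have hO : (obs N (chi a))ᴴ * obs N (chi a) = 1 := by
    classical
    rw [hN.obs_conjTranspose, hN.obs_mul, ← hN.obs_one]
    congr 1
    funext v
    rw [star_chi, chi_mul_self]
  -- The ancillas return to zero because the measurement is projective: the zero-ancilla block of
  -- the unitary `U` is already an isometry, so a column of `U` over a zero ancilla has no norm left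
  -- for other ancilla values.
  have hUs : ∀ x y s, s ≠ zeros (Fin r) → U (Sum.elim x s) (Sum.elim y (zeros _)) = 0 := by
    intro x y
    have h1 : ∑ x, ∑ s, ‖U (Sum.elim x s) (Sum.elim y (zeros _))‖ ^ 2 = 1 := by
      have h := congrFun₂ hUu (Sum.elim y (zeros _)) (Sum.elim y (zeros _))
      rw [Matrix.mul_apply, Matrix.one_apply_eq, sum_bits_sum] at h
      have h' : ((∑ x, ∑ s, ‖U (Sum.elim x s) (Sum.elim y (zeros _))‖ ^ 2 : ℝ) : ℂ) = 1 := by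
        push_cast
        rw [← h]
        refine Finset.sum_congr rfl fun _ _ => Finset.sum_congr rfl fun _ _ => ?_
        rw [Matrix.conjTranspose_apply, Complex.star_def, Complex.conj_mul']
      exact_mod_cast h'
    have h2 : ∑ x, ‖U (Sum.elim x (zeros _)) (Sum.elim y (zeros _))‖ ^ 2 = 1 := by
      have h := congrFun₂ hO y y
      rw [Matrix.mul_apply, Matrix.one_apply_eq] at h
      have h' : ((∑ x, ‖U (Sum.elim x (zeros _)) (Sum.elim y (zeros _))‖ ^ 2 : ℝ) : ℂ) = 1 := by
        push_cast
        rw [← h]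
        refine Finset.sum_congr rfl fun _ _ => ?_
        rw [Matrix.conjTranspose_apply, Complex.star_def, Complex.conj_mul', hU0]
      exact_mod_cast h'
    have h3 : ∀ x, ∑ s, ‖U (Sum.elim x s) (Sum.elim y (zeros _))‖ ^ 2 =
        ‖U (Sum.elim x (zeros _)) (Sum.elim y (zeros _))‖ ^ 2 +
          ∑ s ∈ Finset.univ.erase (zeros _), ‖U (Sum.elim x s) (Sum.elim y (zeros _))‖ ^ 2 :=
      fun x => (Finset.add_sum_erase _ _ (Finset.mem_univ _)).symm
    simp only [h3, Finset.sum_add_distrib, h2] at h1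
    have h4 : ∑ x, ∑ s ∈ Finset.univ.erase (zeros _),
        ‖U (Sum.elim x s) (Sum.elim y (zeros _))‖ ^ 2 = 0 := by linarith
    rw [Finset.sum_eq_zero_iff_of_nonneg fun _ _ => by positivity] at h4
    intro s hs
    have h5 := h4 x (Finset.mem_univ _)
    rw [Finset.sum_eq_zero_iff_of_nonneg fun _ _ => by positivity] at h5
    have h6 := h5 s (by simp [hs])
    simpa using h6
  -- The circuit and its inverse cost at most `t` each. Each of the at most `t` controlled σ_Z gates
  -- costs 2, one for the gate and one for its control.
  refine ⟨R ++ (l.map controlledZ ++ Circuit.inv R), ?_, fun u' u x y s => ?_⟩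
  · rw [Circuit.gateCost_append, Circuit.gateCost_append, Circuit.gateCost_inv, hR,
      Circuit.gateCost_relabel]
    have h1 : Circuit.gateCost (l.map controlledZ) ≤ 2 * t := by
      have h2 : Circuit.gateCost (l.map controlledZ) = 2 * l.length := by
        simp [Circuit.gateCost, controlledZ, Function.comp_def, mul_comm]
      have h3 : l.length ≤ Fintype.card o := by
        simpa [hl] using Finset.card_filter_le (Finset.univ : Finset o) fun j => a j = true
      omega
    omega
  · have key : ∀ w' w : Bits (ι ⊕ Fin r),
        Circuit.mat (R ++ (l.map controlledZ ++ Circuit.inv R)) (Sum.elim u' w') (Sum.elim u w) =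
          if u' = u then (if u () = true then U else 1) w' w else 0 := by
      intro w' w
      rw [Circuit.mat_append, Circuit.mat_append, Circuit.mat_inv, mat_map_controlledZ,
        Matrix.mul_apply, sum_bits_sum]
      simp only [Matrix.mul_diagonal, Matrix.conjTranspose_apply, hR, mat_relabel_inr,
        Sum.elim_inl, Sum.elim_inr]
      trans ∑ v : Bits Unit, ∑ z : Bits (ι ⊕ Fin r), if v = u then
          (if u' = u then (star (C.mat z w') * (if u () = true then sgn z else 1) *
            C.mat z w) else 0) else 0
      · refine Finset.sum_congr rfl fun v _ => Finset.sum_congr rfl fun z _ => ?_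
        by_cases hv : v = u
        · subst hv
          by_cases hv' : u' = v
          · subst hv'
            by_cases hu : u' () = true
            · simp only [if_true, hsgn, hu]
              rfl
            · simp [hu]
          · simp [hv', Ne.symm hv']
        · simp [hv]
      rw [Finset.sum_comm]
      simp only [Finset.sum_ite_eq', Finset.mem_univ, if_true]
      split_ifs with hu hu2
      · rw [hU, Matrix.mul_apply]
        simp only [Matrix.mul_diagonal, Matrix.conjTranspose_apply, hsgn]
      · rw [← C.mat_unitary, Matrix.mul_apply]
        simp only [Matrix.conjTranspose_apply, mul_one]
      · simp
    rw [key]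
    by_cases hu : u' = u
    · by_cases hs : s = zeros _
      · subst hs
        simp only [hu, and_self, if_true]
        split_ifs
        · exact hU0 x y
        · simp [Matrix.one_apply, Sum.elim_eq_iff]
      · simp only [hu, hs, and_false, if_true, if_false]
        split_ifs
        · exact hUs x y s hs
        · simp [Sum.elim_eq_iff, hs]
    · simp [hu]

end controlled

/-- The unitary Hadamard matrix. -/
def unitaryH : Matrix.unitaryGroup Bool ℂ :=
  ⟨Matrix.of fun x y => ((√2 : ℝ) : ℂ)⁻¹ * if x && y then -1 else 1, by
    have h2 : ((√2 : ℝ) : ℂ)⁻¹ * ((√2 : ℝ) : ℂ)⁻¹ = 1 / 2 := by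
      rw [← mul_inv, ← Complex.ofReal_mul, Real.mul_self_sqrt (by norm_num)]
      norm_num
    rw [Matrix.mem_unitaryGroup_iff]
    ext x y
    rw [Matrix.mul_apply]
    cases x <;> cases y <;> (simp [Matrix.star_apply, h2]; try norm_num)⟩

section hadamardTest

variable {ct ans ι : Type} {r t : ℕ}

/-- The wires of the Hadamard test: those of the ciphertext, and the working register. -/
abbrev TestWires (ans ι : Type) (r t : ℕ) : Type := (ans ⊕ (Fin r ⊕ ι)) ⊕ (Unit ⊕ Fin t)

/-- A string on the wires of the Hadamard test, in terms of its pieces. -/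
def join (c : Bits ct) (α : Bits ans) (s : Bits (Fin r)) (x : Bits ι) (u : Bits Unit)
    (w : Bits (Fin t)) : Bits (ct ⊕ TestWires ans ι r t) :=
  Sum.elim c (Sum.elim (Sum.elim α (Sum.elim s x)) (Sum.elim u w))

/-- The wires of the first measurement. -/
def firstWires (ct ans ι : Type) (r t : ℕ) :
    (ct ⊕ ans) ⊕ (Fin r ⊕ ι) ↪ ct ⊕ TestWires ans ι r t where
  toFun
    | Sum.inl (Sum.inl i) => Sum.inl i
    | Sum.inl (Sum.inr i) => Sum.inr (Sum.inl (Sum.inl i))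
    | Sum.inr i => Sum.inr (Sum.inl (Sum.inr i))
  inj' := by
    rintro ((i | i) | i) ((j | j) | j) h <;> simp_all

/-- The wires of the controlled observable. -/
def secondWires (ct ans ι : Type) (r t : ℕ) :
    Unit ⊕ (ι ⊕ Fin t) ↪ ct ⊕ TestWires ans ι r t where
  toFun
    | Sum.inl i => Sum.inr (Sum.inr (Sum.inl i))
    | Sum.inr (Sum.inl i) => Sum.inr (Sum.inl (Sum.inr (Sum.inr i)))
    | Sum.inr (Sum.inr i) => Sum.inr (Sum.inr (Sum.inr i))
  inj' := by
    rintro (i | i | i) (j | j | j) h <;> simp_all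

/-- The wire of the control qubit. -/
def controlWire (ct ans ι : Type) (r t : ℕ) : Unit ↪ ct ⊕ TestWires ans ι r t where
  toFun i := Sum.inr (Sum.inr (Sum.inl i))
  inj' := by
    intro i j _
    rfl

theorem extend_eq_of_forall {κ ν : Type} (e : κ ↪ ν) (w : Bits κ) (x y : Bits ν)
    (h : ∀ k, y (e k) = w k) (h' : ∀ k ∉ Set.range e, y k = x k) :
    Function.extend e w x = y := by
  funext k
  by_cases hr : k ∈ Set.range e
  · obtain ⟨i, rfl⟩ := hr
    rw [e.injective.extend_apply, h]
  · rw [Function.extend_apply' _ _ _ (by simpa using hr), h' k hr]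

variable (c c' : Bits ct) (α α' : Bits ans) (s s' : Bits (Fin r)) (x x' : Bits ι)
  (u u' : Bits Unit) (w w' : Bits (Fin t))

theorem extend_firstWires :
    Function.extend (firstWires ct ans ι r t) (Sum.elim (Sum.elim c' α') (Sum.elim s' x'))
      (join c α s x u w) = join c' α' s' x' u w := by
  refine extend_eq_of_forall _ _ _ _ ?_ ?_
  · rintro ((i | i) | (i | i)) <;> rfl
  · rintro (i | (i | (i | i)) | (i | i)) hi
    · exact absurd ⟨Sum.inl (Sum.inl i), rfl⟩ hi
    · exact absurd ⟨Sum.inl (Sum.inr i), rfl⟩ hi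
    · exact absurd ⟨Sum.inr (Sum.inl i), rfl⟩ hi
    · exact absurd ⟨Sum.inr (Sum.inr i), rfl⟩ hi
    · rfl
    · rfl

theorem extend_secondWires :
    Function.extend (secondWires ct ans ι r t) (Sum.elim u' (Sum.elim x' w'))
      (join c α s x u w) = join c α s x' u' w' := by
  refine extend_eq_of_forall _ _ _ _ ?_ ?_
  · rintro (i | i | i) <;> rfl
  · rintro (i | (i | (i | i)) | (i | i)) hi
    · rfl
    · rfl
    · rfl
    · exact absurd ⟨Sum.inr (Sum.inl i), rfl⟩ hi
    · exact absurd ⟨Sum.inl i, rfl⟩ hi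
    · exact absurd ⟨Sum.inr (Sum.inr i), rfl⟩ hi

theorem extend_controlWire :
    Function.extend (controlWire ct ans ι r t) u' (join c α s x u w) = join c α s x u' w := by
  refine extend_eq_of_forall _ _ _ _ ?_ ?_
  · intro i
    rfl
  · rintro (i | (i | (i | i)) | (i | i)) hi
    · rfl
    · rfl
    · rfl
    · rfl
    · exact absurd ⟨i, rfl⟩ hi
    · rfl

theorem join_comp_firstWires :
    join c α s x u w ∘ firstWires ct ans ι r t = Sum.elim (Sum.elim c α) (Sum.elim s x) := by
  funext i
  rcases i with (i | i) | (i | i) <;> rfl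

theorem join_comp_secondWires :
    join c α s x u w ∘ secondWires ct ans ι r t = Sum.elim u (Sum.elim x w) := by
  funext i
  rcases i with i | i | i <;> rfl

theorem join_comp_controlWire :
    join c α s x u w ∘ controlWire ct ans ι r t = u := rfl

variable [Fintype ct] [DecidableEq ct] [Fintype ans] [DecidableEq ans] [Fintype ι] [DecidableEq ι]

theorem sum_bits_join {E : Type} [AddCommMonoid E]
    (f : Bits (ct ⊕ TestWires ans ι r t) → E) :
    ∑ z, f z = ∑ c, ∑ α, ∑ s, ∑ x, ∑ u, ∑ w, f (join c α s x u w) := by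
  rw [sum_bits_sum]
  refine Finset.sum_congr rfl fun c _ => ?_
  rw [sum_bits_sum, sum_bits_sum]
  refine Finset.sum_congr rfl fun α _ => ?_
  rw [sum_bits_sum]
  refine Finset.sum_congr rfl fun s _ => Finset.sum_congr rfl fun x _ => ?_
  rw [sum_bits_sum]
  rfl

omit c c' α α' s s' x x' u u' w w'

/-- The advice of the Hadamard test: the state `ψ`, with the control qubit in the state `|+⟩` and
all other wires in the zero state. -/
def hadamardAdvice (ans : Type) (r t : ℕ) (ψ : Bits ι → ℂ) [Fintype ans] [DecidableEq ans] :
    Bits (TestWires ans ι r t) → ℂ := fun z =>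
  if (fun i => z (Sum.inl (Sum.inl i))) = zeros ans ∧
      (fun i => z (Sum.inl (Sum.inr (Sum.inl i)))) = zeros (Fin r) ∧
      (fun i => z (Sum.inr (Sum.inr i))) = zeros (Fin t) then
    ((√2 : ℝ) : ℂ)⁻¹ * ψ fun i => z (Sum.inl (Sum.inr (Sum.inr i))) else 0

theorem norm_inv_sqrt_two_sq : ‖((√2 : ℝ) : ℂ)⁻¹‖ ^ 2 = 1 / 2 := by
  rw [norm_inv, Complex.norm_real, inv_pow, Real.norm_eq_abs, sq_abs, Real.sq_sqrt (by norm_num)]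
  norm_num

omit [Fintype ι] [DecidableEq ι] in
theorem hadamardAdvice_elim (ψ : Bits ι → ℂ) (α : Bits ans) (s : Bits (Fin r)) (x : Bits ι)
    (u : Bits Unit) (w : Bits (Fin t)) :
    hadamardAdvice ans r t ψ (Sum.elim (Sum.elim α (Sum.elim s x)) (Sum.elim u w)) =
      if α = zeros ans ∧ s = zeros (Fin r) ∧ w = zeros (Fin t) then
        ((√2 : ℝ) : ℂ)⁻¹ * ψ x else 0 := rfl

theorem hadamardAdvice_norm {ψ : Bits ι → ℂ} (hψ : ∑ x, ‖ψ x‖ ^ 2 = 1) :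
    ∑ z, ‖hadamardAdvice ans r t ψ z‖ ^ 2 = 1 := by
  rw [sum_bits_sum, sum_bits_sum]
  simp only [sum_bits_sum]
  simp only [hadamardAdvice_elim]
  have h : ∀ (α : Bits ans) (s : Bits (Fin r)) (x : Bits ι) (w : Bits (Fin t)),
      ‖if α = zeros ans ∧ s = zeros (Fin r) ∧ w = zeros (Fin t) then
        ((√2 : ℝ) : ℂ)⁻¹ * ψ x else 0‖ ^ 2 =
      if α = zeros ans then if s = zeros (Fin r) then if w = zeros (Fin t) then
        1 / 2 * ‖ψ x‖ ^ 2 else 0 else 0 else 0 := by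
    intro α s x w
    rw [← norm_inv_sqrt_two_sq]
    simp only [ite_and]
    split_ifs <;> simp [mul_pow]
  simp only [h]
  have h1 : ∀ (α : Bits ans) (s : Bits (Fin r)),
      (∑ x : Bits ι, ∑ _u : Bits Unit, ∑ w : Bits (Fin t), if α = zeros ans then
        if s = zeros (Fin r) then if w = zeros (Fin t) then 1 / 2 * ‖ψ x‖ ^ 2 else 0 else 0 else 0) =
      if α = zeros ans then if s = zeros (Fin r) then (1 : ℝ) else 0 else 0 := by
    intro α s
    split_ifs
    · simp only [sum_ite_eq_zeros, sum_bits_unit, ← two_mul, ← Finset.mul_sum, hψ]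
      norm_num
    · simp
    · simp
  simp only [h1]
  simp

/-- The control qubit is |+⟩ as part of the advice, so a single Hadamard gate after the controlled
`U` suffices. Outcome 1 then has amplitude (1 - U)/2 on the post-measurement vector. The answer
register is never inspected, whence the sum over `α`; the prover's arbitrary initial state also
enters as advice. -/
theorem exists_hadamardTest {g : ℕ} {U : Op ι} (hU : ControlledAtCost t g U)
    (C : Circuit ((ct ⊕ ans) ⊕ (Fin r ⊕ ι))) (A : Bits ct → Bits ans → Op ι)
    (hC : ∀ c c' α s x y, C.mat (Sum.elim (Sum.elim c' α) (Sum.elim s x))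
      (Sum.elim (Sum.elim c (zeros _)) (Sum.elim (zeros _) y)) =
        if c' = c ∧ s = zeros _ then A c α x y else 0) (ψ : Bits ι → ℂ) :
    ∃ (T : Circuit (ct ⊕ TestWires ans ι r t)) (out : ct ⊕ TestWires ans ι r t),
      T.gateCost ≤ C.gateCost + g + 1 ∧
        ∀ c, outputProb T out (hadamardAdvice ans r t ψ) c =
          1 / 4 * ∑ α, nsq ((1 - U) *ᵥ A c α *ᵥ ψ) := by
  classical
  obtain ⟨D, hDg, hD⟩ := hU
  let h : Gate Unit := ⟨(), ∅, by simp, unitaryH⟩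
  set h2 : ℂ := ((√2 : ℝ) : ℂ)⁻¹ with hh2
  have hh : ∀ u' u : Bits Unit, Circuit.mat [h] u' u =
      h2 * if u' () && u () then -1 else 1 := by
    intro u' u
    have h1 : Circuit.mat [h] = h.mat := by simp [Circuit.mat]
    rw [h1, Gate.mat_of_agree (by simp [h]) (by simp [h])]
    rfl
  refine ⟨Circuit.relabel (firstWires ct ans ι r t) C ++
    (Circuit.relabel (secondWires ct ans ι r t) D ++
      Circuit.relabel (controlWire ct ans ι r t) [h]), controlWire ct ans ι r t (), ?_, fun c => ?_⟩
  · simp only [Circuit.gateCost_append, Circuit.gateCost_relabel]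
    have : Circuit.gateCost [h] = 1 := by simp [Circuit.gateCost, h]
    omega
  -- `Φ₀` to `Φ₃` are the global states before the first measurement, after it, after the controlled
  -- observable, and after the Hadamard gate.
  · set Φ₀ : Bits (ct ⊕ TestWires ans ι r t) → ℂ := fun z =>
      if z ∘ Sum.inl = c then hadamardAdvice ans r t ψ (z ∘ Sum.inr) else 0 with hΦ₀
    have hΦ₀' : ∀ c' α s x u w, Φ₀ (join c' α s x u w) =
        if c' = c ∧ α = zeros _ ∧ s = zeros _ ∧ w = zeros _ then h2 * ψ x else 0 := by
      intro c' α s x u w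
      rw [ite_and]
      rfl
    set Φ₁ := Circuit.mat (Circuit.relabel (firstWires ct ans ι r t) C) *ᵥ Φ₀ with hΦ₁
    set Φ₂ := Circuit.mat (Circuit.relabel (secondWires ct ans ι r t) D) *ᵥ Φ₁ with hΦ₂
    set Φ₃ := Circuit.mat (Circuit.relabel (controlWire ct ans ι r t) [h]) *ᵥ Φ₂ with hΦ₃
    have hout : ∀ T : Circuit (ct ⊕ TestWires ans ι r t), ∀ z,
        ∑ y, T.mat z (Sum.elim c y) * hadamardAdvice ans r t ψ y = (T.mat *ᵥ Φ₀) z := by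
      intro T z
      rw [Matrix.mulVec, dotProduct, sum_bits_sum fun z' => T.mat z z' * Φ₀ z', Finset.sum_eq_single c]
      · refine Finset.sum_congr rfl fun y _ => ?_
        rw [hΦ₀]
        simp
      · intro c' _ hc'
        simp [hΦ₀, hc']
      · simp
    have h₁ : ∀ c' α s x u w, Φ₁ (join c' α s x u w) =
        if c' = c ∧ s = zeros _ ∧ w = zeros _ then h2 * (A c α *ᵥ ψ) x else 0 := by
      intro c' α s x u w
      rw [hΦ₁, Circuit.relabel_mulVec, sum_bits_sum]
      simp only [sum_bits_sum, join_comp_firstWires, extend_firstWires, hΦ₀']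
      rw [Finset.sum_eq_single c, Finset.sum_eq_single (zeros _), Finset.sum_eq_single (zeros _)]
      · simp only [true_and, hC]
        by_cases hw : w = zeros _
        · by_cases hcs : c' = c ∧ s = zeros _
          · simp only [hw, hcs, and_self, if_true, Matrix.mulVec, dotProduct, Finset.mul_sum]
            refine Finset.sum_congr rfl fun y _ => ?_
            ring
          · rw [if_neg fun hcsw => hcs ⟨hcsw.1, hcsw.2.1⟩]
            simp [hcs]
        · simp [hw]
      · intro s' _ hs'
        simp [hs']
      · simp
      · intro α' _ hα'
        simp [hα']
      · simp
      · intro c'' _ hc''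
        simp [hc'']
      · simp
    have h₂ : ∀ c' α s x u w, Φ₂ (join c' α s x u w) =
        if c' = c ∧ s = zeros _ ∧ w = zeros _ then
          h2 * ((if u () = true then U else 1) *ᵥ A c α *ᵥ ψ) x else 0 := by
      intro c' α s x u w
      rw [hΦ₂, Circuit.relabel_mulVec, sum_bits_sum]
      simp only [sum_bits_sum, join_comp_secondWires, extend_secondWires, h₁]
      rw [Finset.sum_eq_single u]
      · have h3 : ∀ x', (∑ w', D.mat (Sum.elim u (Sum.elim x w)) (Sum.elim u (Sum.elim x' w')) *
            if c' = c ∧ s = zeros _ ∧ w' = zeros _ then h2 * (A c α *ᵥ ψ) x' else 0) =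
            if c' = c ∧ s = zeros _ ∧ w = zeros _ then
              h2 * ((if u () = true then U else 1) x x' * (A c α *ᵥ ψ) x') else 0 := by
          intro x'
          rw [Finset.sum_eq_single (zeros _)]
          · rw [hD]
            by_cases h5 : c' = c ∧ s = zeros _
            · by_cases hw : w = zeros _
              · simp only [h5, hw, and_self, if_true]
                ring
              · simp [hw]
            · have h6 : ∀ P, ¬ (c' = c ∧ s = zeros _ ∧ P) := fun P hP => h5 ⟨hP.1, hP.2.1⟩
              simp only [h6, if_false, mul_zero]
          · intro w' _ hw'
            simp [hw']
          · simp
        simp only [h3]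
        by_cases h5 : c' = c ∧ s = zeros _ ∧ w = zeros _
        · simp only [h5, and_self, if_true, ← Finset.mul_sum]
          rfl
        · simp only [h5, if_false, Finset.sum_const_zero]
      · intro u' _ hu'
        refine Finset.sum_eq_zero fun x' _ => Finset.sum_eq_zero fun w' _ => ?_
        by_cases hw' : w' = zeros _
        · rw [hw', hD, if_neg fun h => hu' h.1.symm, zero_mul]
        · simp [hw']
      · simp
    have h₃ : ∀ c' α s x u w, u () = true → Φ₃ (join c' α s x u w) =
        if c' = c ∧ s = zeros _ ∧ w = zeros _ then
          1 / 2 * ((1 - U) *ᵥ A c α *ᵥ ψ) x else 0 := by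
      intro c' α s x u w hu
      rw [hΦ₃, Circuit.relabel_mulVec, sum_bits_unit]
      simp only [join_comp_controlWire, extend_controlWire, hh, h₂, hu]
      have h22 : h2 * h2 = 1 / 2 := by
        rw [hh2, ← mul_inv, ← Complex.ofReal_mul, Real.mul_self_sqrt (by norm_num)]
        norm_num
      by_cases h5 : c' = c ∧ s = zeros _ ∧ w = zeros _
      · simp only [h5, and_self, if_true, Matrix.sub_mulVec, Pi.sub_apply, ← h22]
        simp
        ring
      · simp [h5]
    have hfin : ∀ z, ∑ y, Circuit.mat (Circuit.relabel (firstWires ct ans ι r t) C ++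
        (Circuit.relabel (secondWires ct ans ι r t) D ++
          Circuit.relabel (controlWire ct ans ι r t) [h])) z (Sum.elim c y) *
            hadamardAdvice ans r t ψ y = Φ₃ z := by
      intro z
      rw [hout, Circuit.mat_append, Circuit.mat_append, ← Matrix.mulVec_mulVec,
        ← Matrix.mulVec_mulVec]
    simp only [outputProb, hfin]
    rw [sum_bits_join]
    have hj : ∀ (c' : Bits ct) (α : Bits ans) (s : Bits (Fin r)) (x : Bits ι) (u : Bits Unit)
        (w : Bits (Fin t)), join c' α s x u w (controlWire ct ans ι r t ()) = u () :=
      fun _ _ _ _ _ _ => rfl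
    have h4 : ∀ c' α s x u w, (if join c' α s x u w (controlWire ct ans ι r t ()) = true then
        ‖Φ₃ (join c' α s x u w)‖ ^ 2 else 0) = if c' = c then if s = zeros _ then
          if w = zeros _ then if u () = true then
            1 / 4 * ‖((1 - U) *ᵥ A c α *ᵥ ψ) x‖ ^ 2 else 0 else 0 else 0 else 0 := by
      intro c' α s x u w
      rw [hj]
      by_cases hu : u () = true
      · simp only [hu, if_true, h₃ _ _ _ _ _ _ hu, ← ite_and]
        split_ifs
        · rw [norm_mul, mul_pow]
          norm_num
        · simp
      · simp [hu]
    simp only [h4]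
    rw [Finset.sum_eq_single c, Finset.mul_sum]
    · refine Finset.sum_congr rfl fun α _ => ?_
      rw [Finset.sum_eq_single (zeros _), nsq, Finset.mul_sum]
      · refine Finset.sum_congr rfl fun x _ => ?_
        simp [sum_bits_unit]
      · intro s _ hs
        simp [hs]
      · simp
    · intro c' _ hc'
      simp [hc']
    · simp

end hadamardTest

/-! ### Approximate eigenvectors and relations between observables -/

section signs

variable {X I : Type} [Fintype X] [DecidableEq X] [Fintype I]

/-- The average deviation of the vectors `v i` from being eigenvectors of `A` with eigenvalues
`s i`. -/
def signErr (p : I → ℝ) (v : I → X → ℂ) (A : Matrix X X ℂ) (s : I → ℂ) : ℝ :=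
  ∑ i, p i * nsq (A *ᵥ v i - s i • v i)

variable {p : I → ℝ} {v : I → X → ℂ} {ρ A B : Matrix X X ℂ} {s t : I → ℂ}

/-- Approximate eigenvalues multiply: ABv - stv = t(Av - sv) + A(Bv - tv), and neither `t` nor the
isometry `A` increases the norm. -/
theorem signErr_mul_le (hp : ∀ i, 0 ≤ p i) (hA : Aᴴ * A = 1) (ht : ∀ i, ‖t i‖ = 1) :
    signErr p v (A * B) (fun i => s i * t i) ≤ 2 * signErr p v A s + 2 * signErr p v B t := by
  simp only [signErr, Finset.mul_sum, ← Finset.sum_add_distrib]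
  refine Finset.sum_le_sum fun i _ => ?_
  have h : (A * B) *ᵥ v i - (s i * t i) • v i =
      t i • (A *ᵥ v i - s i • v i) + A *ᵥ (B *ᵥ v i - t i • v i) := by
    rw [Matrix.mulVec_sub, Matrix.mulVec_mulVec, Matrix.mulVec_smul, smul_sub, smul_smul,
      mul_comm (t i)]
    abel
  rw [h]
  have h1 := nsq_add_le (t i • (A *ᵥ v i - s i • v i)) (A *ᵥ (B *ᵥ v i - t i • v i))
  rw [nsq_mulVec_of_isometry hA, nsq_smul, ht] at h1
  nlinarith [hp i]

omit [DecidableEq X] in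
theorem IsEnsemble.stateNormSq_sub_le (h : IsEnsemble ρ p v) (c : ℂ) (hc : ‖c‖ = 1)
    (hst : ∀ i, s i = c * t i) :
    stateNormSq (A - c • B) ρ ≤ 2 * signErr p v A s + 2 * signErr p v B t := by
  rw [h.stateNormSq_eq]
  simp only [signErr, Finset.mul_sum, ← Finset.sum_add_distrib]
  refine Finset.sum_le_sum fun i _ => ?_
  have h1 : (A - c • B) *ᵥ v i = (A *ᵥ v i - s i • v i) - c • (B *ᵥ v i - t i • v i) := by
    rw [Matrix.sub_mulVec, Matrix.smul_mulVec, smul_sub, smul_smul, hst]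
    abel
  rw [h1]
  have h2 := nsq_sub_le (A *ᵥ v i - s i • v i) (c • (B *ᵥ v i - t i • v i))
  rw [nsq_smul, hc] at h2
  nlinarith [h.nonneg i]

omit [DecidableEq X] in
theorem signErr_le_add (hp : ∀ i, 0 ≤ p i) (h : IsEnsemble ρ p v) :
    signErr p v A s ≤ 2 * stateNormSq (A - B) ρ + 2 * signErr p v B s := by
  rw [h.stateNormSq_eq]
  simp only [signErr, Finset.mul_sum, ← Finset.sum_add_distrib]
  refine Finset.sum_le_sum fun i _ => ?_
  have h1 : A *ᵥ v i - s i • v i = (A - B) *ᵥ v i + (B *ᵥ v i - s i • v i) := by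
    rw [Matrix.sub_mulVec]
    abel
  rw [h1]
  have h2 := nsq_add_le ((A - B) *ᵥ v i) (B *ᵥ v i - s i • v i)
  nlinarith [hp i]

/-- The state `ρ` is a mixture of approximate eigenvectors of `A`, with eigenvalues `±1`. -/
def IsSignState (ρ A : Matrix X X ℂ) (e : ℝ) : Prop :=
  ∃ (I : Type) (_ : Fintype I) (p : I → ℝ) (v : I → X → ℂ) (s : I → ℂ),
    IsEnsemble ρ p v ∧ (∀ i, ‖s i‖ = 1) ∧ signErr p v A s ≤ e

omit [DecidableEq X] in
-- On an approximate eigenvector, DAv = s Dv + D(Av - sv), so the factor `A` on the right is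
-- absorbed as a sign. The error 8e is 2·4e, with 4 the bound on the squared norm of `D`.
theorem IsSignState.stateNormSq_mul_le {D : Matrix X X ℂ} {e : ℝ} (h : IsSignState ρ A e)
    (hD : ∀ x, nsq (D *ᵥ x) ≤ 4 * nsq x) :
    stateNormSq (D * A) ρ ≤ 2 * stateNormSq D ρ + 8 * e := by
  obtain ⟨I, _, p, v, s, hv, hs, he⟩ := h
  refine le_trans ?_ (by gcongr : 2 * stateNormSq D ρ + 8 * signErr p v A s ≤ _)
  rw [hv.stateNormSq_eq, hv.stateNormSq_eq]
  simp only [signErr, Finset.mul_sum, ← Finset.sum_add_distrib]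
  refine Finset.sum_le_sum fun i _ => ?_
  have h1 : (D * A) *ᵥ v i = s i • (D *ᵥ v i) + D *ᵥ (A *ᵥ v i - s i • v i) := by
    rw [Matrix.mulVec_sub, Matrix.mulVec_mulVec, Matrix.mulVec_smul]
    abel
  rw [h1]
  have h2 := nsq_add_le (s i • (D *ᵥ v i)) (D *ᵥ (A *ᵥ v i - s i • v i))
  rw [nsq_smul, hs] at h2
  have h3 := hD (A *ᵥ v i - s i • v i)
  nlinarith [hv.nonneg i]

end signs

/-! ### Words in observables on computationally indistinguishable states -/

/-- A family of states, and a family of observables, such that no short word in the observables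
distinguishes the states. -/
structure WordModel (X Q Ob : Type) [Fintype X] [DecidableEq X] where
  ρ : Q → Matrix X X ℂ
  ev : Ob → Matrix X X ℂ
  η : ℝ
  herm : ∀ o, (ev o)ᴴ = ev o
  sq : ∀ o, ev o * ev o = 1
  isState : ∀ q, ∃ (I : Type) (_ : Fintype I) (p : I → ℝ) (v : I → X → ℂ), IsEnsemble (ρ q) p v
  norm_one : ∀ q, stateNormSq 1 (ρ q) = 1
  indist : ∀ (q q' : Q) (l : List Ob), l.length ≤ 16 →
    stateNormSq (1 - (l.map ev).prod) (ρ q) ≤ stateNormSq (1 - (l.map ev).prod) (ρ q') + η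

namespace WordModel

variable {X Q Ob : Type} [Fintype X] [DecidableEq X] (M : WordModel X Q Ob)

/-- The value of a word. -/
def word (l : List Ob) : Matrix X X ℂ := (l.map M.ev).prod

/-- The distance, in the state `q`, between the first word and `(-1)^k` times the second. -/
def gap (q : Q) (k : ℕ) (l l' : List Ob) : ℝ :=
  stateNormSq (M.word l - (-1 : ℂ) ^ k • M.word l') (M.ρ q)

theorem word_cons (o : Ob) (l : List Ob) : M.word (o :: l) = M.ev o * M.word l := by
  simp [word]

theorem word_append (l l' : List Ob) : M.word (l ++ l') = M.word l * M.word l' := by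
  simp [word]

theorem word_reverse (l : List Ob) : M.word l.reverse = (M.word l)ᴴ := by
  induction l with
  | nil => simp [word]
  | cons o l ih =>
    rw [List.reverse_cons, word_append, ih, word_cons M o l, Matrix.conjTranspose_mul, M.herm]
    simp [word]

theorem word_isometry (l : List Ob) : (M.word l)ᴴ * M.word l = 1 := by
  induction l with
  | nil => simp [word]
  | cons o l ih =>
    rw [word_cons, Matrix.conjTranspose_mul, Matrix.mul_assoc, ← Matrix.mul_assoc _ (M.ev o),
      M.herm, M.sq, Matrix.one_mul, ih]

theorem stateNormSq_isometry_mul {U : Matrix X X ℂ} (hU : Uᴴ * U = 1) (A : Matrix X X ℂ)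
    (ρ : Matrix X X ℂ) : stateNormSq (U * A) ρ = stateNormSq A ρ := by
  rw [stateNormSq, stateNormSq, Matrix.conjTranspose_mul, Matrix.mul_assoc Aᴴ,
    ← Matrix.mul_assoc Uᴴ, hU, Matrix.one_mul]

omit [DecidableEq X] in
theorem stateNormSq_smul (c : ℂ) (hc : ‖c‖ = 1) (A ρ : Matrix X X ℂ) :
    stateNormSq (c • A) ρ = stateNormSq A ρ := by
  have h : star c * c = 1 := by
    rw [Complex.star_def, Complex.conj_mul', hc]
    simp
  rw [stateNormSq, stateNormSq, Matrix.conjTranspose_smul, Matrix.smul_mul, Matrix.mul_smul,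
    smul_smul, h, one_smul]

theorem norm_neg_one_pow (k : ℕ) : ‖(-1 : ℂ) ^ k‖ = 1 := by simp

theorem stateNormSq_nonneg (q : Q) (A : Matrix X X ℂ) : 0 ≤ stateNormSq A (M.ρ q) := by
  obtain ⟨I, _, p, v, h⟩ := M.isState q
  rw [h.stateNormSq_eq]
  exact Finset.sum_nonneg fun i _ => mul_nonneg (h.nonneg i) (nsq_nonneg _)

theorem stateNormSq_add_le (q : Q) (A B : Matrix X X ℂ) :
    stateNormSq (A + B) (M.ρ q) ≤ 2 * stateNormSq A (M.ρ q) + 2 * stateNormSq B (M.ρ q) := by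
  obtain ⟨I, _, p, v, h⟩ := M.isState q
  simp only [h.stateNormSq_eq, Finset.mul_sum, ← Finset.sum_add_distrib]
  refine Finset.sum_le_sum fun i _ => ?_
  have := nsq_add_le (A *ᵥ v i) (B *ᵥ v i)
  rw [Matrix.add_mulVec]
  nlinarith [h.nonneg i]

theorem gap_nonneg (q : Q) (k : ℕ) (l l' : List Ob) : 0 ≤ M.gap q k l l' :=
  M.stateNormSq_nonneg _ _

theorem eta_nonneg (q : Q) : 0 ≤ M.η := by
  have := M.indist q q [] (by simp)
  linarith

theorem gap_symm (q : Q) (k : ℕ) (l l' : List Ob) : M.gap q k l l' = M.gap q k l' l := by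
  have h : M.word l - (-1 : ℂ) ^ k • M.word l' =
      (-(-1 : ℂ) ^ k) • (M.word l' - (-1 : ℂ) ^ k • M.word l) := by
    rw [smul_sub, smul_smul, neg_mul, ← mul_pow]
    simp
    abel
  rw [gap, h, stateNormSq_smul _ (by simp), gap]

theorem gap_triangle (q : Q) (k k' : ℕ) (l l' l'' : List Ob) :
    M.gap q (k + k') l l'' ≤ 2 * M.gap q k l l' + 2 * M.gap q k' l' l'' := by
  have h : M.word l - (-1 : ℂ) ^ (k + k') • M.word l'' =
      (M.word l - (-1 : ℂ) ^ k • M.word l') +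
        (-1 : ℂ) ^ k • (M.word l' - (-1 : ℂ) ^ k' • M.word l'') := by
    rw [smul_sub, smul_smul, pow_add]
    abel
  have h1 := M.stateNormSq_add_le q (M.word l - (-1 : ℂ) ^ k • M.word l')
    ((-1 : ℂ) ^ k • (M.word l' - (-1 : ℂ) ^ k' • M.word l''))
  rw [stateNormSq_smul _ (norm_neg_one_pow k), ← h] at h1
  exact h1

/-- Words are unitary, so left factors leave the norm unchanged. Right factors act on the state
first and need `gap_append_right`. -/
theorem gap_append_left (q : Q) (k : ℕ) (l₀ l l' : List Ob) :
    M.gap q k (l₀ ++ l) (l₀ ++ l') = M.gap q k l l' := by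
  have h : M.word (l₀ ++ l) - (-1 : ℂ) ^ k • M.word (l₀ ++ l') =
      M.word l₀ * (M.word l - (-1 : ℂ) ^ k • M.word l') := by
    rw [word_append, word_append, Matrix.mul_sub, Matrix.mul_smul]
  rw [gap, h, stateNormSq_isometry_mul (M.word_isometry l₀), gap]

/-- Moving the unitary word `l` to the other side turns the defect into ‖1 ∓ U‖² for the single word
U = l⁻¹l', whose length is what the hypothesis bounds. -/
theorem gap_le_gap (q q' : Q) (k : ℕ) (l l' : List Ob) (hl : l.length + l'.length ≤ 16) :
    M.gap q k l l' ≤ M.gap q' k l l' + M.η := by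
  set U := M.word (l.reverse ++ l') with hU
  have key : ∀ q, M.gap q k l l' = stateNormSq (1 - (-1 : ℂ) ^ k • U) (M.ρ q) := by
    intro q
    have h1 : M.word l * (1 - (-1 : ℂ) ^ k • U) = M.word l - (-1 : ℂ) ^ k • M.word l' := by
      rw [hU, word_append, word_reverse, Matrix.mul_sub, Matrix.mul_smul, ← Matrix.mul_assoc,
        mul_eq_one_comm.1 (M.word_isometry l), Matrix.mul_one, Matrix.one_mul]
    rw [gap, ← h1, stateNormSq_isometry_mul (M.word_isometry l)]
  have hlen : (l.reverse ++ l').length ≤ 16 := by simpa using hl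
  have h1 := M.indist q q' (l.reverse ++ l') hlen
  have h2 := M.indist q' q (l.reverse ++ l') hlen
  rw [key, key]
  rcases Nat.even_or_odd k with hk | hk
  · rw [hk.neg_one_pow, one_smul]
    exact h1
  · rw [hk.neg_one_pow, neg_one_smul, sub_neg_eq_add]
    -- Indistinguishability is assumed for 1 - U only. The parallelogram identity in a normalised
    -- state expresses 1 + U through it, with the roles of `q` and `q'` exchanged.
    have h3 : ∀ q, stateNormSq (1 + U) (M.ρ q) = 4 - stateNormSq (1 - U) (M.ρ q) := by
      intro q
      have h4 : stateNormSq (1 + U) (M.ρ q) + stateNormSq (1 - U) (M.ρ q) =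
          4 * stateNormSq 1 (M.ρ q) := by
        have h5 : (1 + U)ᴴ * (1 + U) + (1 - U)ᴴ * (1 - U) = (4 : ℂ) • (1 : Matrix X X ℂ) := by
          have h6 : Uᴴ * U = 1 := M.word_isometry _
          simp only [Matrix.conjTranspose_add, Matrix.conjTranspose_sub, Matrix.conjTranspose_one,
            Matrix.add_mul, Matrix.sub_mul, Matrix.mul_add, Matrix.mul_sub, Matrix.one_mul,
            Matrix.mul_one, h6]
          module
        have h7 : (4 : ℝ) * stateNormSq 1 (M.ρ q) = ((4 : ℂ) • (M.ρ q).trace).re := by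
          rw [stateNormSq]
          simp
        rw [stateNormSq, stateNormSq, ← Complex.add_re, ← Matrix.trace_add, ← Matrix.add_mul, h5,
          h7, Matrix.smul_mul, Matrix.one_mul, Matrix.trace_smul]
      rw [M.norm_one] at h4
      linarith
    rw [h3, h3]
    change stateNormSq (1 - U) _ ≤ stateNormSq (1 - U) _ + _ at h2
    linarith

/-- Pass from `q` to `q₀`, where `o` acts as a sign, remove it there, and return. The return is
multiplied by the factor 2, which gives η + 2η = 3η. The two words differ by an operator of squared
norm at most 4. -/
theorem gap_append_right {q₀ : Q} {o : Ob} {e : ℝ} (h : IsSignState (M.ρ q₀) (M.ev o) e) (q : Q)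
    (k : ℕ) (l l' : List Ob) (hl : l.length + l'.length + 2 ≤ 16) :
    M.gap q k (l ++ [o]) (l' ++ [o]) ≤ 2 * M.gap q k l l' + 8 * e + 3 * M.η := by
  have h1 := M.gap_le_gap q q₀ k (l ++ [o]) (l' ++ [o]) (by simp; omega)
  have h2 := M.gap_le_gap q₀ q k l l' (by omega)
  have h3 : M.gap q₀ k (l ++ [o]) (l' ++ [o]) ≤ 2 * M.gap q₀ k l l' + 8 * e := by
    have h4 : M.word (l ++ [o]) - (-1 : ℂ) ^ k • M.word (l' ++ [o]) =
        (M.word l - (-1 : ℂ) ^ k • M.word l') * M.ev o := by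
      rw [word_append, word_append, Matrix.sub_mul, Matrix.smul_mul]
      simp [word]
    rw [gap, h4]
    refine h.stateNormSq_mul_le fun x => ?_
    have h5 := nsq_sub_le (M.word l *ᵥ x) ((-1 : ℂ) ^ k • (M.word l' *ᵥ x))
    rw [nsq_smul, norm_neg_one_pow, nsq_mulVec_of_isometry (M.word_isometry l),
      nsq_mulVec_of_isometry (M.word_isometry l')] at h5
    rw [Matrix.sub_mulVec, Matrix.smul_mulVec]
    linarith
  linarith

/-- Approximate solutions of the magic square anticommute approximately. -/
theorem magicSquare {q₀ : Fin 3 × Fin 3 → Q} {g : Fin 3 × Fin 3 → Ob} {e r : ℝ}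
    (hg : ∀ j, IsSignState (M.ρ (q₀ j)) (M.ev (g j)) e)
    (hrow : ∀ q i, M.gap q 0 [g (i, 0), g (i, 1)] [g (i, 2)] ≤ r)
    (hcol : ∀ q j, M.gap q 1 [g (0, j), g (1, j)] [g (2, j)] ≤ r) (q : Q) :
    M.gap q 1 [g (0, 1), g (1, 0)] [g (1, 0), g (0, 1)] ≤ 2000 * (r + e + M.η) := by
  -- Write A, …, I for the nine cells, read row by row. Rows give AB ≈ C, DE ≈ F, GH ≈ I; columns
  -- give AD ≈ -G, BE ≈ -H, CF ≈ -I. The goal is BD ≈ -DB.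
  have R := fun j k l l' hl => M.gap_append_right (hg j) q k l l' hl
  have Lm := fun k l₀ l l' => M.gap_append_left q k l₀ l l'
  have T := fun k k' l l' l'' => M.gap_triangle q k k' l l' l''
  have S := fun k l l' => M.gap_symm q k l l'
  -- `CF ≈ CDE ≈ ABDE`
  have h1 := Lm 0 [g (0, 2)] [g (1, 0), g (1, 1)] [g (1, 2)]
  have h2 := R (1, 0) 0 [g (0, 0), g (0, 1)] [g (0, 2)] (by simp)
  have h3 := R (1, 1) 0 [g (0, 0), g (0, 1), g (1, 0)] [g (0, 2), g (1, 0)] (by simp)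
  -- `I ≈ GH ≈ -GBE ≈ ADBE`
  have h4 := Lm 1 [g (2, 0)] [g (0, 1), g (1, 1)] [g (2, 1)]
  have h5 := R (0, 1) 1 [g (0, 0), g (1, 0)] [g (2, 0)] (by simp)
  have h6 := R (1, 1) 1 [g (0, 0), g (1, 0), g (0, 1)] [g (2, 0), g (0, 1)] (by simp)
  simp only [List.cons_append, List.nil_append] at h1 h2 h3 h4 h5 h6
  -- The two chains give ABDE ≈ -I and ADBE ≈ I, so ABDE ≈ -ADBE. Exponents of -1 are added without
  -- reduction; only their parity matters.
  have t1 := T 0 0 [g (0, 0), g (0, 1), g (1, 0), g (1, 1)] [g (0, 2), g (1, 0), g (1, 1)]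
    [g (0, 2), g (1, 2)]
  have t2 := T 0 1 [g (0, 0), g (0, 1), g (1, 0), g (1, 1)] [g (0, 2), g (1, 2)] [g (2, 2)]
  have t3 := T 1 1 [g (0, 0), g (1, 0), g (0, 1), g (1, 1)] [g (2, 0), g (0, 1), g (1, 1)]
    [g (2, 0), g (2, 1)]
  have t4 := T 2 0 [g (0, 0), g (1, 0), g (0, 1), g (1, 1)] [g (2, 0), g (2, 1)] [g (2, 2)]
  have t5 := T 1 2 [g (0, 0), g (0, 1), g (1, 0), g (1, 1)] [g (2, 2)]
    [g (0, 0), g (1, 0), g (0, 1), g (1, 1)]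
  -- The common A is cancelled on the left for free. The common E on the right is cancelled by
  -- appending another E and using E² = 1.
  have s1 := S 2 [g (2, 2)] [g (0, 0), g (1, 0), g (0, 1), g (1, 1)]
  have h7 := Lm 3 [g (0, 0)] [g (0, 1), g (1, 0), g (1, 1)] [g (1, 0), g (0, 1), g (1, 1)]
  have h8 := R (1, 1) 3 [g (0, 1), g (1, 0), g (1, 1)] [g (1, 0), g (0, 1), g (1, 1)] (by simp)
  simp only [List.cons_append, List.nil_append] at h7 h8
  have h9 : M.gap q 3 [g (0, 1), g (1, 0), g (1, 1), g (1, 1)]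
      [g (1, 0), g (0, 1), g (1, 1), g (1, 1)] =
      M.gap q 1 [g (0, 1), g (1, 0)] [g (1, 0), g (0, 1)] := by
    simp only [gap, word, List.map_cons, List.map_nil, List.prod_cons, List.prod_nil, mul_one,
      M.sq]
    norm_num
  have r0 := hrow q 0
  have r1 := hrow q 1
  have r2 := hrow q 2
  have c0 := hcol q 0
  have c1 := hcol q 1
  have c2 := hcol q 2
  have hη := M.eta_nonneg q
  have hr : 0 ≤ r := (M.gap_nonneg _ _ _ _).trans r0
  have he : 0 ≤ e := by
    obtain ⟨I, _, p, v, s, hv, _, he⟩ := hg (0, 0)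
    exact le_trans (Finset.sum_nonneg fun i _ => mul_nonneg (hv.nonneg i) (nsq_nonneg _)) he
  norm_num at t1 t2 t3 t4 t5
  linarith

end WordModel

/-! ### From a small-bias set to all strings -/

section bias

variable {X I : Type} [Fintype X] [DecidableEq X] [Fintype I] {n : ℕ}

theorem norm_chi_sub_sq (a v u : Bits (Fin n)) :
    ‖chi a v - chi a u‖ ^ 2 = 2 - 2 * (-1 : ℝ) ^ overlap a (bxor v u) := by
  have h : ((-1 : ℝ) ^ overlap a (bxor v u) : ℂ) = chi a v * chi a u := by
    rw [← chi_bxor_right, ← neg_one_pow_overlap]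
    simp
  have h' : (((-1 : ℝ) ^ overlap a (bxor v u) : ℝ) : ℂ) = chi a v * chi a u := by
    rw [← h]
    simp
  rcases chi_eq_or a v with h1 | h1 <;> rcases chi_eq_or a u with h2 | h2 <;>
    rw [h1, h2] at h' ⊢
  · have : (-1 : ℝ) ^ overlap a (bxor v u) = 1 := by
      apply Complex.ofReal_injective
      rw [h']
      simp
    rw [this]
    norm_num
  · have : (-1 : ℝ) ^ overlap a (bxor v u) = -1 := by
      apply Complex.ofReal_injective
      rw [h']
      simp
    rw [this]
    norm_num
  · have : (-1 : ℝ) ^ overlap a (bxor v u) = -1 := by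
      apply Complex.ofReal_injective
      rw [h']
      simp
    rw [this]
    norm_num
  · have : (-1 : ℝ) ^ overlap a (bxor v u) = 1 := by
      apply Complex.ofReal_injective
      rw [h']
      simp
    rw [this]
    norm_num

/-- Distinct strings are separated by a constant fraction of the characters in `S`: the average of
|χ_a(v) - χ_a(u)|² over `S` is at least 2(1 - μ), while no single term exceeds 4. -/
theorem IsBiased.norm_chi_sub_sq_le {μ : ℝ} (hμ : μ < 1) {S : Finset (Bits (Fin n))}
    (hS : IsBiased μ S) (hne : S.Nonempty) (a₀ v u : Bits (Fin n)) :
    ‖chi a₀ v - chi a₀ u‖ ^ 2 ≤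
      2 / (1 - μ) * ((∑ a ∈ S, ‖chi a v - chi a u‖ ^ 2) / (S.card : ℝ)) := by
  by_cases hvu : v = u
  · subst hvu
    simp
  · have hb : bxor v u ≠ zeros (Fin n) := fun h => hvu ((bxor_eq_zeros_iff v u).1 h)
    have h1 := (le_abs_self _).trans (hS _ hb)
    have hc : (0 : ℝ) < S.card := by exact_mod_cast hne.card_pos
    have h2 : (∑ a ∈ S, ‖chi a v - chi a u‖ ^ 2) / (S.card : ℝ) =
        2 - 2 * ((∑ a ∈ S, (-1 : ℝ) ^ overlap a (bxor v u)) / (S.card : ℝ)) := by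
      simp only [norm_chi_sub_sq, Finset.sum_sub_distrib, ← Finset.mul_sum, Finset.sum_const,
        nsmul_eq_mul]
      field_simp
    have h3 : ‖chi a₀ v - chi a₀ u‖ ^ 2 ≤ 4 := by
      rw [norm_chi_sub_sq]
      have : -1 ≤ (-1 : ℝ) ^ overlap a₀ (bxor v u) := by
        rcases neg_one_pow_eq_or ℝ (overlap a₀ (bxor v u)) with h | h <;> norm_num [h]
      linarith
    have h4 : 0 < 1 - μ := by linarith
    refine h3.trans ?_
    rw [h2, div_mul_eq_mul_div, le_div_iff₀ h4]
    linarith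

/-- The observable of this measurement at `a` is (-1)^{a·b} U O(a) U, with O(a) that of `N`. Twisted
commutation of `U` with O(a) thus becomes closeness of two measurements. -/
theorem IsProjMeas.conj_shift {N : Bits (Fin n) → Matrix X X ℂ} (hN : IsProjMeas N)
    {U : Matrix X X ℂ} (hU : Uᴴ = U) (hU2 : U * U = 1) (b : Bits (Fin n)) :
    IsProjMeas fun v => U * N (bxor v b) * U where
  herm v := by
    rw [Matrix.conjTranspose_mul, Matrix.conjTranspose_mul, hU, hN.herm, Matrix.mul_assoc]
  idem v := by
    rw [show U * N (bxor v b) * U * (U * N (bxor v b) * U) =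
      U * N (bxor v b) * (U * U) * N (bxor v b) * U by simp only [Matrix.mul_assoc], hU2,
      Matrix.mul_one, Matrix.mul_assoc U, hN.idem]
  orth v v' h := by
    have h' : bxor v b ≠ bxor v' b := fun hb => h (by
      rw [← bxor_bxor_self v b, hb, bxor_bxor_self])
    rw [show U * N (bxor v b) * U * (U * N (bxor v' b) * U) =
      U * N (bxor v b) * (U * U) * N (bxor v' b) * U by simp only [Matrix.mul_assoc], hU2,
      Matrix.mul_one, Matrix.mul_assoc U, hN.orth _ _ h', Matrix.mul_zero, Matrix.zero_mul]
  total := by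
    have hinv : Function.Involutive fun v : Bits (Fin n) => bxor v b := fun v => bxor_bxor_self v b
    rw [← Finset.sum_mul, ← Finset.mul_sum, hinv.bijective.sum_comp N, hN.total, Matrix.mul_one,
      hU2]

/-- If an observable `U` commutes approximately up to the sign `(-1)^{a·b}` with the observables
of `N`, on average over strings `a` from a small-bias set, then it does so for every `a`. -/
theorem IsEnsemble.extend_of_isBiased {ρ : Matrix X X ℂ} {p : I → ℝ} {v : I → X → ℂ}
    (h : IsEnsemble ρ p v) {N : Bits (Fin n) → Matrix X X ℂ} (hN : IsProjMeas N)
    {u : I → Bits (Fin n)} {e : ℝ}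
    (he : ∀ a, signErr p v (obs N (chi a)) (fun i => chi a (u i)) ≤ e)
    {U : Matrix X X ℂ} (hU : Uᴴ = U) (hU2 : U * U = 1) (b : Bits (Fin n)) {μ : ℝ} (hμ : μ < 1)
    {S : Finset (Bits (Fin n))} (hS : IsBiased μ S) (hne : S.Nonempty) (a₀ : Bits (Fin n)) :
    stateNormSq (obs N (chi a₀) * U - chi a₀ b • (U * obs N (chi a₀))) ρ ≤
      4 / (1 - μ) * (2 * ((∑ a ∈ S, stateNormSq (obs N (chi a) * U -
        chi a b • (U * obs N (chi a))) ρ) / (S.card : ℝ)) + 2 * e) + 2 * e := by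
  set N' : Bits (Fin n) → Matrix X X ℂ := fun v => U * N (bxor v b) * U with hN'def
  have hN' : IsProjMeas N' := hN.conj_shift hU hU2 b
  have hobs : ∀ a, obs N' (chi a) = chi a b • (U * obs N (chi a) * U) := by
    intro a
    have hinv : Function.Involutive fun v : Bits (Fin n) => bxor v b := fun v => bxor_bxor_self v b
    have h1 : obs N (chi a) = ∑ v, chi a (bxor v b) • N (bxor v b) :=
      (hinv.bijective.sum_comp fun v => chi a v • N v).symm
    rw [h1, Finset.mul_sum, Finset.sum_mul, Finset.smul_sum, obs]
    refine Finset.sum_congr rfl fun v _ => ?_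
    rw [Matrix.mul_smul, Matrix.smul_mul, smul_smul, chi_bxor_right, mul_left_comm, chi_mul_self,
      mul_one]
  -- The commutation defect equals the distance between the observables of `N'` and `N`, up to a
  -- sign and the unitary factor `U` on the left.
  have hf : ∀ a, stateNormSq (obs N (chi a) * U - chi a b • (U * obs N (chi a))) ρ =
      stateNormSq (obs N' (chi a) - obs N (chi a)) ρ := by
    intro a
    have h1 : obs N (chi a) * U - chi a b • (U * obs N (chi a)) =
        chi a b • (U * (obs N' (chi a) - obs N (chi a))) := by
      rw [hobs, Matrix.mul_sub, Matrix.mul_smul, smul_sub, smul_smul, chi_mul_self, one_smul,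
        ← Matrix.mul_assoc, ← Matrix.mul_assoc, hU2, Matrix.one_mul]
    have hc : ‖chi a b‖ = 1 := by rcases chi_eq_or a b with h | h <;> simp [h]
    rw [h1, WordModel.stateNormSq_smul _ hc, WordModel.stateNormSq_isometry_mul (by rw [hU, hU2])]
  -- With the observable of `N` replaced by the sign χ_a(u_i), the dependence on `a` lies only in
  -- |χ_a(w) - χ_a(u_i)|², with nonnegative weights independent of `a`. The pointwise bound for
  -- biased sets therefore applies term by term.
  have ht : ∀ a, signErr p v (obs N' (chi a)) (fun i => chi a (u i)) =
      ∑ i, p i * ∑ w, ‖chi a w - chi a (u i)‖ ^ 2 * nsq (N' w *ᵥ v i) := by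
    intro a
    refine Finset.sum_congr rfl fun i _ => ?_
    rw [← hN'.nsq_obs, ← obs_sub, hN'.obs_const, Matrix.sub_mulVec, Matrix.smul_mulVec,
      Matrix.one_mulVec]
  have hμ' : 0 < 1 - μ := by linarith
  have hc : (0 : ℝ) < S.card := by exact_mod_cast hne.card_pos
  have h1 : signErr p v (obs N' (chi a₀)) (fun i => chi a₀ (u i)) ≤ 2 / (1 - μ) *
      ((∑ a ∈ S, signErr p v (obs N' (chi a)) (fun i => chi a (u i))) / (S.card : ℝ)) := by
    simp only [ht]
    rw [Finset.sum_comm, Finset.sum_div, Finset.mul_sum]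
    refine Finset.sum_le_sum fun i _ => ?_
    rw [← Finset.mul_sum, Finset.sum_comm, mul_div_assoc, mul_left_comm]
    refine mul_le_mul_of_nonneg_left ?_ (h.nonneg i)
    rw [Finset.sum_div, Finset.mul_sum]
    refine Finset.sum_le_sum fun w _ => ?_
    rw [← Finset.sum_mul, mul_div_right_comm, ← mul_assoc]
    exact mul_le_mul_of_nonneg_right (hS.norm_chi_sub_sq_le hμ hne _ _ _) (nsq_nonneg _)
  have h2 : ∀ a, signErr p v (obs N' (chi a)) (fun i => chi a (u i)) ≤
      2 * stateNormSq (obs N' (chi a) - obs N (chi a)) ρ + 2 * e := by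
    intro a
    have := signErr_le_add (A := obs N' (chi a)) (B := obs N (chi a))
      (s := fun i => chi a (u i)) h.nonneg h
    linarith [he a]
  have h3 : stateNormSq (obs N' (chi a₀) - obs N (chi a₀)) ρ ≤
      2 * signErr p v (obs N' (chi a₀)) (fun i => chi a₀ (u i)) + 2 * e := by
    have := h.stateNormSq_sub_le (A := obs N' (chi a₀)) (B := obs N (chi a₀))
      (s := fun i => chi a₀ (u i)) (t := fun i => chi a₀ (u i)) 1 (by simp) (by simp)
    rw [one_smul] at this
    linarith [he a₀]
  have h4 : (∑ a ∈ S, signErr p v (obs N' (chi a)) (fun i => chi a (u i))) / (S.card : ℝ) ≤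
      2 * ((∑ a ∈ S, stateNormSq (obs N' (chi a) - obs N (chi a)) ρ) / (S.card : ℝ)) + 2 * e := by
    rw [div_le_iff₀ hc]
    refine (Finset.sum_le_sum fun a _ => h2 a).trans (le_of_eq ?_)
    rw [Finset.sum_add_distrib, ← Finset.mul_sum, Finset.sum_const, nsmul_eq_mul]
    field_simp
  simp only [hf]
  refine h3.trans ?_
  have h5 := mul_le_mul_of_nonneg_left h4 (by positivity : 0 ≤ 2 / (1 - μ))
  have h6 : 4 / (1 - μ) = 2 * (2 / (1 - μ)) := by ring
  rw [h6, mul_assoc 2 (2 / (1 - μ))]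
  linarith

end bias

/-! ### The isometry -/

/-- The positions of `a` at which the label of `w` is `P`. -/
def restrict {n : ℕ} (w : Fin n → Pauli) (P : Pauli) (a : Bits (Fin n)) : Bits (Fin n) :=
  fun i => a i && decide (w i = P)

/-- σ_w(a) sends |y⟩ to (-1)^{a_Z·y} |y + a_X⟩. There is no ordering phase, because each position
carries a single label. -/
theorem pauliString_apply {n : ℕ} (w : Fin n → Pauli) (a x y : Bits (Fin n)) :
    pauliString w a x y =
      if x = bxor y (restrict w Pauli.X a) then chi (restrict w Pauli.Z a) y else 0 := by
  have h : ∀ i, ((w i).mat ^ (a i).toNat) (x i) (y i) =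
      if x i = bxor y (restrict w Pauli.X a) i then
        (if restrict w Pauli.Z a i = true ∧ y i = true then -1 else 1) else 0 := by
    have key : ∀ (P : Pauli) (a x y : Bool), (P.mat ^ a.toNat) x y =
        if x = (y ^^ (a && decide (P = Pauli.X))) then
          (if (a && decide (P = Pauli.Z)) = true ∧ y = true then -1 else 1) else 0 := by
      intro P a x y
      cases P <;> cases a <;> cases x <;> cases y <;>
        simp [Pauli.mat]
    exact fun i => key (w i) (a i) (x i) (y i)
  simp only [pauliString, tensor, Matrix.of_apply, h, chi]
  split_ifs with hx
  · exact Finset.prod_congr rfl fun i _ => if_pos (congrFun hx i)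
  · obtain ⟨i, hi⟩ := Function.ne_iff.1 hx
    exact Finset.prod_eq_zero (Finset.mem_univ i) (if_neg hi)

section isometry

variable {X : Type} [Fintype X] [DecidableEq X] {n d : ℕ} (e : Fin d ≃ X)
  (PX PZ : Bits (Fin n) → Matrix X X ℂ)

/-- The isometry `∑_v |v⟩ ⊗ X(v) P^Z_v`. -/
def swapIsometry : Matrix (Bits (Fin n) × Fin d) X ℂ :=
  Matrix.of fun vk x => (obs PX (chi vk.1) * PZ vk.1) (e vk.2) x

omit [DecidableEq X] in
theorem swapIsometry_conj (A : Op (Fin n)) :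
    (swapIsometry e PX PZ)ᴴ * (A ⊗ₖ (1 : Matrix (Fin d) (Fin d) ℂ)) * swapIsometry e PX PZ =
      ∑ v, ∑ v', A v v' • ((obs PX (chi v) * PZ v)ᴴ * (obs PX (chi v') * PZ v')) := by
  ext x y
  simp only [Matrix.sum_apply, Matrix.smul_apply, smul_eq_mul]
  rw [Matrix.mul_assoc, Matrix.mul_apply, Fintype.sum_prod_type]
  refine Finset.sum_congr rfl fun v _ => ?_
  have h : ∀ k, ((A ⊗ₖ (1 : Matrix (Fin d) (Fin d) ℂ)) * swapIsometry e PX PZ) (v, k) y =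
      ∑ v', A v v' * (obs PX (chi v') * PZ v') (e k) y := by
    intro k
    rw [Matrix.mul_apply, Fintype.sum_prod_type]
    refine Finset.sum_congr rfl fun v' _ => ?_
    simp [Matrix.kroneckerMap_apply, Matrix.one_apply, swapIsometry]
  simp only [h, Finset.mul_sum]
  rw [Finset.sum_comm]
  refine Finset.sum_congr rfl fun v' _ => ?_
  rw [Matrix.mul_apply, Finset.mul_sum, ← e.sum_comp]
  refine Finset.sum_congr rfl fun k _ => ?_
  rw [Matrix.conjTranspose_apply, Matrix.conjTranspose_apply, swapIsometry, Matrix.of_apply]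
  ring

variable {PX PZ} (hX : IsProjMeas PX) (hZ : IsProjMeas PZ)

include hX in
theorem IsProjMeas.chi_herm (a : Bits (Fin n)) : (obs PX (chi a))ᴴ = obs PX (chi a) := by
  simp only [hX.obs_conjTranspose, star_chi]

include hX in
theorem IsProjMeas.chi_mul (a b : Bits (Fin n)) :
    obs PX (chi a) * obs PX (chi b) = obs PX (chi (bxor a b)) := by
  rw [hX.obs_mul]
  congr 1
  funext v
  rw [chi_bxor_left]

include hX in
theorem IsProjMeas.chi_zeros : obs PX (chi (zeros _)) = 1 := by
  rw [← hX.obs_one]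
  congr 1
  funext v
  exact chi_zeros_left v

include hX in
theorem IsProjMeas.chi_sq (a : Bits (Fin n)) : obs PX (chi a) * obs PX (chi a) = 1 := by
  rw [hX.chi_mul, bxor_self, hX.chi_zeros]

include hX hZ in
-- V†V = ∑_v P_v X(v)² P_v = ∑_v P_v = 1, so the isometry is exact even though the Pauli relations
-- hold only approximately.
theorem swapIsometry_isometry : (swapIsometry e PX PZ)ᴴ * swapIsometry e PX PZ = 1 := by
  have h := swapIsometry_conj e PX PZ 1
  rw [Matrix.one_kronecker_one, Matrix.mul_one] at h
  rw [h, ← hZ.total]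
  refine Finset.sum_congr rfl fun v _ => ?_
  simp only [Matrix.one_apply, ite_smul, one_smul, zero_smul, Finset.sum_ite_eq, Finset.mem_univ,
    if_true]
  rw [Matrix.conjTranspose_mul, Matrix.mul_assoc, ← Matrix.mul_assoc _ _ (PZ v), hX.chi_herm,
    hX.chi_sq, Matrix.one_mul, hZ.herm, hZ.idem]

include hX hZ in
-- Directly, the left side is ∑_v (-1)^{a_Z·v} P^Z_{v+a_X} X(a_X) P^Z_v. Averaging over the
-- characters `c` enforces this pairing of outcomes, which turns projections into observables. No
-- relation between X and Z is used.
theorem swapIsometry_conj_pauliString (w : Fin n → Pauli) (a : Bits (Fin n)) :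
    (swapIsometry e PX PZ)ᴴ * (pauliString w a ⊗ₖ (1 : Matrix (Fin d) (Fin d) ℂ)) *
        swapIsometry e PX PZ =
      ∑ c, ((2 : ℂ) ^ n)⁻¹ • (chi c (restrict w Pauli.X a) • (obs PZ (chi c) *
        obs PX (chi (restrict w Pauli.X a)) * obs PZ (chi (bxor c (restrict w Pauli.Z a))))) := by
  set aX := restrict w Pauli.X a
  set aZ := restrict w Pauli.Z a
  have hl : (swapIsometry e PX PZ)ᴴ * (pauliString w a ⊗ₖ (1 : Matrix (Fin d) (Fin d) ℂ)) *
      swapIsometry e PX PZ = ∑ v, chi aZ v • (PZ (bxor v aX) * obs PX (chi aX) * PZ v) := by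
    rw [swapIsometry_conj, Finset.sum_comm]
    refine Finset.sum_congr rfl fun v _ => ?_
    simp only [pauliString_apply, ite_smul, zero_smul, Finset.sum_ite_eq', Finset.mem_univ,
      if_true]
    congr 1
    rw [Matrix.conjTranspose_mul, hX.chi_herm, hZ.herm, Matrix.mul_assoc, ← Matrix.mul_assoc _ _
      (PZ v), hX.chi_mul, ← Matrix.mul_assoc, bxor_comm v, bxor_bxor_self]
  rw [hl]
  have hr : ∀ c, obs PZ (chi c) * obs PX (chi aX) * obs PZ (chi (bxor c aZ)) =
      ∑ v, ∑ u, (chi c u * chi c v * chi aZ v) • (PZ u * obs PX (chi aX) * PZ v) := by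
    intro c
    rw [show obs PZ (chi c) = ∑ u, chi c u • PZ u from rfl,
      show obs PZ (chi (bxor c aZ)) = ∑ v, chi (bxor c aZ) v • PZ v from rfl, Finset.mul_sum]
    refine Finset.sum_congr rfl fun v _ => ?_
    rw [Finset.sum_mul, Finset.sum_mul]
    refine Finset.sum_congr rfl fun u _ => ?_
    rw [Matrix.smul_mul, Matrix.smul_mul, Matrix.mul_smul, smul_smul, chi_bxor_left, mul_assoc (chi c u)]
  simp only [hr, Finset.smul_sum, smul_smul]
  rw [Finset.sum_comm]
  refine Finset.sum_congr rfl fun v _ => ?_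
  rw [Finset.sum_comm]
  simp only [← Finset.sum_smul]
  rw [Finset.sum_eq_single (bxor v aX)]
  · congr 1
    have h : ∀ c, ((2 : ℂ) ^ n)⁻¹ * (chi c aX * (chi c (bxor v aX) * chi c v * chi aZ v)) =
        ((2 : ℂ) ^ n)⁻¹ * chi aZ v := by
      intro c
      rw [chi_bxor_right]
      have h1 := chi_mul_self c aX
      have h2 := chi_mul_self c v
      linear_combination (((2 : ℂ) ^ n)⁻¹ * chi aZ v * chi c v * chi c v) * h1 +
        (((2 : ℂ) ^ n)⁻¹ * chi aZ v) * h2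
    simp [h]
  · intro u _ hu
    have h : ∀ c, ((2 : ℂ) ^ n)⁻¹ * (chi c aX * (chi c u * chi c v * chi aZ v)) =
        ((2 : ℂ) ^ n)⁻¹ * chi aZ v * (chi c (bxor v aX) * chi c u) := by
      intro c
      rw [chi_bxor_right]
      ring
    simp only [h, ← Finset.mul_sum]
    rw [sum_chi_mul_chi, if_neg (Ne.symm hu), mul_zero, zero_smul]
  · simp

include hX hZ in
/-- If all Pauli strings satisfy the commutation relations of the Pauli group approximately, then
the isometry maps them approximately to Pauli strings. -/
theorem stateNormSq_sub_swapIsometry_le {I : Type} [Fintype I] {ρ : Matrix X X ℂ} {p : I → ℝ}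
    {v : I → X → ℂ} (h : IsEnsemble ρ p v) {δ : ℝ}
    (hδ : ∀ a b c, stateNormSq ((obs PX (chi a) * obs PZ (chi c) -
      chi c a • (obs PZ (chi c) * obs PX (chi a))) * obs PZ (chi b)) ρ ≤ δ)
    (w : Fin n → Pauli) (a : Bits (Fin n)) :
    stateNormSq (obs PX (chi (restrict w Pauli.X a)) * obs PZ (chi (restrict w Pauli.Z a)) -
      (swapIsometry e PX PZ)ᴴ * (pauliString w a ⊗ₖ (1 : Matrix (Fin d) (Fin d) ℂ)) *
        swapIsometry e PX PZ) ρ ≤ δ := by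
  rw [swapIsometry_conj_pauliString e hX hZ]
  set aX := restrict w Pauli.X a
  set aZ := restrict w Pauli.Z a
  have key : obs PX (chi aX) * obs PZ (chi aZ) - ∑ c, ((2 : ℂ) ^ n)⁻¹ • (chi c aX •
      (obs PZ (chi c) * obs PX (chi aX) * obs PZ (chi (bxor c aZ)))) =
      ∑ c, (((2 : ℝ) ^ n)⁻¹ : ℝ) • ((obs PX (chi aX) * obs PZ (chi c) -
        chi c aX • (obs PZ (chi c) * obs PX (chi aX))) * obs PZ (chi (bxor c aZ))) := by
    -- Z(c) Z(c + a_Z) = Z(a_Z) holds exactly, so the target X(a_X) Z(a_Z) can be inserted in each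
    -- term of the average over `c`. The difference is then an average of commutation defects,
    -- followed on the right by Z(c + a_Z); convexity finishes.
    have h1 : ∀ c : Bits (Fin n), obs PX (chi aX) * obs PZ (chi c) * obs PZ (chi (bxor c aZ)) =
        obs PX (chi aX) * obs PZ (chi aZ) := by
      intro c
      rw [Matrix.mul_assoc, hZ.chi_mul, ← bxor_assoc, bxor_self, bxor_comm, bxor_zeros]
    simp only [Matrix.sub_mul, Matrix.smul_mul, h1, smul_sub, Finset.sum_sub_distrib]
    congr 1
    · rw [← Finset.sum_smul]
      simp
    · refine Finset.sum_congr rfl fun c _ => ?_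
      rw [← Complex.coe_smul]
      push_cast
      rfl
  rw [key, h.stateNormSq_eq]
  have hsum : ∑ _c : Bits (Fin n), ((2 : ℝ) ^ n)⁻¹ = 1 := by simp
  calc _ ≤ ∑ i, p i * ∑ c, ((2 : ℝ) ^ n)⁻¹ * nsq (((obs PX (chi aX) * obs PZ (chi c) -
        chi c aX • (obs PZ (chi c) * obs PX (chi aX))) * obs PZ (chi (bxor c aZ))) *ᵥ v i) := by
        refine Finset.sum_le_sum fun i _ => mul_le_mul_of_nonneg_left ?_ (h.nonneg i)
        have h3 := nsq_sum_smul_le (fun _ : Bits (Fin n) => ((2 : ℝ) ^ n)⁻¹)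
          (fun _ => by positivity) hsum (fun c => ((obs PX (chi aX) * obs PZ (chi c) -
          chi c aX • (obs PZ (chi c) * obs PX (chi aX))) * obs PZ (chi (bxor c aZ))) *ᵥ v i)
        refine le_trans (le_of_eq ?_) h3
        rw [Matrix.sum_mulVec]
        congr 1
        refine Finset.sum_congr rfl fun c _ => ?_
        rw [← Complex.coe_smul, Matrix.smul_mulVec]
    _ = ∑ c, ((2 : ℝ) ^ n)⁻¹ * stateNormSq ((obs PX (chi aX) * obs PZ (chi c) -
        chi c aX • (obs PZ (chi c) * obs PX (chi aX))) * obs PZ (chi (bxor c aZ))) ρ := by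
        simp only [h.stateNormSq_eq, Finset.mul_sum]
        rw [Finset.sum_comm]
        refine Finset.sum_congr rfl fun c _ => Finset.sum_congr rfl fun i _ => ?_
        ring
    _ ≤ ∑ _c : Bits (Fin n), ((2 : ℝ) ^ n)⁻¹ * δ :=
        Finset.sum_le_sum fun c _ => mul_le_mul_of_nonneg_left (hδ _ _ _) (by positivity)
    _ = δ := by rw [← Finset.sum_mul, hsum, one_mul]

end isometry

/-- Parseval's identity for the state-dependent norm. -/
theorem IsEnsemble.sum_stateNormSq_chi {X I : Type} [Fintype X] [Fintype I] {n : ℕ}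
    {ρ : Matrix X X ℂ} {p : I → ℝ} {v : I → X → ℂ} (h : IsEnsemble ρ p v)
    (T : Bits (Fin n) → Matrix X X ℂ) :
    ∑ u, stateNormSq (((2 : ℂ) ^ n)⁻¹ • ∑ a, chi u a • T a) ρ =
      avgBits fun a => stateNormSq (T a) ρ := by
  simp only [avgBits, h.stateNormSq_eq, smul_eq_mul]
  rw [Finset.sum_comm]
  trans ((2 : ℝ) ^ n)⁻¹ * ∑ i, ∑ a, p i * nsq (T a *ᵥ v i)
  swap
  · rw [Finset.sum_comm]
  rw [Finset.mul_sum]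
  refine Finset.sum_congr rfl fun i _ => ?_
  rw [← Finset.mul_sum, ← Finset.mul_sum, mul_left_comm, ← sum_nsq_chi]
  congr 1
  refine Finset.sum_congr rfl fun u _ => ?_
  rw [Matrix.smul_mulVec, Matrix.sum_mulVec]
  simp only [Matrix.smul_mulVec]

/-! ### Expectations and decrypted answers -/

section expect

variable {α : Type} [Fintype α] (p : PMF α)

theorem expect_eq_sum_mul (f : α → ℝ) : expect p f = ∑ a, (p a).toReal * f a := rfl

theorem sum_toReal_eq_one : ∑ a, (p a).toReal = 1 := by
  have h := p.tsum_coe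
  rw [tsum_fintype] at h
  rw [← ENNReal.toReal_sum fun a _ => p.apply_ne_top a, h, ENNReal.toReal_one]

theorem expect_mono {f g : α → ℝ} (h : ∀ a, f a ≤ g a) : expect p f ≤ expect p g :=
  Finset.sum_le_sum fun a _ => mul_le_mul_of_nonneg_left (h a) ENNReal.toReal_nonneg

theorem expect_const (c : ℝ) : expect p (fun _ => c) = c := by
  rw [expect_eq_sum_mul, ← Finset.sum_mul, sum_toReal_eq_one, one_mul]

theorem expect_add (f g : α → ℝ) : expect p (fun a => f a + g a) = expect p f + expect p g := by
  simp only [expect_eq_sum_mul, mul_add, Finset.sum_add_distrib]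

theorem expect_const_mul (c : ℝ) (f : α → ℝ) : expect p (fun a => c * f a) = c * expect p f := by
  simp only [expect_eq_sum_mul, Finset.mul_sum, mul_left_comm]

theorem expect_one_sub (f : α → ℝ) : expect p (fun a => 1 - f a) = 1 - expect p f := by
  simp only [expect_eq_sum_mul, mul_sub, Finset.sum_sub_distrib, mul_one, sum_toReal_eq_one]

theorem expect_nonneg {f : α → ℝ} (h : ∀ a, 0 ≤ f a) : 0 ≤ expect p f := by
  rw [← expect_const p 0]
  exact expect_mono p h

theorem expect_le_one {f : α → ℝ} (h : ∀ a, f a ≤ 1) : expect p f ≤ 1 := by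
  rw [← expect_const p 1]
  exact expect_mono p h

end expect

theorem prob_nonneg {α : Type} (p : PMF α) (s : Set α) : 0 ≤ prob p s := ENNReal.toReal_nonneg

theorem prob_le_one {α : Type} (p : PMF α) (s : Set α) : prob p s ≤ 1 := by
  have h : p.toOuterMeasure s ≤ 1 := by
    rw [p.toOuterMeasure_apply, ← p.tsum_coe]
    exact ENNReal.tsum_le_tsum fun a => Set.indicator_le_self _ _ _
  simpa [prob] using ENNReal.toReal_mono ENNReal.one_ne_top h

theorem prob_exists_eq {α β : Type} [Fintype β] (p : PMF α) {f : β → α}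
    (hf : Function.Injective f) (R : β → Prop) [DecidablePred R] :
    prob p {s | ∃ u, s = f u ∧ R u} = ∑ u, if R u then (p (f u)).toReal else 0 := by
  classical
  have h : {s | ∃ u, s = f u ∧ R u} = ((Finset.univ.filter R).map ⟨f, hf⟩ : Finset α) := by
    ext s
    simp only [Set.mem_ofPred_eq, Finset.coe_map, Function.Embedding.coeFn_mk, Set.mem_image,
      Finset.coe_filter, Finset.mem_univ, true_and]
    exact ⟨fun ⟨u, hu, hR⟩ => ⟨u, hR, hu.symm⟩, fun ⟨u, hR, hu⟩ => ⟨u, hu.symm, hR⟩⟩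
  rw [prob, h, PMF.toOuterMeasure_apply_finset, Finset.sum_map,
    ENNReal.toReal_sum fun a _ => p.apply_ne_top _, Finset.sum_filter]
  rfl

theorem sum_prob_le_one {α β : Type} [Fintype β] (p : PMF α) {f : β → α}
    (hf : Function.Injective f) : ∑ u, (p (f u)).toReal ≤ 1 := by
  have h := prob_exists_eq p hf fun _ => True
  simp only [if_true] at h
  rw [← h]
  exact prob_le_one _ _

namespace Prover

variable {E : EncScheme} {T : TestFamily} (P : Prover E T) (κ : ℕ) (q : AliceQ (T.S κ))

theorem postState_eq (c : Bits (Fin (E.ctLen κ (T.len κ)))) (α : Bits (Fin (P.ansLen κ))) :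
    P.postState κ c α =
      Matrix.vecMulVec (P.A κ c α *ᵥ P.ψ κ) (star (P.A κ c α *ᵥ P.ψ κ)) := by
  rw [postState, Matrix.mul_vecMulVec, Matrix.vecMulVec_mul, Matrix.star_mulVec]

theorem sum_nsq_A (c : Bits (Fin (E.ctLen κ (T.len κ)))) :
    ∑ α, nsq (P.A κ c α *ᵥ P.ψ κ) = 1 := by
  have h : ((∑ α, nsq (P.A κ c α *ᵥ P.ψ κ) : ℝ) : ℂ) = (nsq (P.ψ κ) : ℂ) := by
    push_cast
    simp only [nsq_mulVec]
    rw [← dotProduct_sum, ← Matrix.sum_mulVec, (P.A_meas κ c).total, Matrix.one_mulVec,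
      nsq_eq_dotProduct]
  have h' : nsq (P.ψ κ) = 1 := P.ψ_norm κ
  rw [h'] at h
  exact_mod_cast h

section accept

variable {γ : Type} [Fintype γ] {N : γ → Op (Fin (P.m κ))}

theorem acceptProb_eq (hN : IsProjMeas N) (acc : List Bool → γ → Prop) :
    P.acceptProb κ q N acc = expect (E.gen κ) fun sk => expect (E.enc κ sk (T.code κ q)) fun c =>
      ∑ α, ∑ v, nsq (N v *ᵥ P.A κ c α *ᵥ P.ψ κ) *
        prob (E.dec κ sk (List.ofFn α)) {s | acc s v} := by
  simp only [acceptProb, postState_eq, hN.trace_mul_vecMulVec]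

theorem acceptProb_nonneg (hN : IsProjMeas N) (acc : List Bool → γ → Prop) :
    0 ≤ P.acceptProb κ q N acc := by
  rw [P.acceptProb_eq κ q hN]
  refine expect_nonneg _ fun sk => expect_nonneg _ fun c => Finset.sum_nonneg fun α _ =>
    Finset.sum_nonneg fun v _ => mul_nonneg (nsq_nonneg _) (prob_nonneg _ _)

theorem acceptProb_le_one (hN : IsProjMeas N) (acc : List Bool → γ → Prop) :
    P.acceptProb κ q N acc ≤ 1 := by
  classical
  rw [P.acceptProb_eq κ q hN]
  refine expect_le_one _ fun sk => expect_le_one _ fun c => ?_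
  rw [← P.sum_nsq_A κ c]
  refine Finset.sum_le_sum fun α _ => ?_
  rw [← hN.sum_nsq]
  exact Finset.sum_le_sum fun v _ => mul_le_of_le_one_right (nsq_nonneg _) (prob_le_one _ _)

end accept

/-- The probability that the decrypted answer has the given label, where `none` stands for all
answers of the wrong format. -/
def labelProb {β : Type} [Fintype β] (f : β → List Bool) (p : PMF (List Bool)) : Option β → ℝ
  | none => 1 - ∑ u, (p (f u)).toReal
  | some u => (p (f u)).toReal

theorem sum_labelProb {β : Type} [Fintype β] (f : β → List Bool) (p : PMF (List Bool)) :
    ∑ o, labelProb f p o = 1 := by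
  simp [Fintype.sum_option, labelProb]

/-- An encrypted state is a mixture of pure states labelled by the decrypted answers. -/
theorem exists_labels {β : Type} [Fintype β] {f : β → List Bool} (hf : Function.Injective f) :
    ∃ (I : Type) (_ : Fintype I) (p : I → ℝ) (v : I → Bits (Fin (P.m κ)) → ℂ)
      (lab : I → Option β), IsEnsemble (P.encState κ q) p v ∧ ∑ i, p i * nsq (v i) = 1 ∧
        ∀ (γ : Type) [Fintype γ] (N : γ → Op (Fin (P.m κ))) (_ : IsProjMeas N)
          (R : β → γ → Prop) [∀ o v, Decidable (∃ u, o = some u ∧ R u v)],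
          P.acceptProb κ q N (fun s v => ∃ u, s = f u ∧ R u v) =
            ∑ i, p i * ∑ w, if ∃ u, lab i = some u ∧ R u w then nsq (N w *ᵥ v i) else 0 := by
  classical
  -- The vectors do not depend on the label: decryption is classical postprocessing and only splits
  -- the weights. As the label weights sum to 1, forgetting the labels recovers the encrypted state.
  let p : Bits (Fin (E.keyLen κ)) × Bits (Fin (E.ctLen κ (T.len κ))) × Bits (Fin (P.ansLen κ)) ×
      Option β → ℝ := fun i => (E.gen κ i.1).toReal * ((E.enc κ i.1 (T.code κ q) i.2.1).toReal *
    labelProb f (E.dec κ i.1 (List.ofFn i.2.2.1)) i.2.2.2)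
  have hp : ∀ i, 0 ≤ p i := by
    rintro ⟨sk, c, α, o⟩
    refine mul_nonneg ENNReal.toReal_nonneg (mul_nonneg ENNReal.toReal_nonneg ?_)
    cases o with
    | none => exact sub_nonneg.2 (sum_prob_le_one _ hf)
    | some u => exact ENNReal.toReal_nonneg
  refine ⟨_, inferInstance, p, fun i => P.A κ i.2.1 i.2.2.1 *ᵥ P.ψ κ, fun i => i.2.2.2,
    ⟨hp, ?_⟩, ?_, ?_⟩
  · simp only [encState, expect, postState_eq, Fintype.sum_prod_type, p, Finset.smul_sum]
    refine Finset.sum_congr rfl fun sk _ => Finset.sum_congr rfl fun c _ =>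
      Finset.sum_congr rfl fun α _ => ?_
    rw [← Finset.sum_smul, ← Complex.ofReal_sum, ← Finset.mul_sum, ← Finset.mul_sum,
      sum_labelProb, mul_one, smul_smul, Complex.coe_smul]
  · simp only [Fintype.sum_prod_type, p, mul_assoc, ← Finset.mul_sum, ← Finset.sum_mul,
      sum_labelProb, one_mul, sum_nsq_A, mul_one, sum_toReal_eq_one]
  · intro γ _ N hN R _
    rw [P.acceptProb_eq κ q hN]
    simp only [Fintype.sum_prod_type, p, expect_eq_sum_mul, mul_assoc, ← Finset.mul_sum]
    refine Finset.sum_congr rfl fun sk _ => ?_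
    congr 1
    refine Finset.sum_congr rfl fun c _ => ?_
    congr 1
    refine Finset.sum_congr rfl fun α _ => ?_
    simp only [prob_exists_eq _ hf]
    simp only [Finset.mul_sum]
    rw [Finset.sum_comm]
    rw [Fintype.sum_option]
    simp only [labelProb, reduceCtorEq, false_and, exists_false, if_false, mul_zero,
      Finset.sum_const_zero, zero_add, Option.some.injEq, exists_eq_left']
    refine Finset.sum_congr rfl fun u _ => Finset.sum_congr rfl fun w _ => ?_
    split_ifs
    · rw [mul_comm]
    · simp

/-- If the observable that assigns signs `χ` to Bob's answers has the right value whenever the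
verifier accepts, then the labelled states are approximate eigenvectors. -/
theorem signErr_le_of_accept {I β γ : Type} [Fintype I] [Fintype γ]
    {p : I → ℝ} {v : I → Bits (Fin (P.m κ)) → ℂ} {lab : I → Option β}
    (hp : ∀ i, 0 ≤ p i) (h1 : ∑ i, p i * nsq (v i) = 1) {N : γ → Op (Fin (P.m κ))}
    (hN : IsProjMeas N) (R : β → γ → Prop) [∀ o v, Decidable (∃ u, o = some u ∧ R u v)]
    {χ : γ → ℂ} {s : Option β → ℂ} (hχ : ∀ w, ‖χ w‖ = 1) (hs : ∀ o, ‖s o‖ = 1)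
    (hR : ∀ u w, R u w → χ w = s (some u)) :
    signErr p v (obs N χ) (fun i => s (lab i)) ≤ 4 * (1 -
      ∑ i, p i * ∑ w, if ∃ u, lab i = some u ∧ R u w then nsq (N w *ᵥ v i) else 0) := by
  classical
  rw [← h1, ← Finset.sum_sub_distrib, Finset.mul_sum, signErr]
  refine Finset.sum_le_sum fun i _ => ?_
  rw [← mul_sub, mul_left_comm]
  refine mul_le_mul_of_nonneg_left ?_ (hp i)
  have h2 : obs N χ *ᵥ v i - s (lab i) • v i = obs N (fun w => χ w - s (lab i)) *ᵥ v i := by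
    rw [← obs_sub, hN.obs_const, Matrix.sub_mulVec, Matrix.smul_mulVec, Matrix.one_mulVec]
  rw [h2, hN.nsq_obs, ← hN.sum_nsq, ← Finset.sum_sub_distrib, Finset.mul_sum]
  refine Finset.sum_le_sum fun w _ => ?_
  have h0 := nsq_nonneg (N w *ᵥ v i)
  split_ifs with h
  · obtain ⟨u, hu, hRu⟩ := h
    rw [hu, hR u w hRu]
    simp
  -- Rejected outcomes are charged the trivial bound 2² = 4; this is the factor in the statement.
  · have h3 : ‖χ w - s (lab i)‖ ≤ 2 := by
      have := norm_sub_le (χ w) (s (lab i))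
      rw [hχ, hs] at this
      linarith
    have h4 : ‖χ w - s (lab i)‖ ^ 2 ≤ 4 := by nlinarith [norm_nonneg (χ w - s (lab i))]
    rw [sub_zero]
    exact mul_le_mul_of_nonneg_right h4 h0

end Prover

/-! ### The observables of a prover -/

/-- The sign `(-1)^b`. -/
def bitSign (b : Bool) : ℂ := if b then -1 else 1

theorem norm_bitSign (b : Bool) : ‖bitSign b‖ = 1 := by cases b <;> simp [bitSign]

theorem norm_chi {ι : Type} [Fintype ι] (a b : Bits ι) : ‖chi a b‖ = 1 := by
  rcases chi_eq_or a b with h | h <;> simp [h]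

theorem chi_eq_bitSign_dot {n : ℕ} (a v : Bits (Fin n)) : chi a v = bitSign (dot a v) := by
  rw [← neg_one_pow_overlap, bitSign, dot]
  rcases Nat.even_or_odd (overlap a v) with h | h
  · simp [h.neg_one_pow, Nat.even_iff.1 h]
  · simp [h.neg_one_pow, Nat.odd_iff.1 h]

/-- The observables that the prover measures: products of the bits of the answers to a pure basis
question, the answers to a question about the magic square, and products of the bits of the
answers to a mixed basis question. -/
inductive Observable {n : ℕ} (S : Finset (Bits (Fin n))) : Type
  | pauli (W : Basis) (a : Bits (Fin n))
  | cell (a b : S) (j : Fin 3 × Fin 3)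
  | mixed (w : Fin n → Pauli) (a : Bits (Fin n))

namespace Prover

variable {E : EncScheme} {T : TestFamily} (P : Prover E T) (κ : ℕ)

/-- The operator of an observable. -/
def opOf : Observable (T.S κ) → Op (Fin (P.m κ))
  | .pauli W a => obs (P.P κ W) (chi a)
  | .cell a b j => obs (P.B κ a b j) bitSign
  | .mixed w a => obs (P.M κ w) (chi a)

theorem obs_bitSign_sq {N : Bool → Op (Fin (P.m κ))} (hN : IsProjMeas N) :
    obs N bitSign * obs N bitSign = 1 := by
  rw [hN.obs_mul, ← hN.obs_one]
  congr 1
  funext v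
  cases v <;> simp [bitSign]

theorem obs_bitSign_herm {N : Bool → Op (Fin (P.m κ))} (hN : IsProjMeas N) :
    (obs N bitSign)ᴴ = obs N bitSign := by
  rw [hN.obs_conjTranspose]
  congr 1
  funext v
  cases v <;> simp [bitSign]

theorem opOf_herm (o : Observable (T.S κ)) : (P.opOf κ o)ᴴ = P.opOf κ o := by
  cases o with
  | pauli W a => exact (P.P_meas κ W).chi_herm a
  | cell a b j => exact P.obs_bitSign_herm κ (P.B_meas κ a b j)
  | mixed w a => exact (P.M_meas κ w).chi_herm a

theorem opOf_sq (o : Observable (T.S κ)) : P.opOf κ o * P.opOf κ o = 1 := by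
  cases o with
  | pauli W a => exact (P.P_meas κ W).chi_sq a
  | cell a b j => exact P.obs_bitSign_sq κ (P.B_meas κ a b j)
  | mixed w a => exact (P.M_meas κ w).chi_sq a

theorem stateNormSq_one_encState (q : AliceQ (T.S κ)) : stateNormSq 1 (P.encState κ q) = 1 := by
  obtain ⟨I, _, p, v, lab, h, h1, _⟩ :=
    P.exists_labels κ q (β := Unit) (f := fun _ => []) fun _ _ _ => rfl
  rw [h.stateNormSq_eq]
  simpa using h1

/-- The encrypted states cannot be distinguished by short words in the observables, up to `η`. -/
def WordIndist (η : ℝ) : Prop :=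
  ∀ (q q' : AliceQ (T.S κ)) (l : List (Observable (T.S κ))), l.length ≤ 16 →
    stateNormSq (1 - (l.map (P.opOf κ)).prod) (P.encState κ q) ≤
      stateNormSq (1 - (l.map (P.opOf κ)).prod) (P.encState κ q') + η

/-- The word model of a prover. -/
def wordModel {η : ℝ} (hη : P.WordIndist κ η) :
    WordModel (Bits (Fin (P.m κ))) (AliceQ (T.S κ)) (Observable (T.S κ)) where
  ρ := P.encState κ
  ev := P.opOf κ
  η := η
  herm := P.opOf_herm κ
  sq := P.opOf_sq κ
  isState q := by
    obtain ⟨I, i, p, v, lab, h, _⟩ :=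
      P.exists_labels κ q (β := Unit) (f := fun _ => []) fun _ _ _ => rfl
    exact ⟨I, i, p, v, h⟩
  norm_one := P.stateNormSq_one_encState κ
  indist := hη

/-! ### The pure and mixed basis questions -/

/-- The loss in the consistency check of the basis `W`. -/
def pureLoss (W : Basis) : ℝ :=
  1 - P.acceptProb κ (AliceQ.pure W) (P.P κ W) (fun s v => s = List.ofFn v)

/-- The loss in the comparison of the basis `W` with the string `w`. -/
def mixedLoss (W : Basis) (w : Fin (T.n κ) → Pauli) : ℝ :=
  1 - P.acceptProb κ (AliceQ.pure W) (P.M κ w) fun s v =>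
    ∃ u : Bits (Fin (T.n κ)), s = List.ofFn u ∧ ∀ i, w i = W.toPauli → u i = v i

theorem pureLoss_nonneg (W : Basis) : 0 ≤ P.pureLoss κ W :=
  sub_nonneg.2 (P.acceptProb_le_one κ _ (P.P_meas κ W) _)

theorem mixedLoss_nonneg (W : Basis) (w : Fin (T.n κ) → Pauli) : 0 ≤ P.mixedLoss κ W w :=
  sub_nonneg.2 (P.acceptProb_le_one κ _ (P.M_meas κ w) _)

theorem sum_basis (f : Basis → ℝ) : ∑ W, f W = f Basis.X + f Basis.Z := by
  have : (Finset.univ : Finset Basis) = {Basis.X, Basis.Z} := rfl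
  rw [this, Finset.sum_pair (by decide)]

theorem mixedPureWin_eq : P.mixedPureWin κ = 1 - (1 / 4) * ∑ W,
    (P.pureLoss κ W + expect (T.D κ) (P.mixedLoss κ W)) := by
  have h : ∀ W, expect (T.D κ) (P.mixedLoss κ W) = 1 - expect (T.D κ) fun w =>
      P.acceptProb κ (AliceQ.pure W) (P.M κ w) fun s v =>
        ∃ u : Bits (Fin (T.n κ)), s = List.ofFn u ∧ ∀ i, w i = W.toPauli → u i = v i :=
    fun W => expect_one_sub _ _
  simp only [mixedPureWin, pureLoss, h, sum_basis]
  ring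

theorem expect_mixedLoss_nonneg (W : Basis) : 0 ≤ expect (T.D κ) (P.mixedLoss κ W) :=
  expect_nonneg _ (P.mixedLoss_nonneg κ W)

theorem mixedPureWin_le_one : P.mixedPureWin κ ≤ 1 := by
  rw [mixedPureWin_eq, sum_basis]
  linarith [P.pureLoss_nonneg κ Basis.X, P.pureLoss_nonneg κ Basis.Z,
    P.expect_mixedLoss_nonneg κ Basis.X, P.expect_mixedLoss_nonneg κ Basis.Z]

theorem mixedPureWin_nonneg : 0 ≤ P.mixedPureWin κ := by
  refine mul_nonneg (by norm_num) (Finset.sum_nonneg fun W _ => add_nonneg ?_ ?_)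
  · exact mul_nonneg (by norm_num) (P.acceptProb_nonneg κ _ (P.P_meas κ W) _)
  · exact mul_nonneg (by norm_num)
      (expect_nonneg _ fun w => P.acceptProb_nonneg κ _ (P.M_meas κ w) _)

variable {ε : ℝ}

theorem pureLoss_le (h : 1 - ε ≤ P.mixedPureWin κ) (W : Basis) : P.pureLoss κ W ≤ 4 * ε := by
  rw [mixedPureWin_eq, sum_basis] at h
  have h1 := P.pureLoss_nonneg κ Basis.X
  have h2 := P.pureLoss_nonneg κ Basis.Z
  have h3 := P.expect_mixedLoss_nonneg κ Basis.X
  have h4 := P.expect_mixedLoss_nonneg κ Basis.Z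
  cases W <;> linarith

theorem expect_mixedLoss_le (h : 1 - ε ≤ P.mixedPureWin κ) (W : Basis) :
    expect (T.D κ) (P.mixedLoss κ W) ≤ 4 * ε := by
  rw [mixedPureWin_eq, sum_basis] at h
  have h1 := P.pureLoss_nonneg κ Basis.X
  have h2 := P.pureLoss_nonneg κ Basis.Z
  have h3 := P.expect_mixedLoss_nonneg κ Basis.X
  have h4 := P.expect_mixedLoss_nonneg κ Basis.Z
  cases W <;> linarith

theorem chi_restrict_congr {n : ℕ} {w : Fin n → Pauli} {W : Pauli} {u v : Bits (Fin n)}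
    (h : ∀ i, w i = W → u i = v i) (a : Bits (Fin n)) :
    chi (restrict w W a) v = chi (restrict w W a) u := by
  refine Finset.prod_congr rfl fun i _ => ?_
  by_cases hi : w i = W
  · rw [h i hi]
  · simp [restrict, hi]

/-- On the state after the question `W`, the pure and mixed basis measurements agree with the
decrypted answer. -/
theorem exists_pureEnsemble (W : Basis) :
    ∃ (I : Type) (_ : Fintype I) (p : I → ℝ) (v : I → Bits (Fin (P.m κ)) → ℂ)
      (u : I → Bits (Fin (T.n κ))), IsEnsemble (P.encState κ (AliceQ.pure W)) p v ∧
        (∀ a, signErr p v (obs (P.P κ W) (chi a)) (fun i => chi a (u i)) ≤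
          4 * P.pureLoss κ W) ∧
        ∀ w a, signErr p v (obs (P.M κ w) (chi (restrict w W.toPauli a)))
          (fun i => chi (restrict w W.toPauli a) (u i)) ≤ 4 * P.mixedLoss κ W w := by
  classical
  obtain ⟨I, _, p, v, lab, h, h1, hacc⟩ := P.exists_labels κ (AliceQ.pure W)
    (List.ofFn_injective (α := Bool) (n := T.n κ))
  -- Malformed answers are given the arbitrary label `zeros`: they are always rejected, so their
  -- sign is irrelevant. A single ensemble serves the pure and the mixed measurement, which makes
  -- the two comparable.
  refine ⟨I, inferInstance, p, v, fun i => (lab i).getD (zeros _), h, fun a => ?_, fun w a => ?_⟩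
  · have h2 := hacc _ (P.P κ W) (P.P_meas κ W) (fun u v => u = v)
    have h3 := P.signErr_le_of_accept κ (lab := lab) h.nonneg h1 (P.P_meas κ W)
      (fun u v => u = v) (χ := chi a) (s := fun o => chi a (o.getD (zeros _))) (norm_chi a)
      (fun _ => norm_chi _ _) (by rintro u w rfl; rfl)
    rw [← h2] at h3
    have h4 : (fun (s : List Bool) (v : Bits (Fin (T.n κ))) => ∃ u, s = List.ofFn u ∧ u = v) =
        fun s v => s = List.ofFn v := by
      funext s v
      simp
    rw [h4] at h3
    exact h3
  · have h2 := hacc _ (P.M κ w) (P.M_meas κ w) (fun u v => ∀ i, w i = W.toPauli → u i = v i)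
    have h3 := P.signErr_le_of_accept κ (lab := lab) h.nonneg h1 (P.M_meas κ w)
      (fun u v => ∀ i, w i = W.toPauli → u i = v i) (χ := chi (restrict w W.toPauli a))
      (s := fun o => chi (restrict w W.toPauli a) (o.getD (zeros _))) (norm_chi _)
      (fun _ => norm_chi _ _) (fun u v huv => chi_restrict_congr huv a)
    rw [← h2] at h3
    exact h3

variable {η : ℝ} (hη : P.WordIndist κ η)

theorem isSignState_pauli (h : 1 - ε ≤ P.mixedPureWin κ) (W : Basis) (a : Bits (Fin (T.n κ))) :
    IsSignState (P.encState κ (AliceQ.pure W)) (P.opOf κ (.pauli W a)) (16 * ε) := by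
  obtain ⟨I, i, p, v, u, hv, hP, _⟩ := P.exists_pureEnsemble κ W
  refine ⟨I, i, p, v, _, hv, fun _ => norm_chi _ _, (hP a).trans ?_⟩
  linarith [P.pureLoss_le κ h W]

/-- In the state of the question `W` both observables are close to the same decrypted sign, hence to
each other; one transfer to `q` adds η. -/
theorem gap_mixed_pauli_le (h : 1 - ε ≤ P.mixedPureWin κ) (W : Basis) (w : Fin (T.n κ) → Pauli)
    (a : Bits (Fin (T.n κ))) (q : AliceQ (T.S κ)) :
    (P.wordModel κ hη).gap q 0 [.mixed w (restrict w W.toPauli a)]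
      [.pauli W (restrict w W.toPauli a)] ≤ 8 * P.mixedLoss κ W w + 32 * ε + η := by
  obtain ⟨I, i, p, v, u, hv, hP, hM⟩ := P.exists_pureEnsemble κ W
  have h1 := (P.wordModel κ hη).gap_le_gap q (AliceQ.pure W) 0
    [.mixed w (restrict w W.toPauli a)] [.pauli W (restrict w W.toPauli a)] (by simp)
  have h2 := hv.stateNormSq_sub_le (A := obs (P.M κ w) (chi (restrict w W.toPauli a)))
    (B := obs (P.P κ W) (chi (restrict w W.toPauli a)))
    (s := fun i => chi (restrict w W.toPauli a) (u i))
    (t := fun i => chi (restrict w W.toPauli a) (u i)) ((-1) ^ 0) (by simp) (by simp)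
  have h3 : (P.wordModel κ hη).gap (AliceQ.pure W) 0 [.mixed w (restrict w W.toPauli a)]
      [.pauli W (restrict w W.toPauli a)] =
      stateNormSq (obs (P.M κ w) (chi (restrict w W.toPauli a)) -
        (-1 : ℂ) ^ 0 • obs (P.P κ W) (chi (restrict w W.toPauli a)))
        (P.encState κ (AliceQ.pure W)) := by
    simp [WordModel.gap, WordModel.word, wordModel, opOf]
  have h4 : (P.wordModel κ hη).η = η := rfl
  rw [h3, h4] at h1
  linarith [P.pureLoss_le κ h W, hP (restrict w W.toPauli a), hM w a]

/-! ### The braiding test -/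

/-- The observable about the cell `j` of the magic square. -/
def cellOb {n : ℕ} {S : Finset (Bits (Fin n))} (a b : S) (j : Fin 3 × Fin 3) : Observable S :=
  if j = (0, 1) then .pauli Basis.Z a.1 else if j = (1, 0) then .pauli Basis.X b.1
  else .cell a b j

/-- The sign of the cell at position `k` of the line `l` for a decrypted answer. -/
def lineSign (l : Line) (k : Fin 3) : Option (Bits (Fin 3)) → ℂ
  | none => bitSign (lineParity l)
  | some u => if ((u 0 ^^ u 1) ^^ u 2) = lineParity l then bitSign (u k)
      else bitSign (lineParity l)

theorem norm_lineSign (l : Line) (k : Fin 3) (o : Option (Bits (Fin 3))) :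
    ‖lineSign l k o‖ = 1 := by
  cases o with
  | none => exact norm_bitSign _
  | some u =>
    simp only [lineSign]
    split_ifs <;> exact norm_bitSign _

/-- The default value in `lineSign` makes the line relation exact for every label: invalid answers
get three signs +1 on a row and three signs -1 on a column. -/
theorem lineSign_mul (l : Line) (o : Option (Bits (Fin 3))) :
    lineSign l 0 o * lineSign l 1 o = (-1) ^ (lineParity l).toNat * lineSign l 2 o := by
  cases o with
  | none => cases l <;> simp [lineSign, bitSign, lineParity]
  | some u =>
    simp only [lineSign]
    split_ifs with h
    · rw [← h]
      cases u 0 <;> cases u 1 <;> cases u 2 <;> simp [bitSign]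
    · cases l <;> simp [bitSign, lineParity]

theorem squareRound_mem (a b : T.S κ) (l : Line) (j : Fin 3 × Fin 3) (k : Fin 3) :
    0 ≤ P.squareRound κ a b l j k ∧ P.squareRound κ a b l j k ≤ 1 := by
  unfold squareRound
  split_ifs
  · exact ⟨P.acceptProb_nonneg κ _ (P.P_meas κ _) _, P.acceptProb_le_one κ _ (P.P_meas κ _) _⟩
  · exact ⟨P.acceptProb_nonneg κ _ (P.P_meas κ _) _, P.acceptProb_le_one κ _ (P.P_meas κ _) _⟩
  · exact ⟨P.acceptProb_nonneg κ _ (P.B_meas κ _ _ _) _,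
      P.acceptProb_le_one κ _ (P.B_meas κ _ _ _) _⟩

/-- One ensemble serves all cells, so the signs at the three positions of the line come from the
same decrypted answer and can be multiplied. -/
theorem exists_squareEnsemble (a b : T.S κ) (l : Line) :
    ∃ (I : Type) (_ : Fintype I) (p : I → ℝ) (v : I → Bits (Fin (P.m κ)) → ℂ)
      (lab : I → Option (Bits (Fin 3))), IsEnsemble (P.encState κ (AliceQ.ms a b l)) p v ∧
        ∀ j k, signErr p v (P.opOf κ (cellOb a b j)) (fun i => lineSign l k (lab i)) ≤
          4 * (1 - P.squareRound κ a b l j k) := by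
  classical
  obtain ⟨I, _, p, v, lab, h, h1, hacc⟩ := P.exists_labels κ (AliceQ.ms a b l)
    (List.ofFn_injective (α := Bool) (n := 3))
  refine ⟨I, inferInstance, p, v, lab, h, fun j k => ?_⟩
  unfold squareRound cellOb
  split_ifs
  · rw [hacc _ (P.P κ Basis.Z) (P.P_meas κ Basis.Z)
      (fun u v => ((u 0 ^^ u 1) ^^ u 2) = lineParity l ∧ dot a.1 v = u k)]
    refine P.signErr_le_of_accept κ (lab := lab) h.nonneg h1 (P.P_meas κ Basis.Z) _
      (norm_chi _) (norm_lineSign l k) ?_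
    rintro u w ⟨hu, hw⟩
    rw [chi_eq_bitSign_dot, hw, lineSign, if_pos hu]
  · rw [hacc _ (P.P κ Basis.X) (P.P_meas κ Basis.X)
      (fun u v => ((u 0 ^^ u 1) ^^ u 2) = lineParity l ∧ dot b.1 v = u k)]
    refine P.signErr_le_of_accept κ (lab := lab) h.nonneg h1 (P.P_meas κ Basis.X) _
      (norm_chi _) (norm_lineSign l k) ?_
    rintro u w ⟨hu, hw⟩
    rw [chi_eq_bitSign_dot, hw, lineSign, if_pos hu]
  · rw [hacc _ (P.B κ a b j) (P.B_meas κ a b j)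
      (fun u v => ((u 0 ^^ u 1) ^^ u 2) = lineParity l ∧ v = u k)]
    refine P.signErr_le_of_accept κ (lab := lab) h.nonneg h1 (P.B_meas κ a b j) _
      norm_bitSign (norm_lineSign l k) ?_
    rintro u w ⟨hu, hw⟩
    rw [hw, lineSign, if_pos hu]

theorem opOf_isometry (o : Observable (T.S κ)) : (P.opOf κ o)ᴴ * P.opOf κ o = 1 := by
  rw [opOf_herm, opOf_sq]

theorem squareRound_ge (a b : T.S κ) (j : Fin 3 × Fin 3) :
    1 - P.squareRound κ a b (Line.row j.1) j j.2 ≤ 18 * (1 - P.anticomWin κ a b) ∧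
      1 - P.squareRound κ a b (Line.col j.2) j j.1 ≤ 18 * (1 - P.anticomWin κ a b) := by
  have h1 : 18 * (1 - P.anticomWin κ a b) = ∑ j : Fin 3 × Fin 3,
      ((1 - P.squareRound κ a b (Line.row j.1) j j.2) +
        (1 - P.squareRound κ a b (Line.col j.2) j j.1)) := by
    rw [anticomWin, Finset.sum_add_distrib, Finset.sum_sub_distrib, Finset.sum_sub_distrib,
      ← Finset.mul_sum, Finset.sum_add_distrib]
    simp
    ring
  have h2 := Finset.single_le_sum (f := fun j : Fin 3 × Fin 3 =>
    ((1 - P.squareRound κ a b (Line.row j.1) j j.2) +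
      (1 - P.squareRound κ a b (Line.col j.2) j j.1)))
    (fun j _ => add_nonneg (sub_nonneg.2 (P.squareRound_mem κ a b _ j _).2)
      (sub_nonneg.2 (P.squareRound_mem κ a b _ j _).2)) (Finset.mem_univ j)
  rw [h1]
  have h3 := (P.squareRound_mem κ a b (Line.row j.1) j j.2).2
  have h4 := (P.squareRound_mem κ a b (Line.col j.2) j j.1).2
  constructor <;> linarith

/-- Each cell has sign error at most 4δ, the product of two at most 16δ, and the comparison with the
third gives 2·16δ + 2·4δ = 40δ. -/
theorem gap_line_le (a b : T.S κ) (l : Line) (j₀ j₁ j₂ : Fin 3 × Fin 3) {δ : ℝ}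
    (h₀ : 1 - P.squareRound κ a b l j₀ 0 ≤ δ) (h₁ : 1 - P.squareRound κ a b l j₁ 1 ≤ δ)
    (h₂ : 1 - P.squareRound κ a b l j₂ 2 ≤ δ) (q : AliceQ (T.S κ)) :
    (P.wordModel κ hη).gap q (lineParity l).toNat [cellOb a b j₀, cellOb a b j₁]
      [cellOb a b j₂] ≤ 40 * δ + η := by
  obtain ⟨I, i, p, v, lab, hv, hs⟩ := P.exists_squareEnsemble κ a b l
  have h3 := signErr_mul_le (p := p) (v := v) (B := P.opOf κ (cellOb a b j₁))
    (s := fun i => lineSign l 0 (lab i)) (t := fun i => lineSign l 1 (lab i)) hv.nonneg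
    (P.opOf_isometry κ (cellOb a b j₀)) (fun i => norm_lineSign l 1 _)
  have h4 := hv.stateNormSq_sub_le
    (A := P.opOf κ (cellOb a b j₀) * P.opOf κ (cellOb a b j₁))
    (B := P.opOf κ (cellOb a b j₂))
    (s := fun i => lineSign l 0 (lab i) * lineSign l 1 (lab i))
    (t := fun i => lineSign l 2 (lab i)) ((-1) ^ (lineParity l).toNat) (by simp)
    (fun i => lineSign_mul l _)
  have h5 := (P.wordModel κ hη).gap_le_gap q (AliceQ.ms a b l) (lineParity l).toNat
    [cellOb a b j₀, cellOb a b j₁] [cellOb a b j₂] (by simp)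
  have h6 : (P.wordModel κ hη).gap (AliceQ.ms a b l) (lineParity l).toNat
      [cellOb a b j₀, cellOb a b j₁] [cellOb a b j₂] =
      stateNormSq (P.opOf κ (cellOb a b j₀) * P.opOf κ (cellOb a b j₁) -
        (-1 : ℂ) ^ (lineParity l).toNat • P.opOf κ (cellOb a b j₂))
        (P.encState κ (AliceQ.ms a b l)) := by
    simp [WordModel.gap, WordModel.word, wordModel]
  have h7 : (P.wordModel κ hη).η = η := rfl
  rw [h6, h7] at h5
  linarith [hs j₀ 0, hs j₁ 1, hs j₂ 2]

theorem gap_anticom_le (a b : T.S κ) (q : AliceQ (T.S κ)) :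
    (P.wordModel κ hη).gap q 1 [.pauli Basis.Z a.1, .pauli Basis.X b.1]
      [.pauli Basis.X b.1, .pauli Basis.Z a.1] ≤ 2000000 * (1 - P.anticomWin κ a b + η) := by
  -- A pair of a cell and a line through it is asked with probability 1/18.
  set δ := 18 * (1 - P.anticomWin κ a b) with hδ
  have hrow := fun j => (P.squareRound_ge κ a b j).1
  have hcol := fun j => (P.squareRound_ge κ a b j).2
  have h := (P.wordModel κ hη).magicSquare (q₀ := fun j => AliceQ.ms a b (Line.row j.1))
    (g := cellOb a b) (e := 4 * δ) (r := 40 * δ + η) (fun j => ?_)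
    (fun q i => P.gap_line_le κ hη a b (Line.row i) (i, 0) (i, 1) (i, 2) (hrow (i, 0))
      (hrow (i, 1)) (hrow (i, 2)) q)
    (fun q i => P.gap_line_le κ hη a b (Line.col i) (0, i) (1, i) (2, i) (hcol (0, i))
      (hcol (1, i)) (hcol (2, i)) q) q
  · have h7 : (P.wordModel κ hη).η = η := rfl
    have h8 := (P.wordModel κ hη).eta_nonneg q
    have h9 : 0 ≤ 1 - P.anticomWin κ a b := by
      have := (P.squareRound_mem κ a b (Line.row 0) (0, 0) 0).2
      have := hrow (0, 0)
      simp only at this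
      linarith
    rw [h7] at h h8
    have h10 : cellOb a b (0, 1) = .pauli Basis.Z a.1 := rfl
    have h11 : cellOb a b (1, 0) = .pauli Basis.X b.1 := by
      simp [cellOb]
    rw [h10, h11] at h
    linarith
  · obtain ⟨I, i, p, v, lab, hv, hs⟩ := P.exists_squareEnsemble κ a b (Line.row j.1)
    refine ⟨I, i, p, v, _, hv, fun _ => norm_lineSign _ j.2 _, (hs j j.2).trans ?_⟩
    linarith [hrow j]

theorem comWin_mem (a b : T.S κ) : 0 ≤ P.comWin κ a b ∧ P.comWin κ a b ≤ 1 := by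
  unfold comWin
  have h1 := fun W acc => P.acceptProb_nonneg κ (AliceQ.com a b) (P.P_meas κ W) acc
  have h2 := fun W acc => P.acceptProb_le_one κ (AliceQ.com a b) (P.P_meas κ W) acc
  constructor
  · exact mul_nonneg (by norm_num) (add_nonneg (h1 _ _) (h1 _ _))
  · linarith [h2 Basis.Z fun s v => ∃ ua ub : Bool, s = [ua, ub] ∧ dot a.1 v = ua,
      h2 Basis.X fun s v => ∃ ua ub : Bool, s = [ua, ub] ∧ dot b.1 v = ub]

theorem anticomWin_mem (a b : T.S κ) : 0 ≤ P.anticomWin κ a b ∧ P.anticomWin κ a b ≤ 1 := by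
  constructor
  · refine mul_nonneg (by norm_num) (Finset.sum_nonneg fun j _ => mul_nonneg (by norm_num) ?_)
    exact add_nonneg (P.squareRound_mem κ a b _ _ _).1 (P.squareRound_mem κ a b _ _ _).1
  · have h1 := (P.squareRound_ge κ a b (0, 0)).1
    have h2 := (P.squareRound_mem κ a b (Line.row 0) (0, 0) 0).2
    simp only at h1
    linarith

/-- Alice's answer fixes both signs at once, so ZX and XZ have the same approximate eigenvalue on
each piece of her state. -/
theorem gap_com_le (a b : T.S κ) (q : AliceQ (T.S κ)) :
    (P.wordModel κ hη).gap q 0 [.pauli Basis.Z a.1, .pauli Basis.X b.1]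
      [.pauli Basis.X b.1, .pauli Basis.Z a.1] ≤ 128 * (1 - P.comWin κ a b) + η := by
  classical
  have hf : Function.Injective fun u : Bool × Bool => [u.1, u.2] := by
    rintro ⟨x, y⟩ ⟨x', y'⟩ h
    simpa using h
  obtain ⟨I, _, p, v, lab, hv, h1, hacc⟩ := P.exists_labels κ (AliceQ.com a b) hf
  have hZ := P.signErr_le_of_accept κ (lab := lab) hv.nonneg h1 (P.P_meas κ Basis.Z)
    (fun u v => dot a.1 v = u.1) (χ := chi a.1)
    (s := fun o => bitSign (o.getD (false, false)).1) (norm_chi _) (fun _ => norm_bitSign _)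
    (by rintro u w hw; rw [chi_eq_bitSign_dot, hw]; rfl)
  have hX := P.signErr_le_of_accept κ (lab := lab) hv.nonneg h1 (P.P_meas κ Basis.X)
    (fun u v => dot b.1 v = u.2) (χ := chi b.1)
    (s := fun o => bitSign (o.getD (false, false)).2) (norm_chi _) (fun _ => norm_bitSign _)
    (by rintro u w hw; rw [chi_eq_bitSign_dot, hw]; rfl)
  rw [← hacc _ _ (P.P_meas κ Basis.Z)] at hZ
  rw [← hacc _ _ (P.P_meas κ Basis.X)] at hX
  have hwin : P.comWin κ a b = 1 / 2 *
      (P.acceptProb κ (AliceQ.com a b) (P.P κ Basis.Z)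
        (fun s v => ∃ u : Bool × Bool, s = [u.1, u.2] ∧ dot a.1 v = u.1) +
      P.acceptProb κ (AliceQ.com a b) (P.P κ Basis.X)
        (fun s v => ∃ u : Bool × Bool, s = [u.1, u.2] ∧ dot b.1 v = u.2)) := by
    simp only [comWin, Prod.exists]
  have hZ1 := P.acceptProb_le_one κ (AliceQ.com a b) (P.P_meas κ Basis.Z)
    (fun s v => ∃ u : Bool × Bool, s = [u.1, u.2] ∧ dot a.1 v = u.1)
  have hX1 := P.acceptProb_le_one κ (AliceQ.com a b) (P.P_meas κ Basis.X)
    (fun s v => ∃ u : Bool × Bool, s = [u.1, u.2] ∧ dot b.1 v = u.2)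
  set sZ : I → ℂ := fun i => bitSign ((lab i).getD (false, false)).1
  set sX : I → ℂ := fun i => bitSign ((lab i).getD (false, false)).2
  have h3 := signErr_mul_le (p := p) (v := v) (B := P.opOf κ (.pauli Basis.X b.1))
    (s := sZ) (t := sX) hv.nonneg (P.opOf_isometry κ (.pauli Basis.Z a.1))
    (fun i => norm_bitSign _)
  have h4 := signErr_mul_le (p := p) (v := v) (B := P.opOf κ (.pauli Basis.Z a.1))
    (s := sX) (t := sZ) hv.nonneg (P.opOf_isometry κ (.pauli Basis.X b.1))
    (fun i => norm_bitSign _)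
  have h5 := hv.stateNormSq_sub_le
    (A := P.opOf κ (.pauli Basis.Z a.1) * P.opOf κ (.pauli Basis.X b.1))
    (B := P.opOf κ (.pauli Basis.X b.1) * P.opOf κ (.pauli Basis.Z a.1))
    (s := fun i => sZ i * sX i) (t := fun i => sX i * sZ i) ((-1) ^ 0) (by simp)
    (fun i => by rw [pow_zero, one_mul, mul_comm])
  have h6 := (P.wordModel κ hη).gap_le_gap q (AliceQ.com a b) 0
    [.pauli Basis.Z a.1, .pauli Basis.X b.1] [.pauli Basis.X b.1, .pauli Basis.Z a.1] (by simp)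
  have h7 : (P.wordModel κ hη).gap (AliceQ.com a b) 0
      [.pauli Basis.Z a.1, .pauli Basis.X b.1] [.pauli Basis.X b.1, .pauli Basis.Z a.1] =
      stateNormSq (P.opOf κ (.pauli Basis.Z a.1) * P.opOf κ (.pauli Basis.X b.1) -
        (-1 : ℂ) ^ 0 • (P.opOf κ (.pauli Basis.X b.1) * P.opOf κ (.pauli Basis.Z a.1)))
        (P.encState κ (AliceQ.com a b)) := by
    simp [WordModel.gap, WordModel.word, wordModel]
  have h8 : (P.wordModel κ hη).η = η := rfl
  have hZ' : signErr p v (P.opOf κ (.pauli Basis.Z a.1)) sZ ≤ _ := hZ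
  have hX' : signErr p v (P.opOf κ (.pauli Basis.X b.1)) sX ≤ _ := hX
  rw [h7, h8] at h6
  rw [hwin]
  linarith

end Prover

/-! ### Commutation relations for all strings, and the constants -/

theorem sum_div_card_le {α : Type} {S : Finset α} (hS : S.Nonempty) {f g : α → ℝ} {A B : ℝ}
    (h : ∀ a ∈ S, f a ≤ A * g a + B) :
    (∑ a ∈ S, f a) / (S.card : ℝ) ≤ A * ((∑ a ∈ S, g a) / (S.card : ℝ)) + B := by
  have hc : (0 : ℝ) < S.card := by exact_mod_cast hS.card_pos
  rw [div_le_iff₀ hc]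
  refine (Finset.sum_le_sum h).trans (le_of_eq ?_)
  rw [Finset.sum_add_distrib, ← Finset.mul_sum, Finset.sum_const, nsmul_eq_mul]
  field_simp

/-- The constants of the bound that the small-bias argument produces. -/
def biasConst (μ K : ℝ) : ℝ := 4 / (1 - μ) * (2 * K + 32) + 33

/-- The constant of the rigidity theorem. -/
def rigidityConst (μ : ℝ) : ℝ :=
  1280 + 2 * (2 * biasConst μ (biasConst μ 2000000) + 131)

theorem biasConst_pos {μ K : ℝ} (hμ : μ < 1) (hK : 0 < K) : 0 < biasConst μ K := by
  have : 0 < 1 - μ := by linarith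
  unfold biasConst
  positivity

theorem rigidityConst_pos {μ : ℝ} (hμ : μ < 1) : 0 < rigidityConst μ := by
  have := biasConst_pos hμ (biasConst_pos hμ (by norm_num : (0 : ℝ) < 2000000))
  unfold rigidityConst
  positivity

namespace Prover

variable {E : EncScheme} {T : TestFamily} (P : Prover E T) (κ : ℕ)

/-- The loss in the braiding test for the strings `a` and `b`. -/
def roundLoss (a b : T.S κ) : ℝ :=
  1 - if dot a.1 b.1 = false then P.comWin κ a b else P.anticomWin κ a b

theorem roundLoss_mem (a b : T.S κ) : 0 ≤ P.roundLoss κ a b ∧ P.roundLoss κ a b ≤ 1 := by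
  unfold roundLoss
  have h1 := P.comWin_mem κ a b
  have h2 := P.anticomWin_mem κ a b
  split_ifs <;> constructor <;> linarith

theorem card_S_pos : (0 : ℝ) < (T.S κ).card := by
  exact_mod_cast (T.S_nonempty κ).card_pos

theorem braidingWin_eq : P.braidingWin κ = 1 - (∑ b : T.S κ, (∑ a : T.S κ, P.roundLoss κ a b) /
    ((T.S κ).card : ℝ)) / ((T.S κ).card : ℝ) := by
  have hc := card_S_pos (T := T) κ
  simp only [braidingWin, roundLoss]
  rw [Finset.sum_comm]
  simp only [Finset.sum_sub_distrib, ← Finset.sum_div]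
  simp
  field_simp
  ring

theorem braidingWin_mem : 0 ≤ P.braidingWin κ ∧ P.braidingWin κ ≤ 1 := by
  have hc := card_S_pos (T := T) κ
  constructor
  · refine mul_nonneg (by positivity) (Finset.sum_nonneg fun a _ => Finset.sum_nonneg fun b _ => ?_)
    split_ifs
    · exact (P.comWin_mem κ a b).1
    · exact (P.anticomWin_mem κ a b).1
  · rw [braidingWin_eq, sub_le_self_iff]
    exact div_nonneg (Finset.sum_nonneg fun b _ => div_nonneg
      (Finset.sum_nonneg fun a _ => (P.roundLoss_mem κ a b).1) hc.le) hc.le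

variable {η ε : ℝ} (hη : P.WordIndist κ η)

/-- The defect of the commutation relation between `Z(a)` and `X(b)`. -/
def braidGap (q : AliceQ (T.S κ)) (a b : Bits (Fin (T.n κ))) : ℝ :=
  (P.wordModel κ hη).gap q (overlap a b) [.pauli Basis.Z a, .pauli Basis.X b]
    [.pauli Basis.X b, .pauli Basis.Z a]

theorem braidGap_eq (q : AliceQ (T.S κ)) (a b : Bits (Fin (T.n κ))) :
    P.braidGap κ hη q a b = stateNormSq (obs (P.P κ Basis.Z) (chi a) *
      obs (P.P κ Basis.X) (chi b) - chi a b • (obs (P.P κ Basis.X) (chi b) *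
        obs (P.P κ Basis.Z) (chi a))) (P.encState κ q) := by
  simp [braidGap, WordModel.gap, WordModel.word, wordModel, opOf, neg_one_pow_overlap]

theorem braidGap_eq' (q : AliceQ (T.S κ)) (a b : Bits (Fin (T.n κ))) :
    P.braidGap κ hη q a b = stateNormSq (obs (P.P κ Basis.X) (chi b) *
      obs (P.P κ Basis.Z) (chi a) - chi b a • (obs (P.P κ Basis.Z) (chi a) *
        obs (P.P κ Basis.X) (chi b))) (P.encState κ q) := by
  rw [braidGap, WordModel.gap_symm]
  simp [WordModel.gap, WordModel.word, wordModel, opOf, neg_one_pow_overlap, chi_comm b a]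

theorem braidGap_le_braidGap (q q' : AliceQ (T.S κ)) (a b : Bits (Fin (T.n κ))) :
    P.braidGap κ hη q a b ≤ P.braidGap κ hη q' a b + η :=
  (P.wordModel κ hη).gap_le_gap q q' _ _ _ (by simp)

theorem braidGap_le_roundLoss (q : AliceQ (T.S κ)) (a b : T.S κ) :
    P.braidGap κ hη q a.1 b.1 ≤ 2000000 * (P.roundLoss κ a b + η) := by
  have hη0 : 0 ≤ η := (P.wordModel κ hη).eta_nonneg q
  unfold roundLoss
  by_cases hab : dot a.1 b.1 = false
  · rw [if_pos hab]
    -- The subtest is chosen by the parity of `overlap`, so the sign it certifies is (-1)^{a·b} in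
    -- either case.
    have h1 : (-1 : ℂ) ^ overlap a.1 b.1 = (-1) ^ 0 := by
      rw [neg_one_pow_overlap, chi_eq_bitSign_dot, hab]
      simp [bitSign]
    have h2 := P.gap_com_le κ hη a b q
    have h3 := (P.comWin_mem κ a b).2
    rw [WordModel.gap, ← h1] at h2
    change P.braidGap κ hη q a.1 b.1 ≤ _ at h2
    linarith
  · rw [if_neg hab]
    have hab' : dot a.1 b.1 = true := by simpa using hab
    have h1 : (-1 : ℂ) ^ overlap a.1 b.1 = (-1) ^ 1 := by
      rw [neg_one_pow_overlap, chi_eq_bitSign_dot, hab']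
      simp [bitSign]
    have h2 := P.gap_anticom_le κ hη a b q
    rw [WordModel.gap, ← h1] at h2
    exact h2

theorem avg_braidGap_le (hε : 1 - ε ≤ P.braidingWin κ) (q : AliceQ (T.S κ)) :
    (∑ b ∈ T.S κ, (∑ a ∈ T.S κ, P.braidGap κ hη q a b) / ((T.S κ).card : ℝ)) /
      ((T.S κ).card : ℝ) ≤ 2000000 * (ε + η) := by
  have hc := card_S_pos (T := T) κ
  rw [braidingWin_eq] at hε
  have hne : (Finset.univ : Finset (T.S κ)).Nonempty :=
    ⟨⟨_, (T.S_nonempty κ).choose_spec⟩, Finset.mem_univ _⟩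
  have hcard : (Finset.univ : Finset (T.S κ)).card = (T.S κ).card := by simp
  have h1 : ∀ b : T.S κ, (∑ a : T.S κ, P.braidGap κ hη q a.1 b.1) / ((T.S κ).card : ℝ) ≤
      2000000 * ((∑ a : T.S κ, P.roundLoss κ a b) / ((T.S κ).card : ℝ)) + 2000000 * η := by
    intro b
    rw [← hcard]
    refine sum_div_card_le hne fun a _ => ?_
    linarith [P.braidGap_le_roundLoss κ hη q a b]
  have h2 := sum_div_card_le hne fun b _ => h1 b
  rw [hcard] at h2
  have h3 : ∑ b ∈ T.S κ, (∑ a ∈ T.S κ, P.braidGap κ hη q a b) / ((T.S κ).card : ℝ) =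
      ∑ b : T.S κ, (∑ a : T.S κ, P.braidGap κ hη q a.1 b.1) / ((T.S κ).card : ℝ) := by
    rw [← Finset.sum_coe_sort]
    refine Finset.sum_congr rfl fun b _ => ?_
    rw [← Finset.sum_coe_sort]
  rw [h3]
  linarith

/-- All commutation relations of the Pauli group hold approximately. -/
theorem braidGap_le {μ : ℝ} (hμ : μ < 1) (hS : IsBiased μ (T.S κ))
    (hb : 1 - ε ≤ P.braidingWin κ) (hm : 1 - ε ≤ P.mixedPureWin κ) (q : AliceQ (T.S κ))
    (a b : Bits (Fin (T.n κ))) :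
    P.braidGap κ hη q a b ≤ biasConst μ (biasConst μ 2000000) * (ε + η) := by
  have hμ' : 0 < 1 - μ := by linarith
  have hc : 0 ≤ 4 / (1 - μ) := by positivity
  have hη0 : 0 ≤ η := (P.wordModel κ hη).eta_nonneg q
  have hε0 : 0 ≤ ε := by linarith [P.mixedPureWin_le_one κ]
  set K := biasConst μ 2000000 with hK
  have hcη : 0 ≤ 4 / (1 - μ) * η := by positivity
  -- First `a` is extended from the small-bias set to all strings, for each `b`, in the state of the
  -- question Z, where Z(a) acts as a sign; `b` stays averaged. Then `b` is extended in the same way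
  -- in the state of the question X. Each round replaces a constant `K` by `biasConst μ K`.
  have step1 : ∀ a₀ q, (∑ b ∈ T.S κ, P.braidGap κ hη q a₀ b) / ((T.S κ).card : ℝ) ≤
      K * (ε + η) := by
    intro a₀ q
    obtain ⟨I, i, p, v, u, hv, hP, _⟩ := P.exists_pureEnsemble κ Basis.Z
    have h1 : ∀ b, P.braidGap κ hη (AliceQ.pure Basis.Z) a₀ b ≤
        4 / (1 - μ) * (2 * ((∑ a ∈ T.S κ, P.braidGap κ hη (AliceQ.pure Basis.Z) a b) /
          ((T.S κ).card : ℝ)) + 2 * (16 * ε)) + 2 * (16 * ε) := by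
      intro b
      simp only [braidGap_eq]
      exact hv.extend_of_isBiased (P.P_meas κ Basis.Z)
        (fun a => (hP a).trans (by linarith [P.pureLoss_le κ hm Basis.Z]))
        ((P.P_meas κ Basis.X).chi_herm b) ((P.P_meas κ Basis.X).chi_sq b) b hμ hS
        (T.S_nonempty κ) a₀
    have h2 : ∀ b ∈ T.S κ, P.braidGap κ hη q a₀ b ≤ 4 / (1 - μ) * 2 *
        ((∑ a ∈ T.S κ, P.braidGap κ hη (AliceQ.pure Basis.Z) a b) / ((T.S κ).card : ℝ)) +
          (4 / (1 - μ) * (32 * ε) + 32 * ε + η) := by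
      intro b _
      have := P.braidGap_le_braidGap κ hη q (AliceQ.pure Basis.Z) a₀ b
      linarith [h1 b]
    have h3 := sum_div_card_le (T.S_nonempty κ) h2
    have h4 := P.avg_braidGap_le κ hη hb (AliceQ.pure Basis.Z)
    have h5 := mul_le_mul_of_nonneg_left h4 hc
    rw [hK, biasConst]
    linarith
  obtain ⟨I, i, p, v, u, hv, hP, _⟩ := P.exists_pureEnsemble κ Basis.X
  have h1 : P.braidGap κ hη (AliceQ.pure Basis.X) a b ≤
      4 / (1 - μ) * (2 * ((∑ b ∈ T.S κ, P.braidGap κ hη (AliceQ.pure Basis.X) a b) /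
        ((T.S κ).card : ℝ)) + 2 * (16 * ε)) + 2 * (16 * ε) := by
    simp only [braidGap_eq']
    exact hv.extend_of_isBiased (P.P_meas κ Basis.X)
      (fun a => (hP a).trans (by linarith [P.pureLoss_le κ hm Basis.X]))
      ((P.P_meas κ Basis.Z).chi_herm a) ((P.P_meas κ Basis.Z).chi_sq a) a hμ hS
      (T.S_nonempty κ) b
  have h2 := P.braidGap_le_braidGap κ hη q (AliceQ.pure Basis.X) a b
  have h3 := mul_le_mul_of_nonneg_left (step1 a (AliceQ.pure Basis.X)) hc
  rw [biasConst]
  linarith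

/-! ### Rigidity for a fixed value of the security parameter -/

/-- The isometry of the prover. -/
def isometry : Matrix (Bits (Fin (T.n κ)) × Fin (Fintype.card (Bits (Fin (P.m κ)))))
    (Bits (Fin (P.m κ))) ℂ :=
  swapIsometry (Fintype.equivFin (Bits (Fin (P.m κ)))).symm (P.P κ Basis.X) (P.P κ Basis.Z)

theorem isometry_isometry : (P.isometry κ)ᴴ * P.isometry κ = 1 :=
  swapIsometry_isometry _ (P.P_meas κ Basis.X) (P.P_meas κ Basis.Z)

/-- The operator `V† (A ⊗ 𝟙) V`. -/
def pullback (A : Op (Fin (T.n κ))) : Op (Fin (P.m κ)) :=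
  (P.isometry κ)ᴴ * (A ⊗ₖ (1 : Matrix (Fin (Fintype.card (Bits (Fin (P.m κ)))))
    (Fin (Fintype.card (Bits (Fin (P.m κ))))) ℂ)) * P.isometry κ

theorem pullback_pauliProj (w : Fin (T.n κ) → Pauli) (u : Bits (Fin (T.n κ))) :
    P.pullback κ (pauliProj w u) =
      ((2 : ℂ) ^ T.n κ)⁻¹ • ∑ a, chi u a • P.pullback κ (pauliString w a) := by
  have h : ∀ v v', pauliProj w u v v' =
      ∑ a, ((2 : ℂ) ^ T.n κ)⁻¹ * (chi u a * pauliString w a v v') := by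
    intro v v'
    rw [pauliProj_eq, avgBits, ← Complex.coe_smul, Matrix.smul_apply, Matrix.sum_apply,
      Finset.smul_sum]
    simp [neg_one_pow_overlap]
  simp only [pullback, isometry, swapIsometry_conj, h, Finset.smul_sum, Finset.sum_smul, smul_smul]
  conv_rhs => rw [Finset.sum_comm]
  refine Finset.sum_congr rfl fun v _ => ?_
  rw [Finset.sum_comm]

theorem mixedObs_eq (w : Fin (T.n κ) → Pauli) (a : Bits (Fin (T.n κ))) :
    P.mixedObs κ w a = obs (P.M κ w) (chi a) := by
  simp only [mixedObs, obs, neg_one_pow_overlap]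

/-- The factorisation is exact because outcomes with a 1 at an identity position vanish; on all
others the bits of `a` at such positions do not affect the sign. -/
theorem mixedObs_eq_mul (w : Fin (T.n κ) → Pauli) (a : Bits (Fin (T.n κ))) :
    P.mixedObs κ w a = obs (P.M κ w) (chi (restrict w Pauli.X a)) *
      obs (P.M κ w) (chi (restrict w Pauli.Z a)) := by
  rw [mixedObs_eq, (P.M_meas κ w).chi_mul, obs, obs]
  refine Finset.sum_congr rfl fun u _ => ?_
  by_cases hu : ∃ i, w i = Pauli.I ∧ u i = true
  · obtain ⟨i, hi, hui⟩ := hu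
    rw [P.M_zero κ w u i hi hui, smul_zero, smul_zero]
  · congr 1
    refine Finset.prod_congr rfl fun i _ => ?_
    have hi : w i = Pauli.I → u i = false := fun h => by
      by_contra hui
      exact hu ⟨i, h, by simpa using hui⟩
    have key : ∀ (W : Pauli) (x y : Bool), (W = Pauli.I → y = false) →
        (if x = true ∧ y = true then (-1 : ℂ) else 1) =
          if ((x && decide (W = Pauli.X)) ^^ (x && decide (W = Pauli.Z))) = true ∧ y = true then -1
          else 1 := by
      intro W x y h
      cases W
      · simp [h rfl]
      · simp
      · simp
    exact key (w i) (a i) (u i) hi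

/-- Fourier inversion, with the same coefficients as in `pullback_pauliProj`, so that Parseval's
identity applies to the difference. -/
theorem M_eq_sum_mixedObs (w : Fin (T.n κ) → Pauli) (u : Bits (Fin (T.n κ))) :
    P.M κ w u = ((2 : ℂ) ^ T.n κ)⁻¹ • ∑ a, chi u a • P.mixedObs κ w a := by
  simp only [mixedObs_eq, obs, Finset.smul_sum, smul_smul]
  rw [Finset.sum_comm]
  simp only [← Finset.sum_smul, ← Finset.mul_sum]
  have h : ∀ v : Bits (Fin (T.n κ)), ∑ a, chi u a * chi a v =
      if u = v then (2 : ℂ) ^ T.n κ else 0 := by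
    intro v
    have := sum_chi_mul_chi u v
    simp only [Fintype.card_fin] at this
    rw [← this]
    simp only [chi_comm u]
  simp [h]

include hη in
theorem stateNormSq_mixedObs_sub_le {μ : ℝ} (hμ : μ < 1) (hS : IsBiased μ (T.S κ))
    (hb : 1 - ε ≤ P.braidingWin κ) (hm : 1 - ε ≤ P.mixedPureWin κ) (q : AliceQ (T.S κ))
    (w : Fin (T.n κ) → Pauli) (a : Bits (Fin (T.n κ))) :
    stateNormSq (P.mixedObs κ w a - P.pullback κ (pauliString w a)) (P.encState κ q) ≤
      64 * P.mixedLoss κ Basis.X w + 32 * P.mixedLoss κ Basis.Z w + 896 * ε + 24 * η +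
        2 * (2 * biasConst μ (biasConst μ 2000000) + 131) * (ε + η) := by
  set aX := restrict w Pauli.X a with haX
  set aZ := restrict w Pauli.Z a with haZ
  set M := P.wordModel κ hη with hM
  have hη0 : 0 ≤ η := M.eta_nonneg q
  have hε0 : 0 ≤ ε := by linarith [P.mixedPureWin_le_one κ]
  -- The right factor is replaced by a pure basis observable first: this is left multiplication and
  -- costs nothing extra. Only then is the left factor replaced, since the right one is now Z(a_Z),
  -- which is a sign in the state of the question Z.
  have h1 : M.gap q 0 [.mixed w aX, .mixed w aZ] [.mixed w aX, .pauli Basis.Z aZ] ≤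
      8 * P.mixedLoss κ Basis.Z w + 32 * ε + η := by
    refine le_of_eq_of_le ?_ (P.gap_mixed_pauli_le κ hη hm Basis.Z w a q)
    exact M.gap_append_left q 0 [.mixed w aX] [.mixed w aZ] [.pauli Basis.Z aZ]
  have h2 : M.gap q 0 [.mixed w aX, .pauli Basis.Z aZ] [.pauli Basis.X aX, .pauli Basis.Z aZ] ≤
      2 * (8 * P.mixedLoss κ Basis.X w + 32 * ε + η) + 8 * (16 * ε) + 3 * η := by
    have h3 := M.gap_append_right (P.isSignState_pauli κ hm Basis.Z aZ) q 0 [.mixed w aX]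
      [.pauli Basis.X aX] (by simp)
    refine h3.trans ?_
    have h4 : M.η = η := rfl
    have h5 : M.gap q 0 [.mixed w aX] [.pauli Basis.X aX] ≤
        8 * P.mixedLoss κ Basis.X w + 32 * ε + η := P.gap_mixed_pauli_le κ hη hm Basis.X w a q
    rw [h4]
    linarith
  have h5 := M.gap_triangle q 0 0 [.mixed w aX, .mixed w aZ] [.mixed w aX, .pauli Basis.Z aZ]
    [.pauli Basis.X aX, .pauli Basis.Z aZ]
  have h6 : M.gap q (0 + 0) [.mixed w aX, .mixed w aZ] [.pauli Basis.X aX, .pauli Basis.Z aZ] =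
      stateNormSq (P.mixedObs κ w a -
        obs (P.P κ Basis.X) (chi aX) * obs (P.P κ Basis.Z) (chi aZ)) (P.encState κ q) := by
    rw [mixedObs_eq_mul]
    simp [WordModel.gap, WordModel.word, hM, wordModel, opOf, haX, haZ]
  have h7 : stateNormSq (obs (P.P κ Basis.X) (chi aX) * obs (P.P κ Basis.Z) (chi aZ) -
      P.pullback κ (pauliString w a)) (P.encState κ q) ≤
        (2 * biasConst μ (biasConst μ 2000000) + 131) * (ε + η) := by
    obtain ⟨I, _, p, v, hv⟩ := M.isState q
    refine stateNormSq_sub_swapIsometry_le _ (P.P_meas κ Basis.X) (P.P_meas κ Basis.Z) hv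
      (fun x b c => ?_) w a
    -- The extra factor Z(b) left by the average over `c` is absorbed in the state of the question
    -- Z; this costs 8·16ε + 3η and a factor 2.
    have h8 := M.gap_append_right (P.isSignState_pauli κ hm Basis.Z b) q (overlap c x)
      [.pauli Basis.X x, .pauli Basis.Z c] [.pauli Basis.Z c, .pauli Basis.X x] (by simp)
    have h9 := P.braidGap_le κ hη hμ hS hb hm q c x
    rw [braidGap, WordModel.gap_symm] at h9
    have h10 : M.gap q (overlap c x) ([.pauli Basis.X x, .pauli Basis.Z c] ++ [.pauli Basis.Z b])
        ([.pauli Basis.Z c, .pauli Basis.X x] ++ [.pauli Basis.Z b]) =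
        stateNormSq ((obs (P.P κ Basis.X) (chi x) * obs (P.P κ Basis.Z) (chi c) -
          chi c x • (obs (P.P κ Basis.Z) (chi c) * obs (P.P κ Basis.X) (chi x))) *
            obs (P.P κ Basis.Z) (chi b)) (P.encState κ q) := by
      simp [WordModel.gap, WordModel.word, hM, wordModel, opOf, neg_one_pow_overlap,
        Matrix.sub_mul, Matrix.mul_assoc]
    have h4 : M.η = η := rfl
    rw [h10, h4] at h8
    refine h8.trans ?_
    linarith
  have h11 := M.stateNormSq_add_le q (P.mixedObs κ w a -
    obs (P.P κ Basis.X) (chi aX) * obs (P.P κ Basis.Z) (chi aZ))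
    (obs (P.P κ Basis.X) (chi aX) * obs (P.P κ Basis.Z) (chi aZ) -
      P.pullback κ (pauliString w a))
  rw [sub_add_sub_cancel] at h11
  rw [h6] at h5
  refine h11.trans ?_
  change 2 * stateNormSq _ (P.encState κ q) + 2 * stateNormSq _ (P.encState κ q) ≤ _
  linarith

theorem avgBits_le {n : ℕ} {f : Bits (Fin n) → ℝ} {c : ℝ} (h : ∀ a, f a ≤ c) :
    avgBits f ≤ c := by
  rw [avgBits, smul_eq_mul, inv_mul_le_iff₀ (by positivity)]
  refine (Finset.sum_le_sum fun a _ => h a).trans (le_of_eq ?_)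
  simp

theorem rigidity {μ : ℝ} (hμ : μ < 1) (hS : IsBiased μ (T.S κ))
    (hb : 1 - ε ≤ P.braidingWin κ) (hm : 1 - ε ≤ P.mixedPureWin κ) (hη : P.WordIndist κ η)
    (q : AliceQ (T.S κ)) :
    expect (T.D κ) (fun w => avgBits fun a => stateNormSq
      (P.mixedObs κ w a - P.pullback κ (pauliString w a)) (P.encState κ q)) ≤
        rigidityConst μ * (ε + η) := by
  have hη0 : 0 ≤ η := (P.wordModel κ hη).eta_nonneg q
  have hε0 : 0 ≤ ε := by linarith [P.mixedPureWin_le_one κ]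
  refine (expect_mono _ fun w => avgBits_le fun a =>
    P.stateNormSq_mixedObs_sub_le κ hη hμ hS hb hm q w a).trans ?_
  simp only [add_assoc]
  rw [expect_add, expect_add, expect_const, expect_const_mul, expect_const_mul, rigidityConst]
  -- Each mean mixed loss is at most 4ε, so the terms in ε outside the isometry estimate add up to
  -- 64·4 + 32·4 + 896 = 1280.
  linarith [P.expect_mixedLoss_le κ hm Basis.X, P.expect_mixedLoss_le κ hm Basis.Z]

theorem rigidity_proj (q : AliceQ (T.S κ)) (S : Finset (Bits (Fin (T.n κ)))) :
    expect (T.D κ) (fun w => ∑ u ∈ S, stateNormSq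
      (P.M κ w u - P.pullback κ (pauliProj w u)) (P.encState κ q)) ≤
    expect (T.D κ) (fun w => avgBits fun a => stateNormSq
      (P.mixedObs κ w a - P.pullback κ (pauliString w a)) (P.encState κ q)) := by
  obtain ⟨I, _, p, v, lab, hv, _⟩ :=
    P.exists_labels κ q (β := Unit) (f := fun _ => []) fun _ _ _ => rfl
  refine expect_mono _ fun w => ?_
  rw [← hv.sum_stateNormSq_chi]
  refine (Finset.sum_le_sum_of_subset_of_nonneg (Finset.subset_univ S) fun u _ _ => ?_).trans
    (le_of_eq (Finset.sum_congr rfl fun u _ => ?_))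
  · rw [hv.stateNormSq_eq]
    exact Finset.sum_nonneg fun i _ => mul_nonneg (hv.nonneg i) (nsq_nonneg _)
  · rw [M_eq_sum_mixedObs, pullback_pauliProj, ← smul_sub, ← Finset.sum_sub_distrib]
    simp only [smul_sub]

end Prover

/-! ### Indistinguishability from the security of the encryption -/

theorem stateNormSq_expect {α X : Type} [Fintype α] [Fintype X] (p : PMF α) (A : Matrix X X ℂ)
    (ρ : α → Matrix X X ℂ) :
    stateNormSq A (expect p ρ) = expect p fun a => stateNormSq A (ρ a) := by
  simp only [stateNormSq, expect, Finset.mul_sum, Matrix.trace_sum, Complex.re_sum,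
    ← Complex.coe_smul, Matrix.mul_smul, Matrix.trace_smul]
  simp

theorem finite_observable {n : ℕ} (S : Finset (Bits (Fin n))) : Finite (Observable S) := by
  let f : Observable S → (Basis × Bits (Fin n)) ⊕ ((S × S × (Fin 3 × Fin 3)) ⊕
      ((Fin n → Pauli) × Bits (Fin n))) := fun o =>
    match o with
    | .pauli W a => Sum.inl (W, a)
    | .cell a b j => Sum.inr (Sum.inl (a, b, j))
    | .mixed w a => Sum.inr (Sum.inr (w, a))
  refine Finite.of_injective f ?_
  rintro (⟨W, a⟩ | ⟨a, b, j⟩ | ⟨w, a⟩) (⟨W', a'⟩ | ⟨a', b', j'⟩ | ⟨w', a'⟩) h <;> simp_all [f]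

namespace Prover

variable {E : EncScheme} {T : TestFamily} (P : Prover E T)

theorem stateNormSq_encState (κ : ℕ) (q : AliceQ (T.S κ)) (A : Op (Fin (P.m κ))) :
    stateNormSq A (P.encState κ q) = expect (E.gen κ) fun sk =>
      expect (E.enc κ sk (T.code κ q)) fun c => ∑ α, nsq (A *ᵥ P.A κ c α *ᵥ P.ψ κ) := by
  simp only [encState, stateNormSq_expect, postState_eq, ← stateNormSq_vecMulVec]
  simp only [stateNormSq, Finset.mul_sum, Matrix.trace_sum, Complex.re_sum]

theorem controlledAtCost_opOf {κ t : ℕ} (hP : ∀ W, MeasurableAtCost t (P.P κ W))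
    (hB : ∀ a b j, MeasurableAtCost t fun v : Bits Unit => P.B κ a b j (v ()))
    (hM : ∀ w, MeasurableAtCost t (P.M κ w)) (o : Observable (T.S κ)) :
    ControlledAtCost t (4 * t) (P.opOf κ o) := by
  cases o with
  | pauli W a => exact (hP W).controlled (P.P_meas κ W) a
  | cell a b j =>
    have hN := P.B_meas κ a b j
    have hN' : IsProjMeas fun v : Bits Unit => P.B κ a b j (v ()) :=
      { herm := fun v => hN.herm _
        idem := fun v => hN.idem _
        orth := fun v v' h => hN.orth _ _ fun h' => h (funext fun _ => h')
        total := by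
          rw [sum_bits_unit, ← hN.total, Fintype.sum_bool] }
    have h := (hB a b j).controlled hN' fun _ => true
    have heq : obs (fun v : Bits Unit => P.B κ a b j (v ())) (chi fun _ => true) =
        P.opOf κ (.cell a b j) := by
      rw [obs, sum_bits_unit, opOf, obs, Fintype.sum_bool]
      simp [chi, bitSign]
    rwa [heq] at h
  | mixed w a => exact (hM w).controlled (P.M_meas κ w) a

/-- Short words in the observables of an efficient prover distinguish the encryptions of different
questions at most with negligible advantage. -/
theorem exists_wordIndist (hE : E.Secure) (hP : P.Efficient) :
    ∃ η : ℕ → ℝ, Negligible η ∧ ∀ κ, P.WordIndist κ (η κ) := by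
  classical
  let F : ∀ κ, AliceQ (T.S κ) × AliceQ (T.S κ) × List (Observable (T.S κ)) → ℝ := fun κ x =>
    stateNormSq (1 - (x.2.2.map (P.opOf κ)).prod) (P.encState κ x.1) -
      stateNormSq (1 - (x.2.2.map (P.opOf κ)).prod) (P.encState κ x.2.1)
  -- One η must serve all questions and words. For each κ there are finitely many of them, so a
  -- worst triple exists; as security is nonuniform, it can be applied once to the sequence of worst
  -- triples.
  have hmax : ∀ κ, ∃ x : AliceQ (T.S κ) × AliceQ (T.S κ) × List (Observable (T.S κ)),
      x.2.2.length ≤ 16 ∧ ∀ y : AliceQ (T.S κ) × AliceQ (T.S κ) × List (Observable (T.S κ)),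
        y.2.2.length ≤ 16 → F κ y ≤ F κ x := by
    intro κ
    have := finite_observable (T.S κ)
    have : Finite (AliceQ (T.S κ)) := Finite.of_injective _ (T.code κ).injective
    have hfin : {x : AliceQ (T.S κ) × AliceQ (T.S κ) × List (Observable (T.S κ)) |
        x.2.2.length ≤ 16}.Finite := by
      refine ((Set.finite_univ (α := AliceQ (T.S κ))).prod
        ((Set.finite_univ (α := AliceQ (T.S κ))).prod
          (List.finite_length_le (Observable (T.S κ)) 16))).subset ?_
      rintro ⟨q, q', l⟩ h
      exact ⟨trivial, trivial, h⟩
    obtain ⟨x, hx, hx'⟩ := Set.exists_max_image _ (F κ) hfin ⟨(AliceQ.tele, AliceQ.tele, []),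
      Nat.zero_le _⟩
    exact ⟨x, hx, fun y hy => hx' y hy⟩
  choose x hx hxmax using hmax
  obtain ⟨p, hp⟩ := hP
  obtain ⟨p', hp'⟩ := T.len_poly
  have hA := fun κ => (hp κ).1
  choose r C hcost hC using hA
  have hword : ∀ κ, ControlledAtCost (p.eval κ) (16 * (4 * p.eval κ))
      ((x κ).2.2.map (P.opOf κ)).prod := by
    intro κ
    have h := ControlledAtCost.list_prod ((x κ).2.2.map (P.opOf κ)) (r := p.eval κ)
      (g := 4 * p.eval κ) (by
        intro U hU
        obtain ⟨o, _, rfl⟩ := List.mem_map.1 hU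
        exact P.controlledAtCost_opOf (hp κ).2.1 (hp κ).2.2.1 (hp κ).2.2.2 o)
    obtain ⟨D, hD, hD'⟩ := h
    refine ⟨D, hD.trans ?_, hD'⟩
    rw [List.length_map]
    exact Nat.mul_le_mul_right _ (hx κ)
  have htest := fun κ => exists_hadamardTest (hword κ) (C κ) (P.A κ) (hC κ) (P.ψ κ)
  choose D out hD hout using htest
  -- Wires and gates of the first measurement cost p, the ancillas of the word p, its gates 16·4p,
  -- and the control qubit and Hadamard gate 2; `p'` bounds the message length.
  have hsec := hE (p' + 66 * p + 2) T.len (fun κ => T.code κ (x κ).1) (fun κ => T.code κ (x κ).2.1)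
    (fun κ => TestWires (Fin (P.ansLen κ)) (Fin (P.m κ)) (r κ) (p.eval κ))
    (fun κ => hadamardAdvice (Fin (P.ansLen κ)) (r κ) (p.eval κ) (P.ψ κ)) D out
    (fun κ => by
      have := hp' κ
      simp only [Polynomial.eval_add, Polynomial.eval_mul]
      omega)
    (fun κ => by
      have h1 := hcost κ
      have h2 := hD κ
      rw [Circuit.cost_eq] at h1 ⊢
      simp only [Fintype.card_sum, Fintype.card_fin, Fintype.card_unit] at h1 ⊢
      simp only [Polynomial.eval_add, Polynomial.eval_mul, Polynomial.eval_ofNat]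
      omega)
    (fun κ => hadamardAdvice_norm (P.ψ_norm κ))
  -- The factor 4 undoes the 1/4 in the acceptance probability of the Hadamard test.
  refine ⟨_, hsec.const_mul 4, fun κ q q' l hl => ?_⟩
  have h1 := hxmax κ (q, q', l) hl
  have h2 : F κ (x κ) = 4 * (expect (E.gen κ) (fun sk =>
      expect (E.enc κ sk (T.code κ (x κ).1)) (outputProb (D κ) (out κ)
        (hadamardAdvice (Fin (P.ansLen κ)) (r κ) (p.eval κ) (P.ψ κ)))) -
      expect (E.gen κ) (fun sk =>
        expect (E.enc κ sk (T.code κ (x κ).2.1)) (outputProb (D κ) (out κ)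
          (hadamardAdvice (Fin (P.ansLen κ)) (r κ) (p.eval κ) (P.ψ κ))))) := by
    have h3 : outputProb (D κ) (out κ)
        (hadamardAdvice (Fin (P.ansLen κ)) (r κ) (p.eval κ) (P.ψ κ)) = fun c =>
          1 / 4 * ∑ α, nsq ((1 - ((x κ).2.2.map (P.opOf κ)).prod) *ᵥ P.A κ c α *ᵥ P.ψ κ) :=
      funext (hout κ)
    simp only [h3, expect_const_mul, F, stateNormSq_encState]
    ring
  have h4 := le_abs_self (expect (E.gen κ) (fun sk =>
      expect (E.enc κ sk (T.code κ (x κ).1)) (outputProb (D κ) (out κ)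
        (hadamardAdvice (Fin (P.ansLen κ)) (r κ) (p.eval κ) (P.ψ κ)))) -
      expect (E.gen κ) (fun sk =>
        expect (E.enc κ sk (T.code κ (x κ).2.1)) (outputProb (D κ) (out κ)
          (hadamardAdvice (Fin (P.ansLen κ)) (r κ) (p.eval κ) (P.ψ κ)))))
  rw [h2] at h1
  simp only [F] at h1
  linarith

end Prover

end

end CompiledPauli

theorem mainTheorem12 (μ : ℝ) (hμ : μ < 1) :
    ∃ K : ℝ, 0 < K ∧
      ∀ (E : EncScheme) (_ : E.Secure) (T : TestFamily) (_ : ∀ κ, IsBiased μ (T.S κ))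
        (P : Prover E T) (_ : P.Efficient) (ε : ℕ → ℝ)
        (_ : ∀ κ, 1 - ε κ ≤ P.braidingWin κ) (_ : ∀ κ, 1 - ε κ ≤ P.mixedPureWin κ),
        ∃ (d : ℕ → ℕ)
          (V : ∀ κ, Matrix (Bits (Fin (T.n κ)) × Fin (d κ)) (Bits (Fin (P.m κ))) ℂ),
          (∀ κ, (V κ)ᴴ * V κ = 1) ∧
          ∃ η : ℕ → ℝ, Negligible η ∧
            ∀ (κ : ℕ) (q : AliceQ (T.S κ)),
              (expect (T.D κ) (fun w => avgBits fun a =>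
                  stateNormSq
                    (P.mixedObs κ w a -
                      (V κ)ᴴ * (pauliString w a ⊗ₖ (1 : Matrix (Fin (d κ)) (Fin (d κ)) ℂ)) * V κ)
                    (P.encState κ q))
                ≤ K * √(ε κ) + η κ) ∧
              ∀ S : Finset (Bits (Fin (T.n κ))),
                expect (T.D κ) (fun w => ∑ u ∈ S,
                    stateNormSq
                      (P.M κ w u -
                        (V κ)ᴴ * (pauliProj w u ⊗ₖ (1 : Matrix (Fin (d κ)) (Fin (d κ)) ℂ)) * V κ)
                      (P.encState κ q))
                  ≤ K * √(ε κ) + η κ := by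
  refine ⟨rigidityConst μ, rigidityConst_pos hμ, ?_⟩
  intro E hE T hS P hP ε hb hm
  obtain ⟨η, hη, hind⟩ := P.exists_wordIndist hE hP
  refine ⟨fun κ => Fintype.card (Bits (Fin (P.m κ))), P.isometry, P.isometry_isometry,
    fun κ => rigidityConst μ * η κ, hη.const_mul _, fun κ q => ?_⟩
  -- Capping ε at 1 is harmless, as winning probabilities are nonnegative. The bound linear in
  -- min(ε, 1) is then at most one in √ε, also when ε > 1.
  have hb' : 1 - min (ε κ) 1 ≤ P.braidingWin κ := by
    rcases min_choice (ε κ) 1 with h | h <;> rw [h]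
    · exact hb κ
    · simpa using (P.braidingWin_mem κ).1
  have hm' : 1 - min (ε κ) 1 ≤ P.mixedPureWin κ := by
    rcases min_choice (ε κ) 1 with h | h <;> rw [h]
    · exact hm κ
    · simpa using P.mixedPureWin_nonneg κ
  have hε0 : 0 ≤ ε κ := by linarith [hm κ, P.mixedPureWin_le_one κ]
  have hsqrt : min (ε κ) 1 ≤ √(ε κ) := by
    rcases le_total (ε κ) 1 with h | h
    · rw [min_eq_left h]
      exact Real.le_sqrt_of_sq_le (by nlinarith)
    · rw [min_eq_right h]
      exact Real.one_le_sqrt.2 h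
  have h1 := P.rigidity κ hμ (hS κ) hb' hm' (hind κ) q
  have h2 := mul_le_mul_of_nonneg_left hsqrt (rigidityConst_pos hμ).le
  have h3 : rigidityConst μ * (min (ε κ) 1 + η κ) ≤
      rigidityConst μ * √(ε κ) + rigidityConst μ * η κ := by linarith
  exact ⟨h1.trans h3, fun S => (P.rigidity_proj κ q S).trans (h1.trans h3)⟩
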